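/- Let $C>0$, $p>0$, and let $a_k>0$ ($k\ge 1$) satisfy $a_k\sim Ck^{p-1}$ as $k\to\infty$. For $N\ge 0$ let $\mu_N$ be the Gibbs distribution on the partitions $\eta$ of $N$, $\mu_N(\eta)=c_N^{-1}\prod_{k=1}^N a_k^{n_k}/n_k!$, where $n_k=n_k(\eta)$ is the number of parts of $\eta$ equal to $k$ and $c_N$ is the normalizing constant. Let $q\ge 1$, $0=u_0<u_1<\dots<u_q$, $u_{q+1}=\infty$, $r_N=\left(C\Gamma(p+1)\right)^{-1/(p+1)}N^{1/(p+1)}$, $M_j=[u_jr_N]$ for $0\le j\le q$, $M_{q+1}=N+1$, and put, with all sums restricted to $1\le k\le N$, $$\nu_j^\star=\sum_{M_j\le k<M_{j+1}}n_k,\qquad K_j^\star=\sum_{M_j\le k<M_{j+1}}kn_k,\qquad 0\le j\le q .$$ Let $\delta_N$ be real numbers with $\sum_{k=1}^N ka_ke^{-\delta_N k}=N+o\big(N^{(p+2)/(2(p+1))}\big)$ as $N\to\infty$; for $N\ge 1$ one may take for $\delta_N$ the unique solution of $\sum_{k=1}^N ka_ke^{-\delta_N k}=N$. Put $$S_j^\star=\sum_{M_j\le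 k<M_{j+1}}a_ke^{-\delta_Nk},\quad E_j^\star=\sum_{M_j\le k<M_{j+1}}ka_ke^{-\delta_Nk},\quad S_0=S_0^\star,\quad V_0=\sum_{M_0\le k<M_1}k^2a_ke^{-\delta_Nk},$$ $$f_j(s)=C\int_{u_j}^{u_{j+1}}x^se^{-x}\,dx\quad(s>-1),$$ $$\hat\nu_j^\star=\sqrt{f_0(p-1)}\,\frac{\nu_j^\star-S_j^\star}{\sqrt{S_0}},\qquad \hat K_j^\star=\sqrt{f_0(p+1)}\,\frac{K_j^\star-E_j^\star}{\sqrt{V_0}},\qquad 0\le j\le q,$$ where, for those small $N$ with $S_0=V_0=0$, the quotients are read as $0$. (i) For every $N$, the random variables $\hat\nu_0^\star,\dots,\hat\nu_q^\star$ are conditionally independent under $\mu_N$ given $(\hat K_0^\star,\dots,\hat K_q^\star)$. Moreover, for all real $x_j,y_j$ with $\mathbb P(\hat K_j^\star=y_j,\ 0\le j\le q)>0$, $$\mathbb P\big(\hat\nu_j^\star=x_j,\,0\le j\le q\,\big|\,\hat K_j^\star=y_j,\,0\le j\le q\big)=\prod_{j=0}^q\mathbb P\big(\hat\nu_j^\star=x_j\,\big|\,\hat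 K_j^\star=y_j\big).$$ (ii) As $N\to\infty$, the $(2q+1)$-dimensional random vector $(\hat\nu_0^\star,\dots,\hat\nu_q^\star,\hat K_1^\star,\dots,\hat K_q^\star)$ converges weakly to the Gaussian vector with mean zero and covariance matrix $\{\vartheta^\star_{mk}(q)\}_{m,k=0}^{2q}$ (which is positive semidefinite), where $$\vartheta^\star_{mk}(q)=\begin{cases} f_m(p-1)\mathbf 1_{m=k}-\dfrac{f_m(p)f_k(p)}{C\,\Gamma(p+2)},&0\le m,k\le q,\\[2mm] f_m(p)\mathbf 1_{m=k-q}-\dfrac{f_m(p)f_{k-q}(p+1)}{C\,\Gamma(p+2)},&0\le m\le q<k\le 2q,\\[2mm] f_k(p)\mathbf 1_{k=m-q}-\dfrac{f_k(p)f_{m-q}(p+1)}{C\,\Gamma(p+2)},&0\le k\le q<m\le 2q,\\[2mm] f_{m-q}(p+1)\mathbf 1_{m=k}-\dfrac{f_{m-q}(p+1)f_{k-q}(p+1)}{C\,\Gamma(p+2)},&q<m,k\le 2q. \end{cases}$$ (iii) As $N\to\infty$, all (mixed) moments of the random vector in (ii) converge to the corresponding moments of the limiting Gaussian vector; in particular the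 covariances of its coordinates $m$ and $k$ converge to $\vartheta^\star_{mk}(q)$ for all $0\le m,k\le 2q$. (iv) Let the points be equidistant, $u_j=jd$ with $d>0$ fixed. There is a constant $A$, depending only on $C$, $p$, $d$, such that for all $q\ge 1$ and $0\le m<k\le 2q$ $$|\vartheta^\star_{mk}(q)|\le\begin{cases}A\,u_k^{p}e^{-u_k},&k\le q,\\ A\,u_{k-q}^{p+1}e^{-u_{k-q}},&k>q.\end{cases}$$ Moreover, for fixed $m$ and $q$, $|\vartheta^\star_{mk}(q)|$ is strictly decreasing in $k>m$ on the range $u_k\ge p$, $k<q$, and also on the range $k>q$, $u_{k-q}\ge p+1$, $k<2q$, in the following sense: if $k<k'$ both lie in the same one of these two ranges and $k'\ne m+q$, then $|\vartheta^\star_{mk'}(q)|<|\vartheta^\star_{mk}(q)|$. -/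

import Mathlib

open MeasureTheory ProbabilityTheory Filter Asymptotics
open scoped Topology

namespace GibbsPartition

instance instMeasurableSpacePartition (N : ℕ) : MeasurableSpace N.Partition := ⊤

instance instDiscretePartition (N : ℕ) : DiscreteMeasurableSpace N.Partition := ⟨fun _ => trivial⟩

/-- The number `n_k(η)` of parts of `η` that are equal to `k`. -/
def mult {N : ℕ} (η : N.Partition) (k : ℕ) : ℕ := η.parts.count k

/-- The unnormalised Gibbs weight `∏ a_k ^ n_k / n_k!` of a partition of `N`. -/
noncomputable def weight (a : ℕ → ℝ) {N : ℕ} (η : N.Partition) : ℝ :=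
  ∏ k ∈ Finset.Icc 1 N, a k ^ mult η k / (Nat.factorial (mult η k) : ℝ)

/-- The partition function `c_N`. -/
noncomputable def partitionFunction (a : ℕ → ℝ) (N : ℕ) : ℝ := ∑ η : N.Partition, weight a η

theorem weight_pos {a : ℕ → ℝ} (ha : ∀ k, 1 ≤ k → 0 < a k) {N : ℕ} (η : N.Partition) :
    0 < weight a η := by
  refine Finset.prod_pos fun k hk => ?_
  have := ha k (Finset.mem_Icc.1 hk).1
  positivity

theorem partitionFunction_pos {a : ℕ → ℝ} (ha : ∀ k, 1 ≤ k → 0 < a k) (N : ℕ) :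
    0 < partitionFunction a N :=
  Finset.sum_pos (fun η _ => weight_pos ha η) ⟨default, Finset.mem_univ _⟩

/-- The Gibbs distribution `μ_N(η) = c_N⁻¹ ∏ a_k ^ n_k / n_k!` on the partitions of `N`. -/
noncomputable def gibbs (a : ℕ → ℝ) (ha : ∀ k, 1 ≤ k → 0 < a k) (N : ℕ) : PMF N.Partition :=
  PMF.ofFintype (fun η => ENNReal.ofReal (weight a η / partitionFunction a N)) (by
    have hc := partitionFunction_pos ha N
    rw [← ENNReal.ofReal_sum_of_nonneg fun η _ => (div_pos (weight_pos ha η) hc).le,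
      ← Finset.sum_div, ← partitionFunction, div_self hc.ne', ENNReal.ofReal_one])

/-- The Gibbs distribution as a measure. -/
noncomputable def gibbsMeasure (a : ℕ → ℝ) (ha : ∀ k, 1 ≤ k → 0 < a k) (N : ℕ) :
    Measure N.Partition := (gibbs a ha N).toMeasure

instance instIsProbabilityMeasureGibbs (a : ℕ → ℝ) (ha : ∀ k, 1 ≤ k → 0 < a k) (N : ℕ) :
    IsProbabilityMeasure (gibbsMeasure a ha N) := by
  unfold gibbsMeasure
  infer_instance

/-- The scaling factor `r_N = h⁻¹ N ^ (1 / (p + 1))`, where `h = (C Γ(p + 1)) ^ (1 / (p + 1))`. -/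
noncomputable def scaling (C p : ℝ) (N : ℕ) : ℝ :=
  ((C * Real.Gamma (p + 1)) ^ (1 / (p + 1)))⁻¹ * (N : ℝ) ^ (1 / (p + 1))

/-- The stratification point `M_j = [u_j r_N]`. -/
noncomputable def stratPoint (C p : ℝ) (u : ℕ → ℝ) (N j : ℕ) : ℕ := ⌊u j * scaling C p N⌋₊

/-- The `j`-th stratum: the sizes `k` in `{1, …, N}` with `M_j ≤ k < M_{j+1}`, where
`M_{q+1} = N + 1`, so that for `j = q` the upper bound is void. -/
noncomputable def stratum (C p : ℝ) (u : ℕ → ℝ) (q N j : ℕ) : Finset ℕ :=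
  {k ∈ Finset.Icc 1 N | stratPoint C p u N j ≤ k ∧ (j < q → k < stratPoint C p u N (j + 1))}

/-- The number `ν*_j(η)` of components with size in the `j`-th stratum. -/
noncomputable def count (C p : ℝ) (u : ℕ → ℝ) (q j : ℕ) {N : ℕ} (η : N.Partition) : ℕ :=
  ∑ k ∈ stratum C p u q N j, mult η k

/-- The total mass `K*_j(η)` of the components with size in the `j`-th stratum. -/
noncomputable def mass (C p : ℝ) (u : ℕ → ℝ) (q j : ℕ) {N : ℕ} (η : N.Partition) : ℕ :=
  ∑ k ∈ stratum C p u q N j, k * mult η k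

/-- The sum of `k ^ r a_k e ^ (-δ k)` over the `j`-th stratum;
it is `S*_j`, `E*_j`, `V*_j` for `r = 0, 1, 2`. -/
noncomputable def stratSum (a : ℕ → ℝ) (C p : ℝ) (u : ℕ → ℝ) (q : ℕ) (δ : ℝ) (N j r : ℕ) : ℝ :=
  ∑ k ∈ stratum C p u q N j, (k : ℝ) ^ r * a k * Real.exp (-δ * k)

/-- `f_j(s) = C ∫ x ^ s e ^ (-x)` over `(u_j, u_{j+1})`, where `u_{q+1} = ∞`. -/
noncomputable def fInt (C : ℝ) (u : ℕ → ℝ) (q j : ℕ) (s : ℝ) : ℝ :=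
  C * ∫ x in (if j < q then Set.Ioo (u j) (u (j + 1)) else Set.Ioi (u j)), x ^ s * Real.exp (-x)

/-- The scaled count of the `j`-th stratum. -/
noncomputable def scaledCount (a : ℕ → ℝ) (C p : ℝ) (u : ℕ → ℝ) (q : ℕ) (δ : ℝ) (j : ℕ) {N : ℕ}
    (η : N.Partition) : ℝ :=
  √(fInt C u q 0 (p - 1)) * (((count C p u q j η : ℝ) - stratSum a C p u q δ N j 0)
    / √(stratSum a C p u q δ N 0 0))

/-- The scaled mass of the `j`-th stratum. -/
noncomputable def scaledMass (a : ℕ → ℝ) (C p : ℝ) (u : ℕ → ℝ) (q : ℕ) (δ : ℝ) (j : ℕ) {N : ℕ}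
    (η : N.Partition) : ℝ :=
  √(fInt C u q 0 (p + 1)) * (((mass C p u q j η : ℝ) - stratSum a C p u q δ N j 1)
    / √(stratSum a C p u q δ N 0 2))

/-- The `(2q+1)`-dimensional vector of the scaled counts of the strata `0, …, q` (coordinates
`0, …, q`) and the scaled masses of the strata `1, …, q` (coordinates `q + 1, …, 2q`). -/
noncomputable def scaledVector (a : ℕ → ℝ) (C p : ℝ) (u : ℕ → ℝ) (q : ℕ) (δ : ℝ) {N : ℕ}
    (η : N.Partition) : EuclideanSpace ℝ (Fin (2 * q + 1)) :=
  WithLp.toLp 2 fun i => if (i : ℕ) ≤ q then scaledCount a C p u q δ i η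
    else scaledMass a C p u q δ (i - q) η

/-- The limiting covariances `ϑ*_{mk}(q)`, `0 ≤ m, k ≤ 2q`. -/
noncomputable def theta (C p : ℝ) (u : ℕ → ℝ) (q m k : ℕ) : ℝ :=
  if m ≤ q then
    if k ≤ q then
      (if m = k then fInt C u q m (p - 1) else 0)
        - fInt C u q m p * fInt C u q k p / (C * Real.Gamma (p + 2))
    else
      (if m = k - q then fInt C u q m p else 0)
        - fInt C u q m p * fInt C u q (k - q) (p + 1) / (C * Real.Gamma (p + 2))
  else
    if k ≤ q then
      (if k = m - q then fInt C u q k p else 0)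
        - fInt C u q k p * fInt C u q (m - q) (p + 1) / (C * Real.Gamma (p + 2))
    else
      (if m = k then fInt C u q (m - q) (p + 1) else 0)
        - fInt C u q (m - q) (p + 1) * fInt C u q (k - q) (p + 1) / (C * Real.Gamma (p + 2))

/-- The limiting covariance matrix. -/
noncomputable def covMatrix (C p : ℝ) (u : ℕ → ℝ) (q : ℕ) :
    Matrix (Fin (2 * q + 1)) (Fin (2 * q + 1)) ℝ :=
  Matrix.of fun m k => theta C p u q m k

end GibbsPartition

open GibbsPartition

/-!
Whatever the tilt `δ`, the Gibbs distribution on the partitions of `N` is the law of independent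
Poisson multiplicities `n_k` with parameters `b_k = a_k e ^ (-δ k)`, conditioned on `∑ k n_k = N`
(`map_conf_gibbsMeasure`). Everything about the distribution follows from this.

*Conditional independence.* The strata are disjoint groups of multiplicities. Once the masses of
all strata are prescribed, the condition `∑ k n_k = N` is automatic, so the conditional law is a
product over the strata; and given the mass of one stratum, the condition concerns the other strata
only (`cond_gibbsMeasure_groups`).

*Central limit theorem.* By Fourier inversion on the event `∑ k n_k = N`, the characteristic
function of a linear statistic of the counts and masses is a ratio of two integrals over the
frequency `s ∈ (-π, π]` (`integral_exp_gibbsMeasure`). With `s = v r_N ^ (-(p + 2) / 2)` the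
integrands converge pointwise to `e ^ (-Q(v) / 2)`, where `Q` is the limit of the variances; the
limits of the sums `∑ k ^ s a_k e ^ (-δ k)` over the strata are incomplete Gamma integrals, being
limits of Riemann sums (`tendsto_weighted_sum`). The same asymptotics for the complete sums shows
that the condition on `δ_N` forces `δ_N r_N → 1` (`tendsto_tilt_mul_scaling`). The integrands are
dominated by one stretched exponential, since the parameters are of full order on a block of sizes
comparable to `r_N` (`tendsto_integral_fourierIntegrand`). Now `Q(v)` is a quadratic polynomial in
`v`, and its Gaussian integral is, up to a factor common to numerator and denominator, the
exponential of the quadratic form of the limiting covariance matrix (`dotProduct_covMatrix`): the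
variance before conditioning, minus the part explained by the total size. Lévy's continuity theorem
concludes.

*Moments.* Real exponential moments of linear statistics are ratios of partition functions for
tilted parameters. The numerator is bounded by the stretched exponential as before, the denominator
is known from the local limit theorem, so exponential moments stay bounded
(`exists_integral_real_exp_linForm_le`). Hence all moments are uniformly integrable and converge.

*Decay of the covariances.* The off-diagonal covariances are products of incomplete Gamma
integrals, up to the covariances of the count and the mass of one stratum. The bounds come from the
tail of the Gamma integral, and the monotonicity from that of `x ^ s e ^ (-x)` for `x ≥ s`; the
entry for count and mass of one stratum is compared by means of
`∑_j f_j(p + 1) = C Γ(p + 2)` (`sum_fInt`).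
-/

namespace GibbsPartition

/-! ### Poisson multiplicities conditioned on the size -/

/-- The multiplicities `(n_1, …, n_N)` of the part sizes `1, …, N`. -/
abbrev Conf (N : ℕ) : Type := ↥(Finset.Icc 1 N) → ℕ

/-- The size `∑ k n_k` of the partition with the given multiplicities. -/
def total {N : ℕ} (n : Conf N) : ℕ :=
  ∑ k : ↥(Finset.Icc 1 N), (k : ℕ) * n k

/-- The multiplicities of a partition of `N`. -/
def conf {N : ℕ} (η : N.Partition) : Conf N := fun k => mult η k

/-- The law of independent Poisson multiplicities with parameters `b_1, …, b_N`. -/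
noncomputable def poissonField (b : ℕ → ℝ) (N : ℕ) : Measure (Conf N) :=
  Measure.pi fun k => poissonMeasure (b k).toNNReal

instance instIsProbabilityMeasurePoissonField (b : ℕ → ℝ) (N : ℕ) :
    IsProbabilityMeasure (poissonField b N) := by
  unfold poissonField; infer_instance

lemma toFinset_parts_subset {N : ℕ} (η : N.Partition) : η.parts.toFinset ⊆ Finset.Icc 1 N := by
  intro k hk
  rw [Multiset.mem_toFinset] at hk
  exact Finset.mem_Icc.2 ⟨η.parts_pos hk, η.le_of_mem_parts hk⟩

lemma total_conf {N : ℕ} (η : N.Partition) : total (conf η) = N := by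
  have h := Finset.sum_multiset_count_of_subset η.parts _ (toFinset_parts_subset η)
  rw [η.parts_sum] at h
  unfold total conf mult
  rw [Finset.sum_coe_sort (Finset.Icc 1 N) fun k => k * η.parts.count k]
  conv_rhs => rw [h]
  simp [mul_comm]

lemma conf_injective (N : ℕ) : Function.Injective (conf (N := N)) := by
  intro η η' h
  ext k
  by_cases hk : k ∈ Finset.Icc 1 N
  · exact congrFun h ⟨k, hk⟩
  · rw [Multiset.count_eq_zero_of_notMem, Multiset.count_eq_zero_of_notMem]
    · exact fun hm => hk (toFinset_parts_subset η' (Multiset.mem_toFinset.2 hm))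
    · exact fun hm => hk (toFinset_parts_subset η (Multiset.mem_toFinset.2 hm))

lemma exists_conf_eq {N : ℕ} {n : Conf N} (hn : total n = N) : ∃ η, conf η = n := by
  refine ⟨⟨∑ k, Multiset.replicate (n k) (k : ℕ), fun {i} hi => ?_, ?_⟩, ?_⟩
  · obtain ⟨k, -, hk⟩ := Multiset.mem_sum.1 hi
    rw [Multiset.eq_of_mem_replicate hk]
    exact (Finset.mem_Icc.1 k.2).1
  · rw [Multiset.sum_sum]
    simpa [total, mul_comm] using hn
  · funext j
    simp only [conf, mult, Multiset.count_sum', Multiset.count_replicate]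
    rw [Finset.sum_eq_single j]
    · simp
    · intro k _ hk
      rw [if_neg]
      exact fun h => hk (Subtype.ext h)
    · simp

lemma poissonField_real_singleton {b : ℕ → ℝ} (hb : ∀ k, 1 ≤ k → 0 ≤ b k) {N : ℕ} (n : Conf N) :
    (poissonField b N).real {n}
      = ∏ k : ↥(Finset.Icc 1 N), (Real.exp (-b k) * b k ^ n k / (Nat.factorial (n k) : ℝ)) := by
  rw [measureReal_def, poissonField, Measure.pi_singleton, ENNReal.toReal_prod]
  refine Finset.prod_congr rfl fun k _ => ?_
  rw [← measureReal_def, poissonMeasure_real_singleton,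
    Real.coe_toNNReal _ (hb k (Finset.mem_Icc.1 k.2).1)]

/-- The tilt `a_k ↦ a_k e ^ (-δ k)` multiplies the weight of every partition of `N` by the same
factor. -/
lemma poissonField_real_conf {a : ℕ → ℝ} (ha : ∀ k, 1 ≤ k → 0 < a k) (δ : ℝ) {N : ℕ}
    (η : N.Partition) :
    (poissonField (fun k => a k * Real.exp (-δ * k)) N).real {conf η}
      = Real.exp (-(∑ k ∈ Finset.Icc 1 N, a k * Real.exp (-δ * k)) - δ * N) * weight a η := by
  have h1 : ∀ k : ℕ, 1 ≤ k → 0 ≤ a k * Real.exp (-δ * k) := fun k hk => by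
    have := ha k hk; positivity
  rw [poissonField_real_singleton h1]
  have h2 := total_conf η
  unfold total conf at h2
  rw [Finset.sum_coe_sort (Finset.Icc 1 N) fun k => k * mult η k] at h2
  unfold conf weight
  rw [Finset.prod_coe_sort (Finset.Icc 1 N) fun k =>
    (Real.exp (-(a k * Real.exp (-δ * k))) * (a k * Real.exp (-δ * k)) ^ mult η k
      / (Nat.factorial (mult η k) : ℝ))]
  have h3 : (δ * N : ℝ) = ∑ k ∈ Finset.Icc 1 N, δ * k * mult η k := by
    conv_lhs => rw [← h2]
    push_cast
    rw [Finset.mul_sum]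
    exact Finset.sum_congr rfl fun k _ => by ring
  rw [h3, ← Finset.sum_neg_distrib, ← Finset.sum_sub_distrib, Real.exp_sum,
    ← Finset.prod_mul_distrib]
  refine Finset.prod_congr rfl fun k _ => ?_
  rw [mul_pow, ← Real.exp_nat_mul, sub_eq_add_neg, Real.exp_add]
  have : (-(δ * k * mult η k) : ℝ) = mult η k * (-δ * k) := by ring
  rw [this]
  ring

lemma setOf_total_eq (N : ℕ) :
    {n : Conf N | total n = N} = ↑(Finset.univ.image (conf (N := N))) := by
  ext n
  simp only [Set.mem_ofPred_eq, Finset.coe_image, Finset.coe_univ, Set.image_univ, Set.mem_range]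
  exact ⟨exists_conf_eq, fun ⟨η, h⟩ => h ▸ total_conf η⟩

/-- The probability that the independent Poisson multiplicities describe a partition of `N`. -/
lemma poissonField_real_total {a : ℕ → ℝ} (ha : ∀ k, 1 ≤ k → 0 < a k) (δ : ℝ) (N : ℕ) :
    (poissonField (fun k => a k * Real.exp (-δ * k)) N).real {n | total n = N}
      = Real.exp (-(∑ k ∈ Finset.Icc 1 N, a k * Real.exp (-δ * k)) - δ * N)
        * partitionFunction a N := by
  rw [setOf_total_eq, ← sum_measureReal_singleton, Finset.sum_image (conf_injective N).injOn,
    partitionFunction, Finset.mul_sum]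
  exact Finset.sum_congr rfl fun η _ => poissonField_real_conf ha δ η

/-- Whatever the tilt `δ`, the Gibbs distribution is the law of independent Poisson multiplicities
with parameters `a_k e ^ (-δ k)`, conditioned on `∑ k n_k = N`. -/
theorem map_conf_gibbsMeasure {a : ℕ → ℝ} (ha : ∀ k, 1 ≤ k → 0 < a k) (δ : ℝ) (N : ℕ) :
    (gibbsMeasure a ha N).map conf
      = cond (poissonField (fun k => a k * Real.exp (-δ * k)) N) {n | total n = N} := by
  set P := poissonField (fun k => a k * Real.exp (-δ * k)) N with hP
  have hm : Measurable (conf (N := N)) := Measurable.of_discrete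
  have hc := partitionFunction_pos ha N
  have hZ : P.real {n | total n = N} ≠ 0 := by
    rw [poissonField_real_total ha]
    positivity
  refine Measure.ext_of_singleton fun n => ?_
  rw [Measure.map_apply hm (measurableSet_singleton _), cond_apply (MeasurableSet.of_discrete)]
  by_cases hn : total n = N
  · obtain ⟨η, rfl⟩ := exists_conf_eq hn
    have h1 : conf ⁻¹' {conf η} = {η} := by
      ext η'
      simp [(conf_injective N).eq_iff]
    have h2 : {n | total n = N} ∩ {conf η} = {conf η} := by
      rw [Set.inter_eq_right]
      simpa using hn
    rw [h1, h2, gibbsMeasure, PMF.toMeasure_apply_singleton _ _ (measurableSet_singleton _), gibbs,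
      PMF.ofFintype_apply, ← ofReal_measureReal (μ := P) (s := {conf η}),
      ← ofReal_measureReal (μ := P) (s := {n | total n = N}),
      ← ENNReal.ofReal_inv_of_pos (by positivity), ← ENNReal.ofReal_mul (by positivity)]
    congr 1
    rw [poissonField_real_total ha, poissonField_real_conf ha]
    have := hc.ne'
    field_simp
  · have h1 : conf ⁻¹' {n} = ∅ := by
      ext η'
      simp only [Set.mem_preimage, Set.mem_singleton_iff, Set.mem_empty_iff_false, iff_false]
      rintro rfl
      exact hn (total_conf η')
    have h2 : {n | total n = N} ∩ {n} = ∅ := by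
      ext m
      simp only [Set.mem_inter_iff, Set.mem_ofPred_eq, Set.mem_singleton_iff,
        Set.mem_empty_iff_false, iff_false, not_and]
      rintro hm rfl
      exact hn hm
    rw [h1, h2]
    simp

/-- The characteristic function of a linear statistic of independent Poisson multiplicities. -/
lemma integral_exp_poissonField {b : ℕ → ℝ} (hb : ∀ k, 1 ≤ k → 0 ≤ b k) (N : ℕ) (φ : ℕ → ℝ) :
    ∫ n : Conf N, Complex.exp (Complex.I * ∑ k : ↥(Finset.Icc 1 N), (φ k : ℂ) * n k)
        ∂poissonField b N
      = Complex.exp (∑ k ∈ Finset.Icc 1 N, (b k : ℂ) * (Complex.exp (φ k * Complex.I) - 1)) := by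
  have h1 : ∀ k : ↥(Finset.Icc 1 N), ∫ m : ℕ, Complex.exp (Complex.I * ((φ k : ℂ) * m))
      ∂poissonMeasure (b k).toNNReal
      = Complex.exp ((b k : ℂ) * (Complex.exp (φ k * Complex.I) - 1)) := fun k => by
    have h := charFun_map_cast_poissonMeasure (b k).toNNReal (φ k)
    rw [charFun_apply_real, integral_map .of_discrete (by fun_prop)] at h
    have e : (((b k).toNNReal : ℝ) : ℂ) = (b k : ℂ) := by
      rw [Real.coe_toNNReal _ (hb k (Finset.mem_Icc.1 k.2).1)]
    have e' : (((b k).toNNReal : ℂ)) = (b k : ℂ) := e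
    rw [e'] at h
    rw [← h]
    refine integral_congr_ae (Eventually.of_forall fun m => ?_)
    simp only [Complex.ofReal_natCast]
    congr 1
    ring
  simp_rw [Finset.mul_sum, Complex.exp_sum]
  rw [poissonField, integral_fintype_prod_eq_prod (𝕜 := ℂ)
    (f := fun (k : ↥(Finset.Icc 1 N)) (m : ℕ) => Complex.exp (Complex.I * ((φ k : ℂ) * m)))]
  simp_rw [h1]
  rw [Finset.prod_coe_sort (Finset.Icc 1 N) fun k =>
    Complex.exp ((b k : ℂ) * (Complex.exp (φ k * Complex.I) - 1))]

lemma integral_exp_int (m : ℤ) :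
    ∫ s in (-Real.pi)..Real.pi, Complex.exp (Complex.I * (m * s))
      = if m = 0 then (2 * Real.pi : ℂ) else 0 := by
  split_ifs with h
  · subst h
    simp only [Int.cast_zero, zero_mul, mul_zero, Complex.exp_zero, intervalIntegral.integral_const,
      sub_neg_eq_add]
    rw [Complex.real_smul]
    push_cast
    ring
  · have hc : (Complex.I * m : ℂ) ≠ 0 :=
      mul_ne_zero Complex.I_ne_zero (Int.cast_ne_zero.2 h)
    simp_rw [← mul_assoc]
    rw [integral_exp_mul_complex hc]
    have : Complex.exp (Complex.I * m * (Real.pi : ℝ))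
        = Complex.exp (Complex.I * m * ((-Real.pi : ℝ) : ℂ)) := by
      rw [Complex.exp_eq_exp_iff_exists_int]
      exact ⟨m, by push_cast; ring⟩
    rw [this, sub_self, zero_div]

/-- Fourier inversion on the event `∑ k n_k = N` for independent Poisson multiplicities. -/
theorem setIntegral_exp_poissonField {b : ℕ → ℝ} (hb : ∀ k, 1 ≤ k → 0 ≤ b k) (N : ℕ)
    (θ : ℕ → ℝ) :
    ∫ n in {n : Conf N | total n = N},
        Complex.exp (Complex.I * ∑ k : ↥(Finset.Icc 1 N), (θ k : ℂ) * n k) ∂poissonField b N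
      = (2 * Real.pi : ℂ)⁻¹ * ∫ s in (-Real.pi)..Real.pi,
        Complex.exp (∑ k ∈ Finset.Icc 1 N, (b k : ℂ) * (Complex.exp ((θ k + k * s) * Complex.I) - 1))
          * Complex.exp (-(Complex.I * (N * s))) := by
  have hpi : (2 * Real.pi : ℂ) ≠ 0 := by
    simp [Real.pi_ne_zero]
  have hle : -Real.pi ≤ Real.pi := by linarith [Real.pi_pos]
  set P := poissonField b N
  set E : Conf N → ℂ := fun n => Complex.exp (Complex.I * ∑ k : ↥(Finset.Icc 1 N), (θ k : ℂ) * n k)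
  set F : Conf N → ℝ → ℂ := fun n s => E n * Complex.exp (Complex.I * (((total n : ℤ) - N : ℤ) * s))
  have h1 : ∀ n, ∫ s in (-Real.pi)..Real.pi, F n s
      = Set.indicator {n : Conf N | total n = N} (fun n => 2 * Real.pi * E n) n := fun n => by
    simp only [F]
    rw [intervalIntegral.integral_const_mul, integral_exp_int]
    by_cases h : total n = N
    · rw [Set.indicator_of_mem (by exact h), if_pos (by omega)]
      ring
    · rw [Set.indicator_of_notMem (by exact h), if_neg (by omega), mul_zero]
  have h2 : ∫ n, ∫ s in (-Real.pi)..Real.pi, F n s ∂volume ∂P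
      = 2 * Real.pi * ∫ n in {n : Conf N | total n = N}, E n ∂P := by
    simp_rw [h1]
    rw [integral_indicator (MeasurableSet.of_discrete), integral_const_mul]
  have h3 : ∫ n, ∫ s in (-Real.pi)..Real.pi, F n s ∂volume ∂P
      = ∫ s in (-Real.pi)..Real.pi, ∫ n, F n s ∂P := by
    simp_rw [intervalIntegral.integral_of_le hle]
    refine integral_integral_swap ?_
    refine Integrable.of_bound (C := 1) ?_ (Eventually.of_forall ?_)
    · refine Measurable.aestronglyMeasurable ?_
      refine measurable_from_prod_countable_right fun n => ?_
      simp only [Function.uncurry, F]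
      fun_prop
    · rintro ⟨n, s⟩
      simp only [Function.uncurry, F, E, norm_mul]
      have e1 : ‖Complex.exp (Complex.I * ∑ k : ↥(Finset.Icc 1 N), (θ k : ℂ) * n k)‖ = 1 := by
        have := Complex.norm_exp_I_mul_ofReal (∑ k : ↥(Finset.Icc 1 N), (θ k : ℝ) * n k)
        push_cast at this
        exact this
      have e2 : ‖Complex.exp (Complex.I * (((total n : ℤ) - N : ℤ) * s))‖ = 1 := by
        have := Complex.norm_exp_I_mul_ofReal (((total n : ℤ) - N : ℤ) * s)
        push_cast at this ⊢
        exact this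
      rw [e1, e2, one_mul]
  have h4 : ∀ s : ℝ, ∫ n, F n s ∂P
      = Complex.exp (∑ k ∈ Finset.Icc 1 N,
          (b k : ℂ) * (Complex.exp ((θ k + k * s) * Complex.I) - 1))
          * Complex.exp (-(Complex.I * (N * s))) := fun s => by
    have h := integral_exp_poissonField hb N fun k => θ k + k * s
    push_cast at h
    rw [← h, ← integral_mul_const]
    refine integral_congr_ae (Eventually.of_forall fun n => ?_)
    simp only [F, E]
    rw [← Complex.exp_add, ← Complex.exp_add]
    congr 1
    simp only [add_mul, Finset.sum_add_distrib]
    have e : (∑ k : ↥(Finset.Icc 1 N), ((k : ℕ) : ℂ) * s * n k) = (total n : ℂ) * s := by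
      unfold total
      push_cast
      rw [Finset.sum_mul]
      exact Finset.sum_congr rfl fun k _ => by ring
    rw [e]
    push_cast
    ring
  rw [eq_inv_mul_iff_mul_eq₀ hpi, ← h2, h3]
  simp_rw [h4]

/-! ### Independence of disjoint groups of multiplicities -/

/-- Under a product measure, events that depend on disjoint groups of coordinates are
independent. -/
lemma measure_iInter_eq_prod_of_disjoint {ι κ : Type*} [Fintype ι] [DecidableEq ι] [DecidableEq κ]
    (μ : ι → Measure ℕ) [∀ i, IsProbabilityMeasure (μ i)] (T : κ → Finset ι)
    (A : κ → Set (ι → ℕ))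
    (hA : ∀ j, ∀ ω ω' : ι → ℕ, (∀ i ∈ T j, ω i = ω' i) → ω ∈ A j → ω' ∈ A j) (s : Finset κ)
    (hT : (s : Set κ).PairwiseDisjoint T) :
    Measure.pi μ (⋂ j ∈ s, A j) = ∏ j ∈ s, Measure.pi μ (A j) := by
  have hindep : iIndepFun (fun (i : ι) (ω : ι → ℕ) => ω i) (Measure.pi μ) :=
    iIndepFun_pi (X := fun _ => id) fun _ => aemeasurable_id
  induction s using Finset.induction_on with
  | empty => simp
  | insert j s hj ih =>
    rw [Finset.prod_insert hj, ← ih (hT.subset (by simp)), Finset.set_biInter_insert]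
    have hd : Disjoint (T j) (s.biUnion T) := by
      rw [Finset.disjoint_biUnion_right]
      intro i hi
      exact hT (by simp) (by simp [hi]) (fun h => hj (h ▸ hi))
    have h := hindep.indepFun_finset (T j) (s.biUnion T) hd fun i => measurable_pi_apply i
    -- A set that depends only on the coordinates in `S` is a preimage under restriction to `S`.
    have key : ∀ (S : Finset ι) (B : Set (ι → ℕ)),
        (∀ ω ω' : ι → ℕ, (∀ i ∈ S, ω i = ω' i) → ω ∈ B → ω' ∈ B) →
        (fun (ω : ι → ℕ) (i : S) => ω i) ⁻¹' ((fun (ω : ι → ℕ) (i : S) => ω i) '' B) = B := by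
      intro S B hB
      refine Set.Subset.antisymm ?_ (Set.subset_preimage_image _ _)
      rintro ω ⟨ω', hω', e⟩
      exact hB ω' ω (fun i hi => congrFun e ⟨i, hi⟩) hω'
    have e1 := key (T j) (A j) (hA j)
    have e2 := key (s.biUnion T) (⋂ i ∈ s, A i) (by
      intro ω ω' hω hmem
      simp only [Set.mem_iInter] at hmem ⊢
      exact fun i hi => hA i ω ω' (fun k hk => hω k (Finset.mem_biUnion.2 ⟨i, hi, hk⟩)) (hmem i hi))
    rw [← e1, ← e2]
    exact h.measure_inter_preimage_eq_mul _ _ MeasurableSet.of_discrete MeasurableSet.of_discrete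

/-! ### The strata and the limiting integrals -/

lemma monotoneOn_points {u : ℕ → ℝ} {q : ℕ} (hu : ∀ j < q, u j < u (j + 1)) {i j : ℕ}
    (hij : i ≤ j) (hj : j ≤ q) : u i ≤ u j := by
  induction j, hij using Nat.le_induction with
  | base => exact le_rfl
  | succ j _ ih => exact (ih (by omega)).trans (hu j (by omega)).le

lemma points_nonneg {u : ℕ → ℝ} {q : ℕ} (hu0 : u 0 = 0) (hu : ∀ j < q, u j < u (j + 1)) {j : ℕ}
    (hj : j ≤ q) : 0 ≤ u j :=
  hu0 ▸ monotoneOn_points hu (Nat.zero_le j) hj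

lemma scaling_nonneg {C p : ℝ} (hC : 0 < C) (hp : 0 < p) (N : ℕ) : 0 ≤ scaling C p N := by
  have := Real.Gamma_pos_of_pos (by linarith : 0 < p + 1)
  unfold scaling
  positivity

lemma stratPoint_mono {C p : ℝ} (hC : 0 < C) (hp : 0 < p) {u : ℕ → ℝ} {q : ℕ}
    (hu : ∀ j < q, u j < u (j + 1)) (N : ℕ) {i j : ℕ} (hij : i ≤ j) (hj : j ≤ q) :
    stratPoint C p u N i ≤ stratPoint C p u N j :=
  Nat.floor_mono (mul_le_mul_of_nonneg_right (monotoneOn_points hu hij hj) (scaling_nonneg hC hp N))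

lemma stratum_subset (C p : ℝ) (u : ℕ → ℝ) (q N j : ℕ) : stratum C p u q N j ⊆ Finset.Icc 1 N :=
  Finset.filter_subset _ _

lemma disjoint_stratum {C p : ℝ} (hC : 0 < C) (hp : 0 < p) {u : ℕ → ℝ} {q : ℕ}
    (hu : ∀ j < q, u j < u (j + 1)) (N : ℕ) {i j : ℕ} (hi : i ≤ q) (hj : j ≤ q) (hij : i ≠ j) :
    Disjoint (stratum C p u q N i) (stratum C p u q N j) := by
  wlog h : i < j generalizing i j
  · exact (this hj hi hij.symm (by omega)).symm
  rw [Finset.disjoint_left]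
  intro k hk hk'
  have h1 := (Finset.mem_filter.1 hk).2.2 (by omega)
  have h2 := (Finset.mem_filter.1 hk').2.1
  have h3 := stratPoint_mono hC hp hu N (i := i + 1) (j := j) (by omega) hj
  omega

lemma exists_mem_stratum {C p : ℝ} {u : ℕ → ℝ} (hu0 : u 0 = 0) (q N : ℕ) {k : ℕ}
    (hk : k ∈ Finset.Icc 1 N) : ∃ j ≤ q, k ∈ stratum C p u q N j := by
  classical
  have h0 : stratPoint C p u N 0 ≤ k := by simp [stratPoint, hu0]
  refine ⟨Nat.findGreatest (fun j => stratPoint C p u N j ≤ k) q, Nat.findGreatest_le q,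
    Finset.mem_filter.2 ⟨hk, ?_, fun hj => ?_⟩⟩
  · exact Nat.findGreatest_spec (P := fun j => stratPoint C p u N j ≤ k) (Nat.zero_le q) h0
  · have := Nat.findGreatest_is_greatest (P := fun j => stratPoint C p u N j ≤ k) (n := q)
      (Nat.lt_succ_self _) hj
    exact not_le.1 this

lemma biUnion_stratum {C p : ℝ} {u : ℕ → ℝ} (hu0 : u 0 = 0) (q N : ℕ) :
    (Finset.range (q + 1)).biUnion (stratum C p u q N) = Finset.Icc 1 N := by
  ext k
  rw [Finset.mem_biUnion]
  constructor
  · rintro ⟨j, -, hj⟩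
    exact stratum_subset C p u q N j hj
  · intro hk
    obtain ⟨j, hj, hkj⟩ := exists_mem_stratum (C := C) (p := p) hu0 q N hk
    exact ⟨j, Finset.mem_range.2 (by omega), hkj⟩

lemma sum_stratum {C p : ℝ} (hC : 0 < C) (hp : 0 < p) {u : ℕ → ℝ} {q : ℕ} (hu0 : u 0 = 0)
    (hu : ∀ j < q, u j < u (j + 1)) (N : ℕ) {M : Type*} [AddCommMonoid M] (f : ℕ → M) :
    ∑ j ∈ Finset.range (q + 1), ∑ k ∈ stratum C p u q N j, f k = ∑ k ∈ Finset.Icc 1 N, f k := by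
  rw [← biUnion_stratum (C := C) (p := p) hu0 q N, Finset.sum_biUnion]
  intro i hi j hj hij
  rw [Finset.coe_range, Set.mem_Iio] at hi hj
  exact disjoint_stratum hC hp hu N (by omega) (by omega) hij

/-- The domain of integration of `fInt`: the interval between the `j`-th point and the next one. -/
def region (u : ℕ → ℝ) (q j : ℕ) : Set ℝ :=
  if j < q then Set.Ioo (u j) (u (j + 1)) else Set.Ioi (u j)

lemma fInt_eq (C : ℝ) (u : ℕ → ℝ) (q j : ℕ) (s : ℝ) :
    fInt C u q j s = C * ∫ x in region u q j, x ^ s * Real.exp (-x) := rfl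

lemma measurableSet_region (u : ℕ → ℝ) (q j : ℕ) : MeasurableSet (region u q j) := by
  unfold region
  split_ifs
  · exact measurableSet_Ioo
  · exact measurableSet_Ioi

lemma isOpen_region (u : ℕ → ℝ) (q j : ℕ) : IsOpen (region u q j) := by
  unfold region
  split_ifs
  · exact isOpen_Ioo
  · exact isOpen_Ioi

lemma region_subset {u : ℕ → ℝ} {q j : ℕ} (hj : 0 ≤ u j) : region u q j ⊆ Set.Ioi 0 := by
  unfold region
  split_ifs
  · exact fun x hx => hj.trans_lt hx.1
  · exact fun x hx => hj.trans_lt hx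

lemma region_nonempty {u : ℕ → ℝ} {q j : ℕ} (hu : ∀ j < q, u j < u (j + 1)) :
    (region u q j).Nonempty := by
  unfold region
  split_ifs with h
  · exact Set.nonempty_Ioo.2 (hu j h)
  · exact Set.nonempty_Ioi

lemma integrableOn_rpow_mul_exp_neg {s : ℝ} (hs : -1 < s) :
    IntegrableOn (fun x : ℝ => x ^ s * Real.exp (-x)) (Set.Ioi 0) := by
  have := Real.GammaIntegral_convergent (by linarith : 0 < s + 1)
  simpa [mul_comm] using this

lemma integral_rpow_mul_exp_neg {s : ℝ} (hs : -1 < s) :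
    ∫ x in Set.Ioi (0 : ℝ), x ^ s * Real.exp (-x) = Real.Gamma (s + 1) := by
  rw [Real.Gamma_eq_integral (by linarith)]
  simp [mul_comm]

lemma setIntegral_rpow_mul_exp_neg_pos {s : ℝ} (hs : -1 < s) {S : Set ℝ} (hS : IsOpen S)
    (hne : S.Nonempty) (hsub : S ⊆ Set.Ioi 0) : 0 < ∫ x in S, x ^ s * Real.exp (-x) := by
  have hpos : ∀ x ∈ S, 0 < x ^ s * Real.exp (-x) := fun x hx => by
    have : 0 < x := hsub hx
    positivity
  rw [setIntegral_pos_iff_support_of_nonneg_ae]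
  · refine (hS.measure_pos volume hne).trans_le (measure_mono fun x hx => ⟨(hpos x hx).ne', hx⟩)
  · exact (ae_restrict_iff' hS.measurableSet).2 (Eventually.of_forall fun x hx => (hpos x hx).le)
  · exact (integrableOn_rpow_mul_exp_neg hs).mono_set hsub

lemma fInt_pos {C : ℝ} (hC : 0 < C) {u : ℕ → ℝ} {q j : ℕ} (hu0 : u 0 = 0)
    (hu : ∀ j < q, u j < u (j + 1)) (hj : j ≤ q) {s : ℝ} (hs : -1 < s) : 0 < fInt C u q j s :=
  mul_pos hC (setIntegral_rpow_mul_exp_neg_pos hs (isOpen_region u q j) (region_nonempty hu)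
    (region_subset (points_nonneg hu0 hu hj)))

/-! ### Conditional independence -/

lemma cond_apply_eq_of_measure_inter {Ω : Type*} [MeasurableSpace Ω] [DiscreteMeasurableSpace Ω]
    {μ : Measure Ω} [IsFiniteMeasure μ] {A B : Set Ω} {c : ENNReal} (hA : μ A ≠ 0)
    (h : μ (A ∩ B) = μ A * c) : cond μ A B = c := by
  rw [cond_apply MeasurableSet.of_discrete, h, ← mul_assoc,
    ENNReal.inv_mul_cancel hA (measure_ne_top μ A), one_mul]

/-- Disjoint groups of independent Poisson multiplicities, conditioned on `∑ k n_k = N`: given the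
masses of all groups, events on the individual groups are independent, and their probabilities
depend on the mass of their own group only. -/
lemma cond_gibbsMeasure_groups {a : ℕ → ℝ} (ha : ∀ k, 1 ≤ k → 0 < a k) {N q : ℕ}
    (T : Fin (q + 1) → Finset ↥(Finset.Icc 1 N)) (hT : Pairwise fun i j => Disjoint (T i) (T j))
    (hcover : ∀ k, ∃ j, k ∈ T j) (y : Fin (q + 1) → ℕ) (X : Fin (q + 1) → Set ℕ)
    (hne : gibbsMeasure a ha N {η | ∀ i, ∑ k ∈ T i, (k : ℕ) * conf η k = y i} ≠ 0) :
    cond (gibbsMeasure a ha N) {η | ∀ i, ∑ k ∈ T i, (k : ℕ) * conf η k = y i}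
        {η | ∀ i, ∑ k ∈ T i, conf η k ∈ X i}
      = ∏ j, cond (gibbsMeasure a ha N) {η | ∀ i, ∑ k ∈ T i, (k : ℕ) * conf η k = y i}
        {η | ∑ k ∈ T j, conf η k ∈ X j} ∧
    cond (gibbsMeasure a ha N) {η | ∀ i, ∑ k ∈ T i, (k : ℕ) * conf η k = y i}
        {η | ∀ i, ∑ k ∈ T i, conf η k ∈ X i}
      = ∏ j, cond (gibbsMeasure a ha N) {η | ∑ k ∈ T j, (k : ℕ) * conf η k = y j}
        {η | ∑ k ∈ T j, conf η k ∈ X j} := by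
  -- Any tilt would do; take `δ = 0`.
  set P := poissonField (fun k => a k * Real.exp (-0 * k)) N with hP
  set A : Fin (q + 1) → Set (Conf N) := fun j => {n | ∑ k ∈ T j, (k : ℕ) * n k = y j} with hAdef
  set B : Fin (q + 1) → Set (Conf N) := fun j => {n | ∑ k ∈ T j, n k ∈ X j} with hBdef
  set Z : Set (Conf N) := {n | total n = N} with hZ
  have hgibbs : ∀ S : Set (Conf N), gibbsMeasure a ha N (conf ⁻¹' S) = (P Z)⁻¹ * P (Z ∩ S) := by
    intro S
    rw [← Measure.map_apply Measurable.of_discrete MeasurableSet.of_discrete,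
      map_conf_gibbsMeasure ha 0, cond_apply MeasurableSet.of_discrete]
  have htotal : ∀ n : Conf N, total n = ∑ j, ∑ k ∈ T j, (k : ℕ) * n k := by
    intro n
    rw [← Finset.sum_biUnion (fun i _ j _ h => hT h)]
    refine (Finset.sum_subset (Finset.subset_univ _) fun k _ hk => absurd ?_ hk).symm
    obtain ⟨j, hj⟩ := hcover k
    exact Finset.mem_biUnion.2 ⟨j, Finset.mem_univ _, hj⟩
  have eA : {η : N.Partition | ∀ i, ∑ k ∈ T i, (k : ℕ) * conf η k = y i}
      = conf ⁻¹' (⋂ j, A j) := by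
    ext η; simp [hAdef]
  have eAj : ∀ j, {η : N.Partition | ∑ k ∈ T j, (k : ℕ) * conf η k = y j}
      = conf ⁻¹' (A j) := fun j => rfl
  have eB : {η : N.Partition | ∀ i, ∑ k ∈ T i, conf η k ∈ X i} = conf ⁻¹' (⋂ j, B j) := by
    ext η; simp [hBdef]
  have eBj : ∀ j, {η : N.Partition | ∑ k ∈ T j, conf η k ∈ X j} = conf ⁻¹' (B j) := fun j => rfl
  simp only [eA, eB, eAj, eBj] at hne ⊢
  have hZA : Z ∩ ⋂ j, A j = ⋂ j, A j := by
    obtain ⟨η, hη⟩ := nonempty_of_measure_ne_zero hne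
    have hsum : ∑ j, y j = N := by
      rw [← total_conf η, htotal]
      refine Finset.sum_congr rfl fun j _ => ?_
      exact (Set.mem_iInter.1 hη j).symm
    refine Set.inter_eq_right.2 fun n hn => ?_
    change total n = N
    refine ((htotal n).trans ?_).trans hsum
    exact Finset.sum_congr rfl fun j _ => Set.mem_iInter.1 hn j
  have hPA : P (⋂ j, A j) ≠ 0 := by
    intro h0
    rw [hgibbs, hZA, h0, mul_zero] at hne
    exact hne rfl
  have hPAj : ∀ j, P (A j) ≠ 0 := fun j h0 =>
    hPA (measure_mono_null (Set.iInter_subset A j) h0)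
  have hdA : ∀ j, ∀ ω ω' : Conf N, (∀ i ∈ T j, ω i = ω' i) → ω ∈ A j → ω' ∈ A j := by
    intro j ω ω' h hω
    refine Eq.trans (b := ∑ k ∈ T j, (k : ℕ) * ω k) ?_ hω
    exact Finset.sum_congr rfl fun k hk => by rw [h k hk]
  have hdB : ∀ j, ∀ ω ω' : Conf N, (∀ i ∈ T j, ω i = ω' i) → ω ∈ B j → ω' ∈ B j := by
    intro j ω ω' h hω
    have : ∑ k ∈ T j, ω' k = ∑ k ∈ T j, ω k := Finset.sum_congr rfl fun k hk => by rw [h k hk]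
    change ∑ k ∈ T j, ω' k ∈ X j
    rwa [this]
  have hprod : ∀ D : Fin (q + 1) → Set (Conf N),
      (∀ j, ∀ ω ω' : Conf N, (∀ i ∈ T j, ω i = ω' i) → ω ∈ D j → ω' ∈ D j) →
      P (⋂ j, D j) = ∏ j, P (D j) := by
    intro D hD
    have := measure_iInter_eq_prod_of_disjoint
      (fun k : ↥(Finset.Icc 1 N) => poissonMeasure (a k * Real.exp (-0 * k)).toNNReal) T D hD
      Finset.univ (fun i _ j _ h => hT h)
    simp only [Finset.mem_univ, Set.iInter_true] at this
    exact this
  set c : Fin (q + 1) → ENNReal := fun j => (P (A j))⁻¹ * P (A j ∩ B j) with hc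
  have hcj : ∀ j, P (A j ∩ B j) = P (A j) * c j := fun j => by
    rw [hc, ← mul_assoc, ENNReal.mul_inv_cancel (hPAj j) (measure_ne_top P _), one_mul]
  have hall : cond (gibbsMeasure a ha N) (conf ⁻¹' ⋂ j, A j) (conf ⁻¹' ⋂ j, B j) = ∏ j, c j := by
    refine cond_apply_eq_of_measure_inter hne ?_
    rw [← Set.preimage_inter, hgibbs, hgibbs, ← Set.inter_assoc, hZA, mul_assoc]
    congr 1
    rw [← Set.iInter_inter_distrib, hprod (fun j => A j ∩ B j), hprod A hdA,
      ← Finset.prod_mul_distrib]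
    · exact Finset.prod_congr rfl fun j _ => hcj j
    · exact fun j ω ω' h hω => ⟨hdA j ω ω' h hω.1, hdB j ω ω' h hω.2⟩
  have hone : ∀ j, cond (gibbsMeasure a ha N) (conf ⁻¹' ⋂ j, A j) (conf ⁻¹' B j) = c j := by
    intro j
    refine cond_apply_eq_of_measure_inter hne ?_
    rw [← Set.preimage_inter, hgibbs, hgibbs, ← Set.inter_assoc, hZA, mul_assoc]
    congr 1
    have e : (⋂ i, A i) ∩ B j = ⋂ i, (if i = j then A i ∩ B i else A i) := by
      ext n
      simp only [Set.mem_inter_iff, Set.mem_iInter]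
      constructor
      · rintro ⟨h1, h2⟩ i
        split_ifs with hij
        · exact ⟨h1 i, hij ▸ h2⟩
        · exact h1 i
      · intro h
        refine ⟨fun i => ?_, ?_⟩
        · have := h i
          split_ifs at this
          exacts [this.1, this]
        · have := h j
          rw [if_pos rfl] at this
          exact this.2
    rw [e, hprod _ ?_, hprod A hdA, ← Finset.mul_prod_erase _ _ (Finset.mem_univ j),
      ← Finset.mul_prod_erase _ (fun i => P (A i)) (Finset.mem_univ j), if_pos rfl, hcj]
    · rw [Finset.prod_congr rfl (g := fun i => P (A i)) fun i hi => by
        rw [if_neg (Finset.ne_of_mem_erase hi)]]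
      ring
    · intro i ω ω' h hω
      split_ifs at hω ⊢
      exacts [⟨hdA i ω ω' h hω.1, hdB i ω ω' h hω.2⟩, hdA i ω ω' h hω]
  have hown : ∀ j, cond (gibbsMeasure a ha N) (conf ⁻¹' A j) (conf ⁻¹' B j) = c j := by
    intro j
    have hne' : gibbsMeasure a ha N (conf ⁻¹' A j) ≠ 0 := fun h0 =>
      hne (measure_mono_null (Set.preimage_mono (Set.iInter_subset A j)) h0)
    refine cond_apply_eq_of_measure_inter hne' ?_
    rw [← Set.preimage_inter, hgibbs, hgibbs, mul_assoc]
    congr 1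
    -- On `A j`, the condition on the total size is a condition on the other groups.
    set R : Set (Conf N) := {n | y j + ∑ k ∈ (T j)ᶜ, (k : ℕ) * n k = N} with hR
    have hZR : ∀ D : Set (Conf N), D ⊆ A j → Z ∩ D = D ∩ R := by
      intro D hD
      rw [Set.inter_comm]
      ext n
      simp only [Set.mem_inter_iff, and_congr_right_iff]
      intro hn
      have h1 : ∑ k ∈ T j, (k : ℕ) * n k = y j := hD hn
      change total n = N ↔ y j + _ = N
      rw [← h1, Finset.sum_add_sum_compl]
      rfl
    have hind : ∀ D : Set (Conf N), (∀ ω ω' : Conf N, (∀ i ∈ T j, ω i = ω' i) → ω ∈ D → ω' ∈ D) →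
        P (D ∩ R) = P D * P R := by
      intro D hD
      have := measure_iInter_eq_prod_of_disjoint
        (fun k : ↥(Finset.Icc 1 N) => poissonMeasure (a k * Real.exp (-0 * k)).toNNReal)
        (fun b : Bool => if b then T j else (T j)ᶜ) (fun b : Bool => if b then D else R)
        (by
          rintro (_ | _) ω ω' h hω
          · simp only [Bool.false_eq_true, if_false] at h hω ⊢
            rw [hR, Set.mem_ofPred_eq] at hω ⊢
            refine Eq.trans ?_ hω
            congr 1
            exact Finset.sum_congr rfl fun k hk => by rw [(h k hk).symm]
          · simp only [if_true] at h hω ⊢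
            exact hD ω ω' h hω)
        Finset.univ (by
          rintro (_ | _) _ (_ | _) _ h
          · exact absurd rfl h
          · simpa [Function.onFun] using disjoint_compl_left
          · simpa [Function.onFun] using disjoint_compl_right
          · exact absurd rfl h)
      rw [Fintype.prod_bool] at this
      simp only [if_true, Bool.false_eq_true, if_false] at this
      change P _ = P D * P R at this
      rw [← this]
      congr 1
      ext n
      simp [and_comm]
    rw [hZR _ Set.inter_subset_left, hZR _ subset_rfl, hind _ (hdA j), hind, hcj]
    · ring
    · exact fun ω ω' h hω => ⟨hdA j ω ω' h hω.1, hdB j ω ω' h hω.2⟩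
  rw [hall]
  exact ⟨Finset.prod_congr rfl fun j _ => (hone j).symm,
    Finset.prod_congr rfl fun j _ => (hown j).symm⟩

lemma sum_filter_mem_coe {N : ℕ} {S : Finset ℕ} (hS : S ⊆ Finset.Icc 1 N) {M : Type*}
    [AddCommMonoid M] (f : ℕ → M) :
    ∑ k ∈ Finset.univ.filter (fun k : ↥(Finset.Icc 1 N) => (k : ℕ) ∈ S),
      f (k : ↥(Finset.Icc 1 N)) = ∑ k ∈ S, f k := by
  rw [Finset.sum_filter, Finset.sum_coe_sort (Finset.Icc 1 N) fun k => if k ∈ S then f k else 0,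
    Finset.sum_ite_mem, Finset.inter_eq_right.2 hS]

lemma stratSum_nonneg {a : ℕ → ℝ} (ha : ∀ k, 1 ≤ k → 0 < a k) (C p : ℝ) (u : ℕ → ℝ) (q : ℕ) (δ : ℝ)
    (N j r : ℕ) : 0 ≤ stratSum a C p u q δ N j r :=
  Finset.sum_nonneg fun k hk => by
    have := ha k (Finset.mem_Icc.1 (stratum_subset C p u q N j hk)).1
    positivity

lemma stratSum_pos {a : ℕ → ℝ} (ha : ∀ k, 1 ≤ k → 0 < a k) {C p : ℝ} {u : ℕ → ℝ} {q : ℕ} (δ : ℝ)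
    {N j : ℕ} (r : ℕ) (h : (stratum C p u q N j).Nonempty) : 0 < stratSum a C p u q δ N j r :=
  Finset.sum_pos (fun k hk => by
    have h1 := (Finset.mem_Icc.1 (stratum_subset C p u q N j hk)).1
    have := ha k h1
    positivity) h

/-- The scaled counts are conditionally independent given the scaled masses, and the conditional
law of a scaled count only depends on the scaled mass of its own stratum. -/
theorem cond_scaledMass_scaledCount {C p : ℝ} (hC : 0 < C) (hp : 0 < p) {a : ℕ → ℝ}
    (ha : ∀ k, 1 ≤ k → 0 < a k) {q : ℕ} {u : ℕ → ℝ} (hu0 : u 0 = 0)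
    (hu : ∀ j < q, u j < u (j + 1)) (δ : ℝ) (N : ℕ) (x y : Fin (q + 1) → ℝ)
    (hne : gibbsMeasure a ha N {η | ∀ i : Fin (q + 1), scaledMass a C p u q δ i η = y i} ≠ 0) :
    cond (gibbsMeasure a ha N) {η | ∀ i : Fin (q + 1), scaledMass a C p u q δ i η = y i}
        {η | ∀ j : Fin (q + 1), scaledCount a C p u q δ j η = x j}
      = ∏ j : Fin (q + 1), cond (gibbsMeasure a ha N)
          {η | ∀ i : Fin (q + 1), scaledMass a C p u q δ i η = y i}
          {η | scaledCount a C p u q δ j η = x j} ∧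
    cond (gibbsMeasure a ha N) {η | ∀ i : Fin (q + 1), scaledMass a C p u q δ i η = y i}
        {η | ∀ j : Fin (q + 1), scaledCount a C p u q δ j η = x j}
      = ∏ j : Fin (q + 1), cond (gibbsMeasure a ha N)
          {η | scaledMass a C p u q δ j η = y j}
          {η | scaledCount a C p u q δ j η = x j} := by
  rcases (stratum C p u q N 0).eq_empty_or_nonempty with h0 | h0
  · -- An empty first stratum makes the normalisations vanish, and all scaled variables are `0`.
    have hm : ∀ (j : ℕ) (η : N.Partition), scaledMass a C p u q δ j η = 0 := fun j η => by
      simp [scaledMass, stratSum, h0]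
    have hc : ∀ (j : ℕ) (η : N.Partition), scaledCount a C p u q δ j η = 0 := fun j η => by
      simp [scaledCount, stratSum, h0]
    simp only [hm, hc] at hne ⊢
    have hy : ∀ i, 0 = y i := by
      by_contra hcon
      simp [hcon] at hne
    have h1 : {η : N.Partition | ∀ i, 0 = y i} = Set.univ := by
      simp [← hy]
    have h2 : ∀ j, {η : N.Partition | 0 = y j} = Set.univ := fun j => by simp [← hy j]
    simp only [h1, h2, cond_univ, and_self]
    by_cases hx : ∀ j, 0 = x j
    · have h3 : ∀ j, {η : N.Partition | 0 = x j} = Set.univ := fun j => by simp [← hx j]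
      have h4 : {η : N.Partition | ∀ j, 0 = x j} = Set.univ := by simp [← hx]
      simp [h3, h4]
    · obtain ⟨j, hj⟩ := not_forall.1 hx
      have h4 : {η : N.Partition | ∀ j, 0 = x j} = ∅ := by simp [hx]
      rw [h4, measure_empty, Finset.prod_eq_zero (Finset.mem_univ j)]
      simp [hj]
  · set T : Fin (q + 1) → Finset ↥(Finset.Icc 1 N) :=
      fun j => Finset.univ.filter fun k => (k : ℕ) ∈ stratum C p u q N j with hTdef
    have hcount : ∀ (j : Fin (q + 1)) (η : N.Partition),
        count C p u q j η = ∑ k ∈ T j, conf η k := fun j η =>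
      (sum_filter_mem_coe (stratum_subset C p u q N j) fun k => mult η k).symm
    have hmass : ∀ (j : Fin (q + 1)) (η : N.Partition),
        mass C p u q j η = ∑ k ∈ T j, (k : ℕ) * conf η k := fun j η =>
      (sum_filter_mem_coe (stratum_subset C p u q N j) fun k => k * mult η k).symm
    have hT : Pairwise fun i j => Disjoint (T i) (T j) := by
      intro i j hij
      rw [Finset.disjoint_left]
      intro k hi hj
      refine Finset.disjoint_left.1 (disjoint_stratum hC hp hu N (i := i) (j := j) (by omega)
        (by omega) (fun h => hij (Fin.ext h))) (Finset.mem_filter.1 hi).2 (Finset.mem_filter.1 hj).2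
    have hcover : ∀ k, ∃ j, k ∈ T j := by
      intro k
      obtain ⟨j, hj, hk⟩ := exists_mem_stratum (C := C) (p := p) hu0 q N k.2
      exact ⟨⟨j, by omega⟩, Finset.mem_filter.2 ⟨Finset.mem_univ _, hk⟩⟩
    have hf : √(fInt C u q 0 (p + 1)) ≠ 0 :=
      (Real.sqrt_pos.2 (fInt_pos hC hu0 hu (Nat.zero_le q) (by linarith))).ne'
    have hV : √(stratSum a C p u q δ N 0 2) ≠ 0 :=
      (Real.sqrt_pos.2 (stratSum_pos ha δ 2 h0)).ne'
    obtain ⟨η₀, hη₀⟩ := nonempty_of_measure_ne_zero hne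
    have hiff : ∀ (j : Fin (q + 1)) (η : N.Partition), scaledMass a C p u q δ j η = y j ↔
        ∑ k ∈ T j, (k : ℕ) * conf η k = mass C p u q j η₀ := by
      intro j η
      have h := hη₀ j
      rw [← h, scaledMass, scaledMass, ← hmass, mul_right_inj' hf, div_left_inj' hV, sub_left_inj,
        Nat.cast_inj]
    set X : Fin (q + 1) → Set ℕ := fun j =>
      {c | √(fInt C u q 0 (p - 1)) * (((c : ℝ) - stratSum a C p u q δ N j 0)
        / √(stratSum a C p u q δ N 0 0)) = x j} with hX
    have hiff' : ∀ (j : Fin (q + 1)) (η : N.Partition), scaledCount a C p u q δ j η = x j ↔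
        ∑ k ∈ T j, conf η k ∈ X j := by
      intro j η
      rw [← hcount]
      rfl
    simp only [hiff, hiff'] at hne ⊢
    exact cond_gibbsMeasure_groups ha T hT hcover (fun j => mass C p u q j η₀) X hne

/-! ### Riemann sums -/

lemma intervalIntegral_ceil (g : ℕ → ℝ) (N : ℕ) :
    IntervalIntegrable (fun x : ℝ => g ⌈x⌉₊) volume 0 N ∧
      ∫ x in (0 : ℝ)..N, g ⌈x⌉₊ = ∑ k ∈ Finset.Icc 1 N, g k := by
  have hstep : ∀ n : ℕ, Set.EqOn (fun _ => g (n + 1)) (fun x : ℝ => g ⌈x⌉₊)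
      (Set.uIoc (n : ℝ) ((n + 1 : ℕ) : ℝ)) := by
    intro n x hx
    rw [Set.uIoc_of_le (by simp)] at hx
    have : ⌈x⌉₊ = n + 1 := by
      rw [Nat.ceil_eq_iff (by omega)]
      exact ⟨by simpa using hx.1, hx.2⟩
    simp only [this]
  have hint : ∀ n : ℕ, IntervalIntegrable (fun x : ℝ => g ⌈x⌉₊) volume n ((n + 1 : ℕ) : ℝ) :=
    fun n => (intervalIntegrable_const (c := g (n + 1))).congr (hstep n)
  induction N with
  | zero => simp
  | succ n ih =>
    refine ⟨ih.1.trans (hint n), ?_⟩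
    rw [← intervalIntegral.integral_add_adjacent_intervals ih.1 (hint n), ih.2,
      Finset.sum_Icc_succ_top (by omega)]
    congr 1
    rw [← intervalIntegral.integral_congr_ae (Eventually.of_forall (hstep n))]
    simp

/-- A Riemann sum with mesh `1 / r` is the integral of a step function. -/
lemma inv_mul_sum_eq_setIntegral {r : ℝ} (hr : 0 < r) (g : ℕ → ℝ) (N : ℕ) :
    r⁻¹ * ∑ k ∈ Finset.Icc 1 N, g k
      = ∫ x in Set.Ioi (0 : ℝ), if ⌈x * r⌉₊ ≤ N then g ⌈x * r⌉₊ else 0 := by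
  rw [integral_comp_mul_right_Ioi (fun y => if ⌈y⌉₊ ≤ N then g ⌈y⌉₊ else 0) 0 hr, zero_mul,
    smul_eq_mul, ← (intervalIntegral_ceil g N).2, intervalIntegral.integral_of_le (by simp)]
  congr 1
  have h : ∀ y ∈ Set.Ioi (0 : ℝ), (if ⌈y⌉₊ ≤ N then g ⌈y⌉₊ else 0)
      = (Set.Iic (N : ℝ)).indicator (fun y => g ⌈y⌉₊) y := by
    intro y _
    simp only [Set.indicator, Set.mem_Iic, Nat.ceil_le]
  rw [setIntegral_congr_fun measurableSet_Ioi h, setIntegral_indicator measurableSet_Iic,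
    Set.Ioi_inter_Iic]

lemma measurable_ceil_step (g : ℕ → ℝ) (r : ℝ) (N : ℕ) :
    Measurable fun x : ℝ => if ⌈x * r⌉₊ ≤ N then g ⌈x * r⌉₊ else 0 := by
  have : Measurable fun k : ℕ => if k ≤ N then g k else 0 := Measurable.of_discrete
  exact this.comp (Nat.measurable_ceil.comp (measurable_id.mul_const r))

/-- Dominated convergence for Riemann sums with mesh `1 / r_N → 0`. -/
lemma tendsto_riemann_sum {r : ℕ → ℝ} (hr : ∀ᶠ N in atTop, 0 < r N) {g : ℕ → ℕ → ℝ} {G B : ℝ → ℝ}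
    (hB : IntegrableOn B (Set.Ioi 0))
    (hbound : ∀ᶠ N in atTop, ∀ x : ℝ, 0 < x → ⌈x * r N⌉₊ ≤ N → |g N ⌈x * r N⌉₊| ≤ B x)
    (hB0 : ∀ x : ℝ, 0 < x → 0 ≤ B x)
    (hlim : ∀ᵐ x : ℝ, 0 < x →
      Tendsto (fun N => if ⌈x * r N⌉₊ ≤ N then g N ⌈x * r N⌉₊ else 0) atTop (𝓝 (G x))) :
    Tendsto (fun N => (r N)⁻¹ * ∑ k ∈ Finset.Icc 1 N, g N k) atTop
      (𝓝 (∫ x in Set.Ioi (0 : ℝ), G x)) := by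
  have h : Tendsto (fun N => ∫ x in Set.Ioi (0 : ℝ), if ⌈x * r N⌉₊ ≤ N then g N ⌈x * r N⌉₊ else 0)
      atTop (𝓝 (∫ x in Set.Ioi (0 : ℝ), G x)) := by
    refine tendsto_integral_filter_of_dominated_convergence B ?_ ?_ hB ?_
    · exact Eventually.of_forall fun N => (measurable_ceil_step _ _ _).aestronglyMeasurable
    · filter_upwards [hbound] with N hN
      refine (ae_restrict_iff' measurableSet_Ioi).2 (Eventually.of_forall fun x hx => ?_)
      split_ifs with hle
      · exact hN x hx hle
      · simpa using hB0 x hx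
    · exact (ae_restrict_iff' measurableSet_Ioi).2 hlim
  refine h.congr' ?_
  filter_upwards [hr] with N hN
  exact (inv_mul_sum_eq_setIntegral hN _ N).symm

lemma tendsto_scaling {C p : ℝ} (hC : 0 < C) (hp : 0 < p) : Tendsto (scaling C p) atTop atTop := by
  have := Real.Gamma_pos_of_pos (by linarith : 0 < p + 1)
  exact ((tendsto_rpow_atTop (by positivity : 0 < 1 / (p + 1))).comp
    tendsto_natCast_atTop_atTop).const_mul_atTop (by positivity)

/-- The scaling `r_N` satisfies `C Γ(p + 1) r_N ^ (p + 1) = N`. -/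
lemma mul_scaling_rpow {C p : ℝ} (hC : 0 < C) (hp : 0 < p) (N : ℕ) :
    C * Real.Gamma (p + 1) * scaling C p N ^ (p + 1) = N := by
  have := Real.Gamma_pos_of_pos (by linarith : 0 < p + 1)
  have hκ : 0 < C * Real.Gamma (p + 1) := by positivity
  have hp1 : p + 1 ≠ 0 := by linarith
  unfold scaling
  rw [Real.mul_rpow (by positivity) (by positivity), Real.inv_rpow (by positivity),
    ← Real.rpow_mul hκ.le, ← Real.rpow_mul (Nat.cast_nonneg N), one_div_mul_cancel hp1,
    Real.rpow_one, Real.rpow_one]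
  field_simp

lemma eventually_mul_scaling_le {C p : ℝ} (hC : 0 < C) (hp : 0 < p) (x : ℝ) :
    ∀ᶠ N : ℕ in atTop, x * scaling C p N + 1 ≤ N := by
  have := Real.Gamma_pos_of_pos (by linarith : 0 < p + 1)
  have hκ : 0 < C * Real.Gamma (p + 1) := by positivity
  have h1 : Tendsto (fun N => C * Real.Gamma (p + 1) * scaling C p N ^ p) atTop atTop :=
    ((tendsto_rpow_atTop hp).comp (tendsto_scaling hC hp)).const_mul_atTop hκ
  filter_upwards [h1.eventually_ge_atTop (x + 1), (tendsto_scaling hC hp).eventually_ge_atTop 1]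
    with N h2 h3
  rw [← mul_scaling_rpow hC hp N, Real.rpow_add_one (by linarith)]
  nlinarith

lemma eventually_ceil_le {C p : ℝ} (hC : 0 < C) (hp : 0 < p) (x : ℝ) :
    ∀ᶠ N : ℕ in atTop, ⌈x * scaling C p N⌉₊ ≤ N := by
  filter_upwards [eventually_mul_scaling_le hC hp x] with N hN
  rw [Nat.ceil_le]
  linarith

lemma tendsto_div_rpow {C p : ℝ} {a : ℕ → ℝ}
    (hC : 0 < C) (hasymp : a ~[atTop] fun k : ℕ => C * (k : ℝ) ^ (p - 1)) :
    Tendsto (fun k : ℕ => a k / (k : ℝ) ^ (p - 1)) atTop (𝓝 C) := by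
  have h0 : ∀ᶠ k : ℕ in atTop, C * (k : ℝ) ^ (p - 1) ≠ 0 := by
    filter_upwards [eventually_ge_atTop 1] with k hk
    have : (0 : ℝ) < k := by exact_mod_cast hk
    positivity
  have h := ((isEquivalent_iff_tendsto_one h0).1 hasymp).const_mul C
  rw [mul_one] at h
  refine h.congr' ?_
  filter_upwards [h0] with k hk
  have h1 := left_ne_zero_of_mul hk
  have h2 := right_ne_zero_of_mul hk
  simp only [Pi.div_apply]
  field_simp

lemma exists_le_rpow {C p : ℝ} {a : ℕ → ℝ}
    (hC : 0 < C) (hasymp : a ~[atTop] fun k : ℕ => C * (k : ℝ) ^ (p - 1)) :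
    ∃ A, 0 < A ∧ ∀ k : ℕ, 1 ≤ k → a k ≤ A * (k : ℝ) ^ (p - 1) := by
  obtain ⟨A, hA⟩ := (tendsto_div_rpow hC hasymp).bddAbove_range
  refine ⟨max A 1, by positivity, fun k hk => ?_⟩
  have hk' : (0 : ℝ) < k := by exact_mod_cast hk
  rw [← div_le_iff₀ (by positivity)]
  exact (hA ⟨k, rfl⟩).trans (le_max_left _ _)

lemma integrableOn_rpow_mul_exp_neg_mul {w c : ℝ} (hw : -1 < w) (hc : 0 < c) :
    IntegrableOn (fun x : ℝ => x ^ w * Real.exp (-c * x)) (Set.Ioi 0) := by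
  simpa using integrableOn_rpow_mul_exp_neg_mul_rpow (p := 1) hw one_pos hc

lemma rpow_le_of_mem_Icc {x y w : ℝ} (hx : 0 < x) (hxy : x ≤ y) (hy : y ≤ x + 1) :
    y ^ w ≤ 2 ^ |w| * (x ^ w + 1) := by
  have hy0 : 0 < y := hx.trans_le hxy
  have h2 : (1 : ℝ) ≤ 2 ^ |w| := Real.one_le_rpow (by norm_num) (abs_nonneg w)
  have hxw : 0 < x ^ w := by positivity
  rcases le_total 0 w with hw | hw
  · rw [abs_of_nonneg hw]
    rcases le_total x 1 with h1 | h1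
    · calc y ^ w ≤ 2 ^ w := Real.rpow_le_rpow hy0.le (by linarith) hw
        _ ≤ 2 ^ w * (x ^ w + 1) := le_mul_of_one_le_right (by positivity) (by linarith)
    · calc y ^ w ≤ (2 * x) ^ w := Real.rpow_le_rpow hy0.le (by linarith) hw
        _ = 2 ^ w * x ^ w := Real.mul_rpow (by norm_num) hx.le
        _ ≤ 2 ^ w * (x ^ w + 1) := by gcongr; linarith
  · calc y ^ w ≤ x ^ w := Real.rpow_le_rpow_of_nonpos hx hxy hw
      _ ≤ 1 * (x ^ w + 1) := by linarith
      _ ≤ 2 ^ |w| * (x ^ w + 1) := by gcongr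

/-- Sums `∑ k ^ s a_k e ^ (-η k)` over the `k` with `k / r_N` in a fixed region, where
`η r_N → c`, are asymptotic to `r_N ^ (s + p)` times an incomplete Gamma integral. -/
theorem tendsto_weighted_sum {C p : ℝ} (hC : 0 < C) (hp : 0 < p) {a : ℕ → ℝ}
    (ha : ∀ k, 1 ≤ k → 0 < a k) (hasymp : a ~[atTop] fun k : ℕ => C * (k : ℝ) ^ (p - 1))
    {η : ℕ → ℝ} {c : ℝ} (hc : 0 < c) (hη : Tendsto (fun N => η N * scaling C p N) atTop (𝓝 c))
    (D : ℕ → ℕ → Prop) [∀ N k, Decidable (D N k)] {S : Set ℝ}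
    (hS : MeasurableSet S)
    (hD : ∀ᵐ x : ℝ, 0 < x → ∀ᶠ N in atTop, (D N ⌈x * scaling C p N⌉₊ ↔ x ∈ S)) (s : ℕ) :
    Tendsto (fun N => (∑ k ∈ Finset.Icc 1 N with D N k, (k : ℝ) ^ s * a k * Real.exp (-η N * k))
        / scaling C p N ^ (s + p)) atTop
      (𝓝 (C * ∫ x in Set.Ioi 0 ∩ S, x ^ (s + p - 1) * Real.exp (-c * x))) := by
  set r := scaling C p with hr
  have hrlim : Tendsto r atTop atTop := tendsto_scaling hC hp
  have hrpos : ∀ᶠ N in atTop, 0 < r N := hrlim.eventually_gt_atTop 0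
  obtain ⟨A, hA, haA⟩ := exists_le_rpow hC hasymp
  set w : ℝ := s + p - 1 with hw
  have hw1 : -1 < w := by
    have : (0 : ℝ) ≤ s := Nat.cast_nonneg s
    linarith
  set g : ℕ → ℕ → ℝ := fun N k => if D N k then
    ((k : ℝ) / r N) ^ s * (a k * r N ^ (1 - p)) * Real.exp (-η N * k) else 0 with hg
  have hlim : Tendsto (fun N => (r N)⁻¹ * ∑ k ∈ Finset.Icc 1 N, g N k) atTop
      (𝓝 (∫ x in Set.Ioi (0 : ℝ), S.indicator (fun x => C * (x ^ w * Real.exp (-c * x))) x)) := by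
    refine tendsto_riemann_sum hrpos
      (B := fun x => A * (2 ^ |w| * (x ^ w + 1)) * Real.exp (-(c / 2) * x)) ?_ ?_ ?_ ?_
    · have h1 := integrableOn_rpow_mul_exp_neg_mul hw1 (half_pos hc)
      have h2 := integrableOn_rpow_mul_exp_neg_mul (w := 0) (by norm_num) (half_pos hc)
      refine ((h1.add h2).const_mul (A * 2 ^ |w|)).congr ?_
      refine Eventually.of_forall fun x => ?_
      simp only [Pi.add_apply, Real.rpow_zero]
      ring
    · filter_upwards [hrlim.eventually_ge_atTop 1, hη.eventually_const_le (half_lt_self hc)]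
        with N h1 h2 x hx _
      set k := ⌈x * r N⌉₊ with hk
      have hr0 : 0 < r N := by linarith
      have hk1 : 1 ≤ k := Nat.one_le_iff_ne_zero.2 (Nat.ceil_pos.2 (by positivity)).ne'
      have hk0 : (0 : ℝ) < k := by exact_mod_cast hk1
      have hxk : x ≤ k / r N := by
        rw [le_div_iff₀ hr0]
        exact Nat.le_ceil _
      have hkx : (k : ℝ) / r N ≤ x + 1 := by
        rw [div_le_iff₀ hr0]
        have := (Nat.ceil_lt_add_one (by positivity : 0 ≤ x * r N)).le
        rw [← hk] at this
        linarith
      have hak := ha k hk1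
      have hgk : |g N k| ≤ ((k : ℝ) / r N) ^ s * (a k * r N ^ (1 - p)) * Real.exp (-η N * k) := by
        simp only [hg]
        split_ifs
        · rw [abs_of_nonneg (by positivity)]
        · simp only [abs_zero]; positivity
      refine hgk.trans ?_
      have e1 : r N ^ (1 - p) = (r N ^ (p - 1))⁻¹ := by rw [← Real.rpow_neg hr0.le]; congr 1; ring
      have e2 : ((k : ℝ) / r N) ^ s * (a k * r N ^ (1 - p)) ≤ A * (k / r N) ^ w := by
        calc ((k : ℝ) / r N) ^ s * (a k * r N ^ (1 - p))
            ≤ ((k : ℝ) / r N) ^ s * (A * (k : ℝ) ^ (p - 1) * r N ^ (1 - p)) := by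
              gcongr
              exact haA k hk1
          _ = A * (((k : ℝ) / r N) ^ s * ((k : ℝ) / r N) ^ (p - 1)) := by
              rw [e1, Real.div_rpow hk0.le hr0.le]; ring
          _ = A * (k / r N) ^ w := by
              rw [← Real.rpow_natCast, ← Real.rpow_add (by positivity), hw, add_sub_assoc]
      have e3 : Real.exp (-η N * k) ≤ Real.exp (-(c / 2) * x) := by
        rw [Real.exp_le_exp]
        have : η N * k = (η N * r N) * (k / r N) := by field_simp
        have h3 : c / 2 * x ≤ (η N * r N) * (k / r N) :=
          mul_le_mul h2 hxk hx.le (by linarith)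
        linarith
      calc _ ≤ A * (k / r N) ^ w * Real.exp (-(c / 2) * x) := by
            gcongr
        _ ≤ A * (2 ^ |w| * (x ^ w + 1)) * Real.exp (-(c / 2) * x) := by
            gcongr
            exact rpow_le_of_mem_Icc hx hxk hkx
    · intro x hx
      positivity
    · filter_upwards [hD] with x hDx hx
      have hceil : Tendsto (fun N => (⌈x * r N⌉₊ : ℝ) / r N) atTop (𝓝 x) :=
        (tendsto_nat_ceil_mul_div_atTop hx.le).comp hrlim
      have hktop : Tendsto (fun N => ⌈x * r N⌉₊) atTop atTop :=
        tendsto_nat_ceil_atTop.comp (hrlim.const_mul_atTop hx)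
      by_cases hxS : x ∈ S
      · rw [Set.indicator_of_mem hxS]
        have h1 := (tendsto_div_rpow hC hasymp).comp hktop
        have h2 : Tendsto (fun N => ((⌈x * r N⌉₊ : ℝ) / r N) ^ s * (a ⌈x * r N⌉₊
            / (⌈x * r N⌉₊ : ℝ) ^ (p - 1) * ((⌈x * r N⌉₊ : ℝ) / r N) ^ (p - 1))
            * Real.exp (-((η N * r N) * ((⌈x * r N⌉₊ : ℝ) / r N)))) atTop
            (𝓝 (x ^ s * (C * x ^ (p - 1)) * Real.exp (-(c * x)))) :=
          ((hceil.pow s).mul (h1.mul (hceil.rpow_const (Or.inl hx.ne')))).mul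
            (Real.continuous_exp.continuousAt.tendsto.comp (hη.mul hceil).neg)
        have h3 : x ^ s * (C * x ^ (p - 1)) * Real.exp (-(c * x))
            = C * (x ^ w * Real.exp (-c * x)) := by
          rw [hw, add_sub_assoc, Real.rpow_add hx, Real.rpow_natCast, neg_mul]
          ring
        rw [h3] at h2
        refine h2.congr' ?_
        filter_upwards [hDx hx, eventually_ceil_le hC hp x, hrpos] with N h4 h5 h6
        rw [if_pos h5]
        simp only [hg]
        rw [if_pos (h4.2 hxS)]
        have hk0 : (0 : ℝ) < ⌈x * r N⌉₊ := by
          exact_mod_cast Nat.ceil_pos.2 (by positivity)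
        have e1 : r N ^ (1 - p) = (r N ^ (p - 1))⁻¹ := by
          rw [← Real.rpow_neg h6.le]; congr 1; ring
        rw [e1, Real.div_rpow hk0.le h6.le]
        have e2 : -((η N * r N) * ((⌈x * r N⌉₊ : ℝ) / r N)) = -η N * ⌈x * r N⌉₊ := by field_simp
        rw [e2]
        have : (⌈x * r N⌉₊ : ℝ) ^ (p - 1) ≠ 0 := by positivity
        field_simp
      · rw [Set.indicator_of_notMem hxS]
        refine tendsto_const_nhds.congr' ?_
        filter_upwards [hDx hx] with N h4
        have : ¬ D N ⌈x * r N⌉₊ := fun h => hxS (h4.1 h)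
        simp [hg, this]
  rw [setIntegral_indicator hS, integral_const_mul] at hlim
  refine hlim.congr' ?_
  filter_upwards [hrpos] with N hN
  rw [Finset.sum_filter, Finset.mul_sum, Finset.sum_div]
  refine Finset.sum_congr rfl fun k hk => ?_
  simp only [hg]
  split_ifs
  · have e1 : r N ^ ((s : ℝ) + p) = r N ^ s * r N ^ p := by
      rw [Real.rpow_add hN, Real.rpow_natCast]
    have e2 : r N ^ (1 - p) = r N / r N ^ p := by
      rw [Real.rpow_sub hN, Real.rpow_one]
    rw [e1, e2, div_pow]
    have : r N ^ p ≠ 0 := by positivity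
    field_simp
  · simp

/-- The complete sum `∑ k ^ s a_k e ^ (-η k)`, where `η r_N → c`. -/
lemma tendsto_full_sum {C p : ℝ} (hC : 0 < C) (hp : 0 < p) {a : ℕ → ℝ}
    (ha : ∀ k, 1 ≤ k → 0 < a k) (hasymp : a ~[atTop] fun k : ℕ => C * (k : ℝ) ^ (p - 1))
    {η : ℕ → ℝ} {c : ℝ} (hc : 0 < c) (hη : Tendsto (fun N => η N * scaling C p N) atTop (𝓝 c))
    (s : ℕ) :
    Tendsto (fun N : ℕ => (∑ k ∈ Finset.Icc 1 N, (k : ℝ) ^ s * a k * Real.exp (-η N * k))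
        / scaling C p N ^ (s + p)) atTop (𝓝 (C * ((1 / c) ^ (s + p) * Real.Gamma (s + p)))) := by
  have h := tendsto_weighted_sum hC hp ha hasymp hc hη (fun _ _ => True) (S := Set.univ)
    MeasurableSet.univ (Eventually.of_forall fun x _ => by simp) s
  have e := Real.integral_rpow_mul_exp_neg_mul_Ioi (a := s + p) (by positivity) hc
  simp only [Finset.filter_true, Set.inter_univ] at h
  rw [← e]
  simpa using h

/-- The `k` in the `j`-th stratum are those with `k / r_N` between the points `u_j` and
`u_{j+1}`, up to rounding. -/
lemma tendsto_stratSum {C p : ℝ} (hC : 0 < C) (hp : 0 < p) {a : ℕ → ℝ}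
    (ha : ∀ k, 1 ≤ k → 0 < a k) (hasymp : a ~[atTop] fun k : ℕ => C * (k : ℝ) ^ (p - 1))
    {q : ℕ} {u : ℕ → ℝ} (hu0 : u 0 = 0) (hu : ∀ j < q, u j < u (j + 1))
    {η : ℕ → ℝ} (hη : Tendsto (fun N => η N * scaling C p N) atTop (𝓝 1)) {j : ℕ} (hj : j ≤ q)
    (s : ℕ) :
    Tendsto (fun N => stratSum a C p u q (η N) N j s / scaling C p N ^ (s + p)) atTop
      (𝓝 (fInt C u q j (s + p - 1))) := by
  have hrlim : Tendsto (scaling C p) atTop atTop := tendsto_scaling hC hp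
  have huj := points_nonneg hu0 hu hj
  have h := tendsto_weighted_sum hC hp ha hasymp one_pos hη
    (fun N k => stratPoint C p u N j ≤ k ∧ (j < q → k < stratPoint C p u N (j + 1)))
    (measurableSet_region u q j) ?_ s
  · rw [Set.inter_eq_right.2 (region_subset huj)] at h
    simpa [fInt_eq, stratSum, stratum] using h
  · have hlow : ∀ x : ℝ, 0 < x → x ≠ u j →
        ∀ᶠ N in atTop, (stratPoint C p u N j ≤ ⌈x * scaling C p N⌉₊ ↔ u j < x) := by
      intro x hx hxj
      rcases hxj.lt_or_gt with hlt | hlt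
      · have hpos : 0 < u j - x := by linarith
        filter_upwards [(hrlim.const_mul_atTop hpos).eventually_ge_atTop 2] with N hN
        refine iff_of_false (fun hle => ?_) (not_lt.2 hlt.le)
        have h1 : u j * scaling C p N < stratPoint C p u N j + 1 := Nat.lt_floor_add_one _
        have h2 := Nat.ceil_lt_add_one (mul_nonneg hx.le (scaling_nonneg hC hp N))
        have h3 : (stratPoint C p u N j : ℝ) ≤ ⌈x * scaling C p N⌉₊ := by exact_mod_cast hle
        nlinarith
      · refine Eventually.of_forall fun N => iff_of_true ?_ hlt
        refine (Nat.floor_mono (mul_le_mul_of_nonneg_right hlt.le (scaling_nonneg hC hp N))).trans ?_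
        exact Nat.floor_le_ceil _
    have hup : ∀ x : ℝ, 0 < x → x ≠ u (j + 1) →
        ∀ᶠ N in atTop, (⌈x * scaling C p N⌉₊ < stratPoint C p u N (j + 1) ↔ x < u (j + 1)) := by
      intro x hx hxj
      rcases hxj.lt_or_gt with hlt | hlt
      · have hpos : 0 < u (j + 1) - x := by linarith
        filter_upwards [(hrlim.const_mul_atTop hpos).eventually_ge_atTop 2] with N hN
        refine iff_of_true ?_ hlt
        have h1 : u (j + 1) * scaling C p N < stratPoint C p u N (j + 1) + 1 :=
          Nat.lt_floor_add_one _
        have h2 := Nat.ceil_lt_add_one (mul_nonneg hx.le (scaling_nonneg hC hp N))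
        have h3 : (⌈x * scaling C p N⌉₊ : ℝ) < stratPoint C p u N (j + 1) := by nlinarith
        exact_mod_cast h3
      · refine Eventually.of_forall fun N => iff_of_false (not_lt.2 ?_) (not_lt.2 hlt.le)
        refine (Nat.floor_mono (mul_le_mul_of_nonneg_right hlt.le (scaling_nonneg hC hp N))).trans ?_
        exact Nat.floor_le_ceil _
    have hfin : ∀ᵐ x : ℝ, x ∉ ({u j, u (j + 1)} : Set ℝ) :=
      ((Set.toFinite _).measure_zero volume : volume ({u j, u (j + 1)} : Set ℝ) = 0) |>
        measure_eq_zero_iff_ae_notMem.1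
    filter_upwards [hfin] with x hx hx0
    simp only [Set.mem_insert_iff, Set.mem_singleton_iff, not_or] at hx
    filter_upwards [hlow x hx0 hx.1, hup x hx0 hx.2] with N h1 h2
    rw [h1, h2]
    unfold region
    split_ifs with hjq
    · simp [hjq]
    · simp [hjq]

/-- The hypothesis on the tilt forces `δ_N r_N → 1`: the sum `∑ k a_k e ^ (-d k)` decreases in `d`,
and its asymptotics at `d = x / r_N` separate `x < 1` from `x > 1`. -/
theorem tendsto_tilt_mul_scaling {C p : ℝ} (hC : 0 < C) (hp : 0 < p) {a : ℕ → ℝ}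
    (ha : ∀ k, 1 ≤ k → 0 < a k) (hasymp : a ~[atTop] fun k : ℕ => C * (k : ℝ) ^ (p - 1))
    {δ : ℕ → ℝ}
    (hδ : (fun N : ℕ => (∑ k ∈ Finset.Icc 1 N, (k : ℝ) * a k * Real.exp (-δ N * k)) - (N : ℝ))
      =o[atTop] fun N : ℕ => (N : ℝ) ^ ((p + 2) / (2 * (p + 1)))) :
    Tendsto (fun N => δ N * scaling C p N) atTop (𝓝 1) ∧
    Tendsto (fun N : ℕ => (N - ∑ k ∈ Finset.Icc 1 N, (k : ℝ) * a k * Real.exp (-δ N * k))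
      / scaling C p N ^ ((p + 2) / 2)) atTop (𝓝 0) := by
  have hΓ := Real.Gamma_pos_of_pos (by linarith : 0 < p + 1)
  set κ := C * Real.Gamma (p + 1) with hκ
  have hκ0 : 0 < κ := by positivity
  have hrlim : Tendsto (scaling C p) atTop atTop := tendsto_scaling hC hp
  set F : ℕ → ℝ → ℝ := fun N d => ∑ k ∈ Finset.Icc 1 N, (k : ℝ) * a k * Real.exp (-d * k) with hF
  have hpow : ∀ᶠ N : ℕ in atTop, (N : ℝ) ^ ((p + 2) / (2 * (p + 1)))
      = κ ^ ((p + 2) / (2 * (p + 1))) * scaling C p N ^ ((p + 2) / 2) := by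
    filter_upwards [hrlim.eventually_gt_atTop 0] with N hN
    rw [← mul_scaling_rpow hC hp N, Real.mul_rpow hκ0.le (by positivity), ← Real.rpow_mul hN.le]
    congr 2
    have : p + 1 ≠ 0 := by linarith
    field_simp
  have hsmall : Tendsto (fun N => (N - F N (δ N)) / scaling C p N ^ ((p + 2) / 2)) atTop (𝓝 0) := by
    have h1 := (hδ.tendsto_div_nhds_zero.neg).mul_const (κ ^ ((p + 2) / (2 * (p + 1))))
    rw [neg_zero, zero_mul] at h1
    refine h1.congr' ?_
    filter_upwards [hpow, hrlim.eventually_gt_atTop 0] with N hN hr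
    rw [hN]
    have : scaling C p N ^ ((p + 2) / 2) ≠ 0 := by positivity
    have h2 : κ ^ ((p + 2) / (2 * (p + 1))) ≠ 0 := by positivity
    change -((F N (δ N) - N) / _) * _ = _
    generalize F N (δ N) = f
    field_simp
    ring
  refine ⟨?_, hsmall⟩
  have hquot : Tendsto (fun N => F N (δ N) / scaling C p N ^ (p + 1)) atTop (𝓝 κ) := by
    have h1 : Tendsto (fun N => (N - F N (δ N)) / scaling C p N ^ ((p + 2) / 2)
        * (scaling C p N ^ (p / 2))⁻¹) atTop (𝓝 (0 * 0)) :=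
      hsmall.mul (((tendsto_rpow_atTop (half_pos hp)).comp hrlim).inv_tendsto_atTop)
    rw [zero_mul] at h1
    have h2 := tendsto_const_nhds (x := κ) |>.sub h1
    rw [sub_zero] at h2
    refine h2.congr' ?_
    filter_upwards [hrlim.eventually_gt_atTop 0] with N hr
    have e : scaling C p N ^ (p + 1)
        = scaling C p N ^ ((p + 2) / 2) * scaling C p N ^ (p / 2) := by
      rw [← Real.rpow_add hr]; congr 1; ring
    have hN := mul_scaling_rpow hC hp N
    rw [← hκ, e] at hN
    rw [e]
    have h3 : scaling C p N ^ ((p + 2) / 2) ≠ 0 := by positivity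
    have h4 : scaling C p N ^ (p / 2) ≠ 0 := by positivity
    generalize F N (δ N) = f
    field_simp
    rw [← hN]
    ring
  have hanti : ∀ N, Antitone (F N) := by
    intro N d d' hd
    refine Finset.sum_le_sum fun k hk => ?_
    have h1 := (Finset.mem_Icc.1 hk).1
    have h2 := ha k h1
    gcongr
  have hx : ∀ x : ℝ, 0 < x →
      Tendsto (fun N => F N (x / scaling C p N) / scaling C p N ^ (p + 1)) atTop
        (𝓝 (κ * (1 / x) ^ (p + 1))) := by
    intro x hx
    have h := tendsto_full_sum hC hp ha hasymp hx (η := fun N => x / scaling C p N) ?_ 1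
    · simp only [pow_one, Nat.cast_one] at h
      rw [add_comm (1 : ℝ) p] at h
      convert h using 2
      rw [hκ]; ring
    · refine tendsto_const_nhds.congr' ?_
      filter_upwards [hrlim.eventually_gt_atTop 0] with N hr
      field_simp
  rw [tendsto_order]
  constructor
  · intro y hy
    obtain ⟨x, hx1, hx2⟩ := exists_between (max_lt hy one_pos)
    have hx0 : 0 < x := (le_max_right _ _).trans_lt hx1
    have hgt : κ < κ * (1 / x) ^ (p + 1) :=
      lt_mul_of_one_lt_right hκ0 (Real.one_lt_rpow ((one_lt_div hx0).2 hx2) (by linarith))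
    obtain ⟨m, hm1, hm2⟩ := exists_between hgt
    filter_upwards [hquot.eventually_lt_const hm1, (hx x hx0).eventually_const_lt hm2,
      hrlim.eventually_gt_atTop 0] with N h1 h2 hr
    have h3 : F N (δ N) < F N (x / scaling C p N) := by
      have := h1.trans h2
      rwa [div_lt_div_iff_of_pos_right (by positivity)] at this
    have h4 : x / scaling C p N < δ N := (hanti N).reflect_lt h3
    rw [div_lt_iff₀ hr] at h4
    exact ((le_max_left _ _).trans_lt hx1).trans h4
  · intro y hy
    have hy0 : 0 < y := by linarith
    have hlt : κ * (1 / y) ^ (p + 1) < κ :=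
      mul_lt_of_lt_one_right hκ0 (Real.rpow_lt_one (by positivity)
        ((div_lt_one hy0).2 hy) (by linarith))
    obtain ⟨m, hm1, hm2⟩ := exists_between hlt
    filter_upwards [hquot.eventually_const_lt hm2, (hx y hy0).eventually_lt_const hm1,
      hrlim.eventually_gt_atTop 0] with N h1 h2 hr
    have h3 : F N (y / scaling C p N) < F N (δ N) := by
      have := h2.trans h1
      rwa [div_lt_div_iff_of_pos_right (by positivity)] at this
    have h4 : δ N < y / scaling C p N := (hanti N).reflect_lt h3
    rwa [lt_div_iff₀ hr] at h4

/-! ### Trigonometric sums -/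

/-- The sum telescopes after multiplication by `2 sin (s / 2)`. -/
lemma abs_sum_cos_le {s : ℝ} (hs0 : s ≠ 0) (hs : |s| ≤ Real.pi) {m n : ℕ} (hmn : m ≤ n) :
    |∑ k ∈ Finset.Ioc m n, Real.cos (k * s)| ≤ Real.pi / |s| := by
  have htel : 2 * Real.sin (s / 2) * ∑ k ∈ Finset.Ioc m n, Real.cos (k * s)
      = Real.sin ((n + 1 / 2) * s) - Real.sin ((m + 1 / 2) * s) := by
    induction n, hmn using Nat.le_induction with
    | base => simp
    | succ n hmn ih =>
      rw [Finset.sum_Ioc_succ_top (by omega), mul_add, ih]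
      have h1 : ((n + 1 : ℕ) + 1 / 2 : ℝ) * s = (n + 1 : ℕ) * s + s / 2 := by push_cast; ring
      have h2 : ((n : ℝ) + 1 / 2) * s = (n + 1 : ℕ) * s - s / 2 := by push_cast; ring
      rw [h1, h2, Real.sin_add, Real.sin_sub]
      ring
  have hsin : |s| / Real.pi ≤ |Real.sin (s / 2)| := by
    have h := Real.mul_le_sin (x := |s| / 2) (by positivity) (by linarith)
    have e : |Real.sin (s / 2)| = Real.sin (|s| / 2) := by
      rcases le_total 0 s with h0 | h0
      · rw [abs_of_nonneg h0] at hs ⊢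
        exact abs_of_nonneg (Real.sin_nonneg_of_nonneg_of_le_pi (by linarith)
          (by linarith [Real.pi_pos]))
      · rw [abs_of_nonpos h0] at hs ⊢
        rw [show s / 2 = -(-s / 2) by ring, Real.sin_neg, abs_neg]
        exact abs_of_nonneg (Real.sin_nonneg_of_nonneg_of_le_pi (by linarith)
          (by linarith [Real.pi_pos]))
    rw [e]
    calc |s| / Real.pi = 2 / Real.pi * (|s| / 2) := by ring
      _ ≤ _ := h
  have hs' : 0 < |s| := abs_pos.2 hs0
  have hup : 2 * (|s| / Real.pi) * |∑ k ∈ Finset.Ioc m n, Real.cos (k * s)| ≤ 2 := by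
    calc 2 * (|s| / Real.pi) * |∑ k ∈ Finset.Ioc m n, Real.cos (k * s)|
        ≤ 2 * |Real.sin (s / 2)| * |∑ k ∈ Finset.Ioc m n, Real.cos (k * s)| := by gcongr
      _ = |2 * Real.sin (s / 2) * ∑ k ∈ Finset.Ioc m n, Real.cos (k * s)| := by
          rw [abs_mul, abs_mul, abs_two]
      _ ≤ 2 := by
          rw [htel]
          refine (abs_sub _ _).trans ?_
          linarith [Real.abs_sin_le_one ((n + 1 / 2) * s), Real.abs_sin_le_one ((m + 1 / 2) * s)]
  rw [le_div_iff₀ hs']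
  have hpi := Real.pi_pos
  have : 2 * (|s| / Real.pi) * |∑ k ∈ Finset.Ioc m n, Real.cos (k * s)|
      = 2 * (|∑ k ∈ Finset.Ioc m n, Real.cos (k * s)| * |s|) / Real.pi := by ring
  rw [this, div_le_iff₀ hpi] at hup
  linarith

/-- A lower bound that is quadratic near `s = 0` and of full order on the rest of the circle. -/
lemma mul_min_le_sum_one_sub_cos {L : ℕ} (hL : 1 ≤ L) {s : ℝ} (hs : |s| ≤ Real.pi) :
    L * min 1 ((L * s) ^ 2 / 5) ≤ ∑ k ∈ Finset.Ioc L (9 * L), (1 - Real.cos (k * s)) := by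
  have hL0 : (1 : ℝ) ≤ L := by exact_mod_cast hL
  have hpi := Real.pi_pos
  rcases le_total (2 * L * |s|) Real.pi with h | h
  · -- On the block `(L, 2L]` all angles are at most `π`.
    have h1 : ∀ k ∈ Finset.Ioc L (2 * L), (L * s) ^ 2 / 5 ≤ 1 - Real.cos (k * s) := by
      intro k hk
      obtain ⟨hk1, hk2⟩ := Finset.mem_Ioc.1 hk
      have hk1' : (L : ℝ) ≤ k := by exact_mod_cast hk1.le
      have hk2' : (k : ℝ) ≤ 2 * L := by exact_mod_cast hk2
      have habs : |k * s| ≤ Real.pi := by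
        rw [abs_mul, Nat.abs_cast]
        exact (mul_le_mul_of_nonneg_right hk2' (abs_nonneg s)).trans h
      have h2 := Real.cos_le_one_sub_mul_cos_sq habs
      have h3 : (1 : ℝ) / 5 ≤ 2 / Real.pi ^ 2 := by
        rw [div_le_div_iff₀ (by norm_num) (by positivity)]
        nlinarith [Real.pi_lt_d2]
      have h4 : (L * s) ^ 2 ≤ (k * s) ^ 2 := by
        rw [mul_pow, mul_pow]
        gcongr
      have h5 : (L * s) ^ 2 / 5 ≤ 2 / Real.pi ^ 2 * (k * s) ^ 2 := by
        calc (L * s) ^ 2 / 5 = 1 / 5 * (L * s) ^ 2 := by ring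
          _ ≤ 2 / Real.pi ^ 2 * (k * s) ^ 2 := by gcongr
      linarith
    calc L * min 1 ((L * s) ^ 2 / 5) ≤ L * ((L * s) ^ 2 / 5) := by
          gcongr; exact min_le_right _ _
      _ = ∑ k ∈ Finset.Ioc L (2 * L), (L * s) ^ 2 / 5 := by
          rw [Finset.sum_const, Nat.card_Ioc, nsmul_eq_mul]
          congr 2
          omega
      _ ≤ ∑ k ∈ Finset.Ioc L (2 * L), (1 - Real.cos (k * s)) := Finset.sum_le_sum h1
      _ ≤ _ := Finset.sum_le_sum_of_subset_of_nonneg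
          (Finset.Ioc_subset_Ioc_right (by omega))
          fun k _ _ => by linarith [Real.cos_le_one (k * s)]
  · -- The block `(L, 9L]` is long enough for the cosines to cancel.
    have hs0 : s ≠ 0 := by
      rintro rfl
      simp only [abs_zero, mul_zero] at h
      linarith
    have hs' : 0 < |s| := abs_pos.2 hs0
    have h1 := (le_abs_self _).trans (abs_sum_cos_le hs0 hs (by omega : L ≤ 9 * L))
    have h2 : Real.pi / |s| ≤ 2 * L := by rwa [div_le_iff₀ hs']
    rw [Finset.sum_sub_distrib, Finset.sum_const, Nat.card_Ioc, nsmul_eq_mul, mul_one,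
      show 9 * L - L = 8 * L by omega]
    push_cast
    have h3 : (L : ℝ) * min 1 ((L * s) ^ 2 / 5) ≤ L * 1 := by gcongr; exact min_le_left _ _
    linarith

/-- A shift of the angle by `θ` costs at most `θ ^ 2`, so lower bounds for the sums of
`1 - cos (k s)` carry over to the shifted angles `θ_k + k s`. -/
lemma one_sub_cos_le_two_mul (x θ : ℝ) :
    1 - Real.cos x ≤ 2 * (1 - Real.cos (θ + x)) + θ ^ 2 := by
  have h : 1 - Real.cos x ≤ 2 * (1 - Real.cos (θ + x)) + 2 * (1 - Real.cos θ) := by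
    have e : Real.cos x = Real.cos (θ + x) * Real.cos θ + Real.sin (θ + x) * Real.sin θ := by
      rw [← Real.cos_sub]; congr 1; ring
    rw [e]
    nlinarith [sq_nonneg (Real.cos (θ + x) + Real.cos θ - 2),
      sq_nonneg (Real.sin (θ + x) + Real.sin θ), Real.sin_sq_add_cos_sq θ,
      Real.sin_sq_add_cos_sq (θ + x)]
  linarith [Real.one_sub_sq_div_two_le_cos (x := θ)]

lemma norm_exp_sub_taylor_le (y : ℝ) :
    ‖Complex.exp (y * Complex.I) - 1 - y * Complex.I + (y : ℂ) ^ 2 / 2‖ ≤ 4 * |y| ^ 3 := by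
  have hn : ‖(y * Complex.I : ℂ)‖ = |y| := by simp
  rcases le_total |y| 1 with h | h
  · have h1 := Complex.exp_bound (x := y * Complex.I) (by rw [hn]; exact h) (n := 3) (by norm_num)
    rw [hn] at h1
    have e : Complex.exp (y * Complex.I) - ∑ m ∈ Finset.range 3, (y * Complex.I) ^ m / m.factorial
        = Complex.exp (y * Complex.I) - 1 - y * Complex.I + (y : ℂ) ^ 2 / 2 := by
      simp only [Finset.sum_range_succ, Finset.sum_range_zero, Nat.factorial]
      have := Complex.I_sq
      push_cast
      linear_combination (-(y : ℂ) ^ 2 / 2) * this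
    rw [e] at h1
    refine h1.trans ?_
    rw [mul_comm]
    gcongr
    norm_num [Nat.factorial]
  · have h1 : ‖Complex.exp (y * Complex.I)‖ = 1 := Complex.norm_exp_ofReal_mul_I y
    have h2 : ‖(y : ℂ) ^ 2 / 2‖ = |y| ^ 2 / 2 := by simp
    calc _ ≤ ‖Complex.exp (y * Complex.I)‖ + ‖(1 : ℂ)‖ + ‖(y * Complex.I : ℂ)‖
          + ‖(y : ℂ) ^ 2 / 2‖ := by
          refine (norm_add_le _ _).trans ?_
          gcongr
          refine (norm_sub_le _ _).trans ?_
          gcongr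
          exact norm_sub_le _ _
      _ = 2 + |y| + |y| ^ 2 / 2 := by rw [h1, h2, hn, norm_one]; ring
      _ ≤ 4 * |y| ^ 3 := by
          have h3 : 1 ≤ |y| ^ 3 := one_le_pow₀ h
          have h4 : |y| ≤ |y| ^ 3 := le_self_pow₀ h (by norm_num)
          have h5 : |y| ^ 2 ≤ |y| ^ 3 := pow_le_pow_right₀ h (by norm_num)
          linarith

/-! ### The local limit theorem -/

/-- A stretched-exponential function, which dominates the rescaled Fourier integrands. -/
noncomputable def stretchedExp (κ β v : ℝ) : ℝ := Real.exp (-(β * (|v| ^ κ - 1)))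

lemma integrable_stretchedExp {κ β : ℝ} (hκ : 0 < κ) (hβ : 0 < β) :
    Integrable (stretchedExp κ β) := by
  have h1 : IntegrableOn (fun x : ℝ => Real.exp (-β * x ^ κ)) (Set.Ioi 0) := by
    simpa using integrableOn_rpow_mul_exp_neg_mul_rpow (s := 0) (by norm_num) hκ hβ
  have h2 : IntegrableOn (stretchedExp κ β) (Set.Ioi 0) := by
    refine (h1.const_mul (Real.exp β)).congr ?_
    refine (ae_restrict_iff' measurableSet_Ioi).2 (Eventually.of_forall fun x hx => ?_)
    rw [Set.mem_Ioi] at hx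
    simp only [stretchedExp]
    rw [← Real.exp_add, abs_of_pos hx]
    congr 1
    ring
  have h3 : (fun x => stretchedExp κ β (-x)) = stretchedExp κ β := by
    funext x
    simp [stretchedExp]
  rw [← integrableOn_univ, ← Set.Iio_union_Ici (a := (0 : ℝ)), integrableOn_union,
    integrableOn_Ici_iff_integrableOn_Ioi]
  refine ⟨?_, h2⟩
  rw [← (Measure.measurePreserving_neg (volume : Measure ℝ)).integrableOn_comp_preimage
      (Homeomorph.neg ℝ).measurableEmbedding]
  simpa only [Function.comp_def, h3, Set.neg_preimage, Set.neg_Iio, neg_zero] using h2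

/-- The parameters are of full order `r ^ (p - 1)` on a block of sizes comparable to `r`. -/
def BlockBound (p β r : ℝ) (N : ℕ) (b : ℕ → ℝ) : Prop :=
  9 * ⌈r⌉₊ ≤ N ∧ ∀ k ∈ Finset.Ioc ⌈r⌉₊ (9 * ⌈r⌉₊), β * r ^ (p - 1) ≤ b k

lemma BlockBound.le_sum_one_sub_cos {p β r : ℝ} (hp : 0 < p) (hβ : 0 ≤ β) (hr : 1 ≤ r) {N : ℕ}
    {b : ℕ → ℝ} (hb : ∀ k, 1 ≤ k → 0 ≤ b k) (h : BlockBound p β r N b) {v : ℝ}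
    (hv : |v| ≤ Real.pi * r ^ ((p + 2) / 2)) :
    β / 10 * (|v| ^ (2 * p / (p + 2)) - 1)
      ≤ ∑ k ∈ Finset.Icc 1 N, b k * (1 - Real.cos (k * (v / r ^ ((p + 2) / 2)))) := by
  obtain ⟨hN, hblock⟩ := h
  have hr0 : 0 < r := by linarith
  set ρ := r ^ ((p + 2) / 2) with hρ
  have hρ0 : 0 < ρ := by positivity
  set L := ⌈r⌉₊ with hL
  have hL1 : 1 ≤ L := Nat.one_le_iff_ne_zero.2 (Nat.ceil_pos.2 hr0).ne'
  have hrL : r ≤ L := Nat.le_ceil r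
  set s := v / ρ with hs
  have hs1 : |s| ≤ Real.pi := by
    rw [hs, abs_div, abs_of_pos hρ0, div_le_iff₀ hρ0]
    exact hv
  set κ := 2 * p / (p + 2) with hκ
  have hκ0 : 0 ≤ κ := by positivity
  have hκ2 : κ ≤ 2 := by
    rw [hκ, div_le_iff₀ (by linarith)]
    linarith
  have hmin : (0 : ℝ) ≤ min 1 ((r * s) ^ 2 / 5) := le_min zero_le_one (by positivity)
  have hsum : β * r ^ p * min 1 ((r * s) ^ 2 / 5)
      ≤ ∑ k ∈ Finset.Icc 1 N, b k * (1 - Real.cos (k * s)) := by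
    calc β * r ^ p * min 1 ((r * s) ^ 2 / 5)
        = β * r ^ (p - 1) * (r * min 1 ((r * s) ^ 2 / 5)) := by
          rw [Real.rpow_sub_one hr0.ne']; field_simp
      _ ≤ β * r ^ (p - 1) * (L * min 1 ((L * s) ^ 2 / 5)) := by
          rw [mul_pow, mul_pow] at *
          gcongr
      _ ≤ β * r ^ (p - 1) * ∑ k ∈ Finset.Ioc L (9 * L), (1 - Real.cos (k * s)) := by
          gcongr
          exact mul_min_le_sum_one_sub_cos hL1 hs1
      _ ≤ ∑ k ∈ Finset.Ioc L (9 * L), b k * (1 - Real.cos (k * s)) := by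
          rw [Finset.mul_sum]
          refine Finset.sum_le_sum fun k hk => ?_
          exact mul_le_mul_of_nonneg_right (hblock k hk) (by linarith [Real.cos_le_one (k * s)])
      _ ≤ ∑ k ∈ Finset.Icc 1 N, b k * (1 - Real.cos (k * s)) := by
          refine Finset.sum_le_sum_of_subset_of_nonneg (fun k hk => ?_) fun k hk _ => ?_
          · obtain ⟨h1, h2⟩ := Finset.mem_Ioc.1 hk
            exact Finset.mem_Icc.2 ⟨by omega, by omega⟩
          · exact mul_nonneg (hb k (Finset.mem_Icc.1 hk).1) (by linarith [Real.cos_le_one (k * s)])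
  refine le_trans ?_ hsum
  have hρsq : ρ ^ 2 = r ^ p * r ^ 2 := by
    rw [hρ, ← Real.rpow_natCast, ← Real.rpow_mul hr0.le, ← Real.rpow_natCast r 2,
      ← Real.rpow_add hr0]
    congr 1
    push_cast
    ring
  have hrp : 0 < r ^ p := by positivity
  have hquad : r ^ p * ((r * s) ^ 2 / 5) = v ^ 2 / 5 := by
    rw [hs, mul_pow, div_pow, hρsq]
    field_simp
  have hpi : Real.pi ^ κ ≤ 10 := by
    calc Real.pi ^ κ ≤ Real.pi ^ (2 : ℝ) :=
          Real.rpow_le_rpow_of_exponent_le (by linarith [Real.pi_gt_three]) hκ2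
      _ = Real.pi ^ 2 := by norm_cast
      _ ≤ 10 := by nlinarith [Real.pi_lt_d2, Real.pi_pos]
  -- The exponent is chosen so that `|v| ≤ π ρ` gives `|v| ^ κ ≤ π ^ κ r ^ p`.
  have hfirst : |v| ^ κ / 10 ≤ r ^ p := by
    have h1 : |v| ^ κ ≤ (Real.pi * ρ) ^ κ := Real.rpow_le_rpow (abs_nonneg v) hv hκ0
    have h2 : ρ ^ κ = r ^ p := by
      rw [hρ, ← Real.rpow_mul hr0.le]
      congr 1
      rw [hκ]
      field_simp
    rw [Real.mul_rpow Real.pi_pos.le hρ0.le, h2] at h1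
    rw [div_le_iff₀ (by norm_num)]
    nlinarith
  have hsecond : (|v| ^ κ - 1) / 10 ≤ v ^ 2 / 5 := by
    rcases le_total |v| 1 with h1 | h1
    · have : |v| ^ κ ≤ 1 := Real.rpow_le_one (abs_nonneg v) h1 hκ0
      nlinarith [sq_nonneg v]
    · have : |v| ^ κ ≤ |v| ^ (2 : ℝ) := Real.rpow_le_rpow_of_exponent_le h1 hκ2
      have e : |v| ^ (2 : ℝ) = v ^ 2 := by rw [Real.rpow_two, sq_abs]
      rw [e] at this
      nlinarith [sq_nonneg v]
  have hfin : (|v| ^ κ - 1) / 10 ≤ r ^ p * min 1 ((r * s) ^ 2 / 5) := by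
    rw [mul_min_of_nonneg _ _ hrp.le, mul_one, hquad]
    exact le_min (by linarith) hsecond
  calc β / 10 * (|v| ^ κ - 1) = β * ((|v| ^ κ - 1) / 10) := by ring
    _ ≤ β * (r ^ p * min 1 ((r * s) ^ 2 / 5)) := by gcongr
    _ = _ := by ring

/-- The Fourier integrand of the centred variable `∑ θ_k (n_k - b_k)` on the event
`∑ k n_k = N`. -/
noncomputable def fourierIntegrand (b θ : ℕ → ℝ) (N : ℕ) (s : ℝ) : ℂ :=
  Complex.exp ((∑ k ∈ Finset.Icc 1 N, (b k : ℂ) * (Complex.exp ((θ k + k * s : ℝ) * Complex.I) - 1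
    - (θ k : ℝ) * Complex.I)) - N * s * Complex.I)

lemma continuous_fourierIntegrand (b θ : ℕ → ℝ) (N : ℕ) : Continuous (fourierIntegrand b θ N) := by
  unfold fourierIntegrand
  fun_prop

lemma norm_fourierIntegrand (b θ : ℕ → ℝ) (N : ℕ) (s : ℝ) :
    ‖fourierIntegrand b θ N s‖
      = Real.exp (-∑ k ∈ Finset.Icc 1 N, b k * (1 - Real.cos (θ k + k * s))) := by
  rw [fourierIntegrand, Complex.norm_exp]
  congr 1
  rw [Complex.sub_re, Complex.re_sum, ← Finset.sum_neg_distrib]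
  have e : (N * s * Complex.I : ℂ).re = 0 := by simp
  rw [e, sub_zero]
  refine Finset.sum_congr rfl fun k _ => ?_
  rw [Complex.re_ofReal_mul, Complex.sub_re, Complex.sub_re, Complex.exp_ofReal_mul_I_re,
    Complex.re_ofReal_mul, Complex.I_re, Complex.one_re]
  ring

lemma norm_fourierIntegrand_le {p β r M : ℝ} (hp : 0 < p) (hβ : 0 ≤ β) (hr : 1 ≤ r) {N : ℕ}
    {b θ : ℕ → ℝ} (hb : ∀ k, 1 ≤ k → 0 ≤ b k) (h : BlockBound p β r N b)
    (hM : ∑ k ∈ Finset.Icc 1 N, b k * θ k ^ 2 ≤ M) {v : ℝ}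
    (hv : |v| ≤ Real.pi * r ^ ((p + 2) / 2)) :
    ‖fourierIntegrand b θ N (v / r ^ ((p + 2) / 2))‖
      ≤ Real.exp (M / 2) * stretchedExp (2 * p / (p + 2)) (β / 20) v := by
  rw [norm_fourierIntegrand, stretchedExp, ← Real.exp_add, Real.exp_le_exp]
  have h1 := h.le_sum_one_sub_cos hp hβ hr hb hv
  set s := v / r ^ ((p + 2) / 2)
  have h2 : ∑ k ∈ Finset.Icc 1 N, b k * (1 - Real.cos (k * s))
      ≤ 2 * ∑ k ∈ Finset.Icc 1 N, b k * (1 - Real.cos (θ k + k * s))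
        + ∑ k ∈ Finset.Icc 1 N, b k * θ k ^ 2 := by
    rw [Finset.mul_sum, ← Finset.sum_add_distrib]
    refine Finset.sum_le_sum fun k hk => ?_
    have := mul_le_mul_of_nonneg_left (one_sub_cos_le_two_mul (k * s) (θ k))
      (hb k (Finset.mem_Icc.1 hk).1)
    linarith
  linarith

/-- A version of the local limit theorem: the rescaled Fourier integrals converge to a Gaussian
integral, where `Q v` is the limit of the variances of `∑ (θ_k + k s) n_k` at
`s = v r ^ (-(p + 2) / 2)`. -/
theorem tendsto_integral_fourierIntegrand {p β K M : ℝ} (hp : 0 < p) (hβ : 0 < β) (hK : 0 ≤ K)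
    {r : ℕ → ℝ} (hr : Tendsto r atTop atTop) {b ψ : ℕ → ℕ → ℝ} (hb : ∀ N k, 1 ≤ k → 0 ≤ b N k)
    (hψ : ∀ᶠ N in atTop, ∀ k ∈ Finset.Icc 1 N, |ψ N k| ≤ K * (1 + k / r N))
    (hM : ∀ᶠ N in atTop, ∑ k ∈ Finset.Icc 1 N, b N k * (1 + k / r N) ^ 3 ≤ M * r N ^ p)
    (hblock : ∀ᶠ N in atTop, BlockBound p β (r N) N (b N))
    (hmean : Tendsto (fun N : ℕ => (N - ∑ k ∈ Finset.Icc 1 N, k * b N k) / r N ^ ((p + 2) / 2))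
      atTop (𝓝 0))
    {Q : ℝ → ℝ} (hQ : ∀ v, Tendsto (fun N => (∑ k ∈ Finset.Icc 1 N,
      b N k * (ψ N k + v * (k / r N)) ^ 2) / r N ^ p) atTop (𝓝 (Q v))) :
    Tendsto (fun N => ∫ v in Set.Ioc (-(Real.pi * r N ^ ((p + 2) / 2)))
      (Real.pi * r N ^ ((p + 2) / 2)), fourierIntegrand (b N) (fun k => ψ N k / r N ^ (p / 2)) N
        (v / r N ^ ((p + 2) / 2))) atTop (𝓝 (∫ v : ℝ, ((Real.exp (-(Q v / 2)) : ℝ) : ℂ))) := by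
  set ρ : ℕ → ℝ := fun N => r N ^ ((p + 2) / 2) with hρdef
  set θ : ℕ → ℕ → ℝ := fun N k => ψ N k / r N ^ (p / 2) with hθdef
  have hr1 : ∀ᶠ N in atTop, 1 ≤ r N := hr.eventually_ge_atTop 1
  have hρlim : Tendsto ρ atTop atTop :=
    (tendsto_rpow_atTop (by positivity : 0 < (p + 2) / 2)).comp hr
  have hsq : ∀ N, 1 ≤ r N → (r N ^ (p / 2)) ^ 2 = r N ^ p := fun N h1 => by
    rw [← Real.rpow_natCast, ← Real.rpow_mul (by linarith)]
    congr 1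
    push_cast
    ring
  have hρeq : ∀ N, 1 ≤ r N → ρ N = r N ^ (p / 2) * r N := fun N h1 => by
    rw [hρdef]
    simp only
    rw [← Real.rpow_add_one (by linarith)]
    congr 1
    ring
  have hdom : ∀ᶠ N in atTop, ∀ v, |v| ≤ Real.pi * ρ N → ‖fourierIntegrand (b N) (θ N) N (v / ρ N)‖
      ≤ Real.exp (K ^ 2 * M / 2) * stretchedExp (2 * p / (p + 2)) (β / 20) v := by
    filter_upwards [hψ, hM, hblock, hr1] with N h1 h2 h3 h4 v hv
    refine norm_fourierIntegrand_le hp hβ.le h4 (hb N) h3 ?_ hv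
    have hrp : 0 < r N ^ p := by positivity
    calc ∑ k ∈ Finset.Icc 1 N, b N k * θ N k ^ 2
        ≤ ∑ k ∈ Finset.Icc 1 N, K ^ 2 / r N ^ p * (b N k * (1 + k / r N) ^ 3) := by
          refine Finset.sum_le_sum fun k hk => ?_
          have hbk := hb N k (Finset.mem_Icc.1 hk).1
          have hone : 1 ≤ 1 + (k : ℝ) / r N := by
            have : 0 ≤ (k : ℝ) / r N := by positivity
            linarith
          have e1 : θ N k ^ 2 = ψ N k ^ 2 / r N ^ p := by
            rw [hθdef]; simp only; rw [div_pow, hsq N h4]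
          have e2 : ψ N k ^ 2 ≤ K ^ 2 * (1 + k / r N) ^ 3 := by
            calc ψ N k ^ 2 = |ψ N k| ^ 2 := (sq_abs _).symm
              _ ≤ (K * (1 + k / r N)) ^ 2 := by gcongr; exact h1 k hk
              _ = K ^ 2 * (1 + k / r N) ^ 2 := by ring
              _ ≤ K ^ 2 * (1 + k / r N) ^ 3 := by
                  gcongr
                  norm_num
          rw [e1]
          calc b N k * (ψ N k ^ 2 / r N ^ p) ≤ b N k * (K ^ 2 * (1 + k / r N) ^ 3 / r N ^ p) := by
                gcongr
            _ = _ := by ring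
      _ ≤ K ^ 2 / r N ^ p * (M * r N ^ p) := by
          rw [← Finset.mul_sum]
          gcongr
      _ = K ^ 2 * M := by field_simp
  have hpt : ∀ v : ℝ, Tendsto (fun N => fourierIntegrand (b N) (θ N) N (v / ρ N)) atTop
      (𝓝 ((Real.exp (-(Q v / 2)) : ℝ) : ℂ)) := by
    intro v
    set y : ℕ → ℕ → ℝ := fun N k => θ N k + k * (v / ρ N) with hy
    have hyeq : ∀ N k, 1 ≤ r N → y N k = (ψ N k + v * (k / r N)) / r N ^ (p / 2) := by
      intro N k h1
      have : r N ≠ 0 := by positivity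
      have h3 : r N ^ (p / 2) ≠ 0 := by positivity
      simp only [hy, hθdef]
      rw [hρeq N h1]
      field_simp
    -- Expand the exponentials to second order: the quadratic terms converge to `Q v`, the cubic
    -- remainder is of order `r ^ (-p / 2)`, and the linear terms are controlled by `hmean`.
    have hquad : Tendsto (fun N => ∑ k ∈ Finset.Icc 1 N, b N k * y N k ^ 2) atTop (𝓝 (Q v)) := by
      refine (hQ v).congr' ?_
      filter_upwards [hr1] with N h1
      rw [Finset.sum_div]
      refine Finset.sum_congr rfl fun k _ => ?_
      rw [hyeq N k h1, div_pow, hsq N h1]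
      ring
    have hrem : Tendsto (fun N => ∑ k ∈ Finset.Icc 1 N, (b N k : ℂ) *
        (Complex.exp (y N k * Complex.I) - 1 - y N k * Complex.I + (y N k : ℂ) ^ 2 / 2)) atTop
        (𝓝 0) := by
      have hz : Tendsto (fun N => 4 * (K + |v|) ^ 3 * M * (r N ^ (p / 2))⁻¹) atTop (𝓝 0) := by
        have := (((tendsto_rpow_atTop (half_pos hp)).comp hr).inv_tendsto_atTop).const_mul
          (4 * (K + |v|) ^ 3 * M)
        rw [mul_zero] at this
        exact this
      refine squeeze_zero_norm' ?_ hz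
      filter_upwards [hψ, hM, hr1] with N h1 h2 h4
      have hrp : 0 < r N ^ p := by positivity
      have hrh : 0 < r N ^ (p / 2) := by positivity
      calc _ ≤ ∑ k ∈ Finset.Icc 1 N, b N k * (4 * |y N k| ^ 3) := by
            refine (norm_sum_le _ _).trans (Finset.sum_le_sum fun k hk => ?_)
            have hbk := hb N k (Finset.mem_Icc.1 hk).1
            rw [norm_mul, Complex.norm_real, Real.norm_of_nonneg hbk]
            exact mul_le_mul_of_nonneg_left (norm_exp_sub_taylor_le _) hbk
        _ ≤ ∑ k ∈ Finset.Icc 1 N, 4 * (K + |v|) ^ 3 / (r N ^ (p / 2)) ^ 3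
              * (b N k * (1 + k / r N) ^ 3) := by
            refine Finset.sum_le_sum fun k hk => ?_
            have hbk := hb N k (Finset.mem_Icc.1 hk).1
            have hkr : 0 ≤ (k : ℝ) / r N := by positivity
            have e : |y N k| ≤ (K + |v|) * (1 + k / r N) / r N ^ (p / 2) := by
              rw [hyeq N k h4, abs_div, abs_of_pos hrh]
              gcongr
              refine (abs_add_le _ _).trans ?_
              rw [abs_mul, abs_of_nonneg hkr, add_mul]
              have := h1 k hk
              have : |v| * (k / r N) ≤ |v| * (1 + k / r N) := by gcongr; linarith
              linarith
            calc b N k * (4 * |y N k| ^ 3)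
                ≤ b N k * (4 * ((K + |v|) * (1 + k / r N) / r N ^ (p / 2)) ^ 3) := by gcongr
              _ = _ := by ring
        _ ≤ 4 * (K + |v|) ^ 3 / (r N ^ (p / 2)) ^ 3 * (M * r N ^ p) := by
            rw [← Finset.mul_sum]
            gcongr
        _ = _ := by
            rw [← hsq N h4]
            field_simp
    have hlin : Tendsto (fun N : ℕ => ((v * ((N - ∑ k ∈ Finset.Icc 1 N, k * b N k) / ρ N) : ℝ) : ℂ)
        * Complex.I) atTop (𝓝 0) := by
      have := (hmean.const_mul v).ofReal |>.mul_const Complex.I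
      simpa using this
    have hexp := Complex.continuous_exp.continuousAt.tendsto.comp
      ((hrem.sub ((hquad.ofReal).div_const 2)).sub hlin)
    have e : Complex.exp (0 - ((Q v : ℝ) : ℂ) / 2 - 0) = ((Real.exp (-(Q v / 2)) : ℝ) : ℂ) := by
      push_cast
      congr 1
      ring
    rw [← e]
    refine hexp.congr fun N => ?_
    simp only [Function.comp, fourierIntegrand]
    congr 1
    simp only [hy]
    push_cast
    simp only [Finset.sum_div, ← Finset.sum_sub_distrib]
    have e3 : (v : ℂ) * ((N - ∑ k ∈ Finset.Icc 1 N, (k : ℂ) * b N k) / ρ N) * Complex.I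
        = N * (v / ρ N) * Complex.I
          - ∑ k ∈ Finset.Icc 1 N, (k : ℂ) * b N k * (v / ρ N) * Complex.I := by
      rw [← Finset.sum_mul, ← Finset.sum_mul]
      ring
    rw [e3, sub_sub_eq_add_sub]
    congr 1
    rw [← Finset.sum_add_distrib]
    refine Finset.sum_congr rfl fun k _ => ?_
    ring
  have hind : ∀ N, ∫ v in Set.Ioc (-(Real.pi * ρ N)) (Real.pi * ρ N),
      fourierIntegrand (b N) (θ N) N (v / ρ N) = ∫ v, (Set.Ioc (-(Real.pi * ρ N)) (Real.pi * ρ N)).indicator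
        (fun v => fourierIntegrand (b N) (θ N) N (v / ρ N)) v := fun N =>
    (integral_indicator measurableSet_Ioc).symm
  change Tendsto (fun N => ∫ v in Set.Ioc (-(Real.pi * ρ N)) (Real.pi * ρ N),
    fourierIntegrand (b N) (θ N) N (v / ρ N)) atTop _
  simp_rw [hind]
  refine tendsto_integral_filter_of_dominated_convergence
    (fun v => Real.exp (K ^ 2 * M / 2) * stretchedExp (2 * p / (p + 2)) (β / 20) v) ?_ ?_
    ((integrable_stretchedExp (by positivity) (by positivity)).const_mul _) ?_
  · refine Eventually.of_forall fun N => ?_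
    refine Measurable.aestronglyMeasurable (Measurable.indicator ?_ measurableSet_Ioc)
    exact ((continuous_fourierIntegrand _ _ N).comp (continuous_id.div_const _)).measurable
  · filter_upwards [hdom] with N hN
    refine Eventually.of_forall fun v => ?_
    rw [norm_indicator_eq_indicator_norm]
    refine Set.indicator_le' (fun v hv => hN v (abs_le.2 ⟨hv.1.le, hv.2⟩)) (fun v _ => ?_) v
    unfold stretchedExp
    positivity
  · refine Eventually.of_forall fun v => (hpt v).congr' ?_
    filter_upwards [hρlim.eventually_gt_atTop |v|] with N hN
    rw [Set.indicator_of_mem]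
    have h1 : |v| < Real.pi * ρ N := by
      have : 0 ≤ |v| := abs_nonneg v
      nlinarith [Real.pi_gt_three]
    exact ⟨(abs_lt.1 h1).1, (abs_lt.1 h1).2.le⟩

/-! ### Transforms of the Gibbs distribution -/

/-- Fourier inversion in the rescaled frequency variable. -/
lemma setIntegral_exp_eq_fourierIntegrand {b : ℕ → ℝ} (hb : ∀ k, 1 ≤ k → 0 ≤ b k) (N : ℕ)
    (θ : ℕ → ℝ) {ρ : ℝ} (hρ : 0 < ρ) :
    ∫ n in {n : Conf N | total n = N}, Complex.exp (Complex.I *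
        ((∑ k : ↥(Finset.Icc 1 N), θ k * ((n k : ℝ) - b k) : ℝ) : ℂ)) ∂poissonField b N
      = (2 * Real.pi * ρ : ℂ)⁻¹ * ∫ v in Set.Ioc (-(Real.pi * ρ)) (Real.pi * ρ),
        fourierIntegrand b θ N (v / ρ) := by
  set w : ℂ := Complex.exp (-(Complex.I * ∑ k ∈ Finset.Icc 1 N, (θ k : ℂ) * b k)) with hw
  have h1 : ∀ n : Conf N, Complex.exp (Complex.I *
      ((∑ k : ↥(Finset.Icc 1 N), θ k * ((n k : ℝ) - b k) : ℝ) : ℂ))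
      = w * Complex.exp (Complex.I * ∑ k : ↥(Finset.Icc 1 N), (θ k : ℂ) * n k) := by
    intro n
    rw [hw, ← Complex.exp_add, ← Finset.sum_coe_sort (Finset.Icc 1 N) fun k => (θ k : ℂ) * b k]
    congr 1
    push_cast
    simp only [mul_sub, Finset.sum_sub_distrib]
    ring
  have h2 : ∀ s : ℝ, w * (Complex.exp (∑ k ∈ Finset.Icc 1 N,
      (b k : ℂ) * (Complex.exp ((θ k + k * s) * Complex.I) - 1))
      * Complex.exp (-(Complex.I * (N * s)))) = fourierIntegrand b θ N s := by
    intro s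
    rw [hw, fourierIntegrand, ← Complex.exp_add, ← Complex.exp_add]
    congr 1
    push_cast
    simp only [mul_sub, Finset.sum_sub_distrib, Finset.mul_sum]
    have e : ∑ k ∈ Finset.Icc 1 N, Complex.I * ((θ k : ℂ) * b k)
        = ∑ k ∈ Finset.Icc 1 N, (b k : ℂ) * (θ k * Complex.I) :=
      Finset.sum_congr rfl fun k _ => by ring
    rw [e]
    ring
  have hρ' : (ρ : ℂ) ≠ 0 := Complex.ofReal_ne_zero.2 hρ.ne'
  simp_rw [h1]
  rw [integral_const_mul, setIntegral_exp_poissonField hb, mul_left_comm,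
    ← intervalIntegral.integral_const_mul]
  simp_rw [h2]
  rw [← intervalIntegral.integral_of_le (by nlinarith [Real.pi_pos]),
    intervalIntegral.integral_comp_div (fun s => fourierIntegrand b θ N s) hρ.ne',
    neg_div, mul_div_cancel_right₀ _ hρ.ne', Complex.real_smul]
  field_simp

/-- The characteristic function of a centred linear statistic under the Gibbs distribution. -/
lemma integral_exp_gibbsMeasure {a : ℕ → ℝ} (ha : ∀ k, 1 ≤ k → 0 < a k) (δ : ℝ) (N : ℕ)
    (θ : ℕ → ℝ) {ρ : ℝ} (hρ : 0 < ρ) :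
    ∫ η : N.Partition, Complex.exp (Complex.I * ((∑ k ∈ Finset.Icc 1 N,
        θ k * ((mult η k : ℝ) - a k * Real.exp (-δ * k)) : ℝ) : ℂ)) ∂gibbsMeasure a ha N
      = (∫ v in Set.Ioc (-(Real.pi * ρ)) (Real.pi * ρ),
          fourierIntegrand (fun k => a k * Real.exp (-δ * k)) θ N (v / ρ))
        / ∫ v in Set.Ioc (-(Real.pi * ρ)) (Real.pi * ρ),
          fourierIntegrand (fun k => a k * Real.exp (-δ * k)) (fun _ => 0) N (v / ρ) := by
  set b : ℕ → ℝ := fun k => a k * Real.exp (-δ * k) with hbdef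
  have hb : ∀ k, 1 ≤ k → 0 ≤ b k := fun k hk => by
    have := ha k hk
    positivity
  have hπ : (Real.pi : ℂ) ≠ 0 := Complex.ofReal_ne_zero.2 Real.pi_ne_zero
  have hρ' : (ρ : ℂ) ≠ 0 := Complex.ofReal_ne_zero.2 hρ.ne'
  have hc : (2 * Real.pi * ρ : ℂ)⁻¹ ≠ 0 := by simp [hπ, hρ']
  have h0 := setIntegral_exp_eq_fourierIntegrand hb N (fun _ => 0) hρ
  simp only [zero_mul, Finset.sum_const_zero, Complex.ofReal_zero, mul_zero, Complex.exp_zero,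
    integral_const, measureReal_restrict_apply_univ,
    Complex.real_smul, mul_one] at h0
  have h1 := setIntegral_exp_eq_fourierIntegrand hb N θ hρ
  have e : ∀ η : N.Partition, (∑ k ∈ Finset.Icc 1 N, θ k * ((mult η k : ℝ) - b k) : ℝ)
      = ∑ k : ↥(Finset.Icc 1 N), θ k * ((conf η k : ℝ) - b k) := fun η =>
    (Finset.sum_coe_sort (Finset.Icc 1 N) fun k => θ k * ((mult η k : ℝ) - b k)).symm
  have e2 : ∀ η : N.Partition, (∑ k ∈ Finset.Icc 1 N,
      θ k * ((mult η k : ℝ) - a k * Real.exp (-δ * k)) : ℝ)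
      = ∑ k : ↥(Finset.Icc 1 N), θ k * ((conf η k : ℝ) - b k) := e
  simp_rw [e2]
  rw [← integral_map (φ := conf) (μ := gibbsMeasure a ha N)
    (f := fun n : Conf N => Complex.exp (Complex.I *
      ((∑ k : ↥(Finset.Icc 1 N), θ k * ((n k : ℝ) - b k) : ℝ) : ℂ)))
    Measurable.of_discrete.aemeasurable
    (Measurable.of_discrete).aestronglyMeasurable,
    map_conf_gibbsMeasure ha δ, ProbabilityTheory.cond, integral_smul_measure, h1, ENNReal.toReal_inv,
    ← measureReal_def, Complex.real_smul, Complex.ofReal_inv, h0, mul_inv]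
  field_simp

/-- The real exponential moments are ratios of partition functions, expressed through the
probabilities of `∑ k n_k = N` under the original and the tilted Poisson multiplicities. -/
lemma integral_real_exp_gibbsMeasure {a : ℕ → ℝ} (ha : ∀ k, 1 ≤ k → 0 < a k) (δ : ℝ) (N : ℕ)
    (θ : ℕ → ℝ) :
    ∫ η : N.Partition, Real.exp (∑ k ∈ Finset.Icc 1 N,
        θ k * ((mult η k : ℝ) - a k * Real.exp (-δ * k))) ∂gibbsMeasure a ha N
      = Real.exp (∑ k ∈ Finset.Icc 1 N, a k * Real.exp (-δ * k) * (Real.exp (θ k) - 1 - θ k))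
        * ((poissonField (fun k => a k * Real.exp (θ k) * Real.exp (-δ * k)) N).real
            {n | total n = N}
          / (poissonField (fun k => a k * Real.exp (-δ * k)) N).real {n | total n = N}) := by
  have ha' : ∀ k, 1 ≤ k → 0 < a k * Real.exp (θ k) := fun k hk => mul_pos (ha k hk) (Real.exp_pos _)
  have hc := partitionFunction_pos ha N
  have hw : ∀ η : N.Partition, weight (fun k => a k * Real.exp (θ k)) η
      = weight a η * Real.exp (∑ k ∈ Finset.Icc 1 N, θ k * mult η k) := by
    intro η
    unfold weight
    rw [Real.exp_sum, ← Finset.prod_mul_distrib]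
    refine Finset.prod_congr rfl fun k _ => ?_
    rw [mul_pow, ← Real.exp_nat_mul, mul_comm (θ k)]
    ring
  have hsum : ∫ η : N.Partition, Real.exp (∑ k ∈ Finset.Icc 1 N,
        θ k * ((mult η k : ℝ) - a k * Real.exp (-δ * k))) ∂gibbsMeasure a ha N
      = Real.exp (-∑ k ∈ Finset.Icc 1 N, θ k * (a k * Real.exp (-δ * k)))
        * (partitionFunction (fun k => a k * Real.exp (θ k)) N / partitionFunction a N) := by
    rw [gibbsMeasure, PMF.integral_eq_sum, partitionFunction, Finset.sum_div, Finset.mul_sum]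
    refine Finset.sum_congr rfl fun η _ => ?_
    rw [gibbs, PMF.ofFintype_apply,
      ENNReal.toReal_ofReal (div_pos (weight_pos ha η) hc).le, hw, smul_eq_mul]
    have e : ∑ k ∈ Finset.Icc 1 N, θ k * ((mult η k : ℝ) - a k * Real.exp (-δ * k))
        = ∑ k ∈ Finset.Icc 1 N, θ k * mult η k
          + -∑ k ∈ Finset.Icc 1 N, θ k * (a k * Real.exp (-δ * k)) := by
      rw [← sub_eq_add_neg, ← Finset.sum_sub_distrib]
      exact Finset.sum_congr rfl fun k _ => by ring
    rw [e, Real.exp_add]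
    ring
  rw [hsum, poissonField_real_total ha', poissonField_real_total ha, mul_div_mul_comm, ← mul_assoc]
  have e : ∑ k ∈ Finset.Icc 1 N, a k * Real.exp (-δ * k) * (Real.exp (θ k) - 1 - θ k)
      = ∑ k ∈ Finset.Icc 1 N, a k * Real.exp (θ k) * Real.exp (-δ * k)
        - ∑ k ∈ Finset.Icc 1 N, a k * Real.exp (-δ * k)
        - ∑ k ∈ Finset.Icc 1 N, θ k * (a k * Real.exp (-δ * k)) := by
    rw [← Finset.sum_sub_distrib, ← Finset.sum_sub_distrib]
    exact Finset.sum_congr rfl fun k _ => by ring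
  congr 1
  rw [← Real.exp_sub, ← Real.exp_add, Real.exp_eq_exp, e]
  ring

/-- The probability of `∑ k n_k = N` is at most of order `r ^ (-(p + 2) / 2)`. -/
lemma poissonField_real_total_le {p β r : ℝ} (hp : 0 < p) (hβ : 0 < β) (hr : 1 ≤ r) {N : ℕ}
    {b : ℕ → ℝ} (hb : ∀ k, 1 ≤ k → 0 ≤ b k) (h : BlockBound p β r N b) :
    (poissonField b N).real {n | total n = N}
      ≤ (2 * Real.pi * r ^ ((p + 2) / 2))⁻¹ * ∫ v, stretchedExp (2 * p / (p + 2)) (β / 20) v := by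
  have hρ : 0 < r ^ ((p + 2) / 2) := Real.rpow_pos_of_pos (by linarith) _
  set ρ := r ^ ((p + 2) / 2)
  have h0 := setIntegral_exp_eq_fourierIntegrand hb N (fun _ => 0) hρ
  simp only [zero_mul, Finset.sum_const_zero, Complex.ofReal_zero, mul_zero, Complex.exp_zero,
    integral_const, measureReal_restrict_apply_univ,
    Complex.real_smul, mul_one] at h0
  have hint := integrable_stretchedExp (κ := 2 * p / (p + 2)) (β := β / 20) (by positivity)
    (by positivity)
  have h1 : ‖∫ v in Set.Ioc (-(Real.pi * ρ)) (Real.pi * ρ),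
      fourierIntegrand b (fun _ => 0) N (v / ρ)‖
      ≤ ∫ v, stretchedExp (2 * p / (p + 2)) (β / 20) v := by
    calc _ ≤ ∫ v in Set.Ioc (-(Real.pi * ρ)) (Real.pi * ρ),
          stretchedExp (2 * p / (p + 2)) (β / 20) v := by
          refine norm_integral_le_of_norm_le hint.integrableOn ?_
          refine (ae_restrict_iff' measurableSet_Ioc).2 (Eventually.of_forall fun v hv => ?_)
          have := norm_fourierIntegrand_le (θ := fun _ => 0) (M := 0) hp hβ.le hr hb h (by simp)
            (abs_le.2 ⟨hv.1.le, hv.2⟩)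
          simpa using this
      _ ≤ _ := setIntegral_le_integral hint (Eventually.of_forall fun v => (Real.exp_pos _).le)
  have h2 : ‖(((poissonField b N).real {n | total n = N} : ℝ) : ℂ)‖
      = (poissonField b N).real {n | total n = N} := by
    rw [Complex.norm_real, Real.norm_of_nonneg measureReal_nonneg]
  have h3 : ‖(2 * Real.pi * ρ : ℂ)⁻¹‖ = (2 * Real.pi * ρ)⁻¹ := by
    rw [norm_inv]
    norm_cast
    rw [Real.norm_of_nonneg (by positivity)]
  rw [← h2, h0, norm_mul, h3]
  gcongr

/-! ### Asymptotics of the parameters -/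

/-- Parameters `a_k e ^ (-η k)` with `η r_N → 1` have bounded third moments on the scale `r_N`. -/
lemma exists_sum_cube_le {C p : ℝ} (hC : 0 < C) (hp : 0 < p) {a : ℕ → ℝ}
    (ha : ∀ k, 1 ≤ k → 0 < a k) (hasymp : a ~[atTop] fun k : ℕ => C * (k : ℝ) ^ (p - 1))
    {η : ℕ → ℝ} (hη : Tendsto (fun N => η N * scaling C p N) atTop (𝓝 1)) :
    ∃ M : ℝ, ∀ᶠ N in atTop, ∑ k ∈ Finset.Icc 1 N, a k * Real.exp (-η N * k)
      * (1 + k / scaling C p N) ^ 3 ≤ M * scaling C p N ^ p := by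
  have h0 := tendsto_full_sum hC hp ha hasymp one_pos hη 0
  have h3 := tendsto_full_sum hC hp ha hasymp one_pos hη 3
  have h := (h0.add h3).const_mul 4
  set l := 4 * (C * ((1 / 1) ^ (((0 : ℕ) : ℝ) + p) * Real.Gamma (((0 : ℕ) : ℝ) + p))
    + C * ((1 / 1) ^ (((3 : ℕ) : ℝ) + p) * Real.Gamma (((3 : ℕ) : ℝ) + p)))
  refine ⟨l + 1, ?_⟩
  filter_upwards [h.eventually_lt_const (lt_add_one l),
    (tendsto_scaling hC hp).eventually_gt_atTop 0] with N h1 hr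
  rw [← div_le_iff₀ (by positivity)]
  refine le_trans ?_ h1.le
  have e0 : scaling C p N ^ (((0 : ℕ) : ℝ) + p) = scaling C p N ^ p := by simp
  have e3 : scaling C p N ^ (((3 : ℕ) : ℝ) + p) = scaling C p N ^ 3 * scaling C p N ^ p := by
    rw [Real.rpow_add hr, Real.rpow_natCast]
  rw [e0, e3, Finset.sum_div, Finset.sum_div, Finset.sum_div, ← Finset.sum_add_distrib,
    Finset.mul_sum]
  refine Finset.sum_le_sum fun k hk => ?_
  have hak := ha k (Finset.mem_Icc.1 hk).1
  have hx : 0 ≤ (k : ℝ) / scaling C p N := by positivity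
  set x := (k : ℝ) / scaling C p N with hxdef
  have hx3 : (k : ℝ) ^ 3 = x ^ 3 * scaling C p N ^ 3 := by
    rw [hxdef, div_pow]; field_simp
  have hcube : (1 + x) ^ 3 ≤ 4 * (1 + x ^ 3) := by
    nlinarith [mul_nonneg (add_nonneg zero_le_one hx) (sq_nonneg (x - 1))]
  rw [hx3]
  calc a k * Real.exp (-η N * k) * (1 + x) ^ 3 / scaling C p N ^ p
      ≤ a k * Real.exp (-η N * k) * (4 * (1 + x ^ 3)) / scaling C p N ^ p := by gcongr
    _ = _ := by field_simp

/-- Parameters `a_k e ^ (-η k)` with `η r_N → 1` are of full order on a block. -/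
lemma exists_blockBound {C p : ℝ} (hC : 0 < C) (hp : 0 < p) {a : ℕ → ℝ}
    (hasymp : a ~[atTop] fun k : ℕ => C * (k : ℝ) ^ (p - 1))
    {η : ℕ → ℝ} (hη : Tendsto (fun N => η N * scaling C p N) atTop (𝓝 1)) :
    ∃ β > 0, ∀ᶠ N in atTop, BlockBound p β (scaling C p N) N (fun k => a k * Real.exp (-η N * k)) := by
  have hrlim := tendsto_scaling hC hp
  have hceil : Tendsto (fun N => ⌈scaling C p N⌉₊) atTop atTop := tendsto_nat_ceil_atTop.comp hrlim
  have hlow := (tendsto_div_rpow hC hasymp).eventually_const_le (half_lt_self hC)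
  obtain ⟨k₀, hk₀⟩ := eventually_atTop.1 hlow
  -- On the block `r ≤ k ≤ 9 ⌈r⌉ ≤ 18 r`, and eventually `η r ≤ 2`, hence `η k ≤ 36`.
  refine ⟨C / 2 * min 1 (18 ^ (p - 1)) * Real.exp (-36), by positivity, ?_⟩
  filter_upwards [hceil.eventually_ge_atTop k₀, hrlim.eventually_ge_atTop 1,
    hη.eventually_le_const (by norm_num : (1 : ℝ) < 2), eventually_mul_scaling_le hC hp 18]
    with N h1 h2 h3 h4
  set r := scaling C p N
  have hr0 : 0 < r := by linarith
  have hc := Nat.ceil_lt_add_one hr0.le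
  constructor
  · have : (9 * ⌈r⌉₊ : ℝ) ≤ N := by linarith
    exact_mod_cast this
  intro k hk
  obtain ⟨hk1, hk2⟩ := Finset.mem_Ioc.1 hk
  have hk0 : (0 : ℝ) < k := by exact_mod_cast (Nat.zero_le _).trans_lt hk1
  have hrk : r ≤ k := (Nat.le_ceil r).trans (by exact_mod_cast hk1.le)
  have hkr : (k : ℝ) ≤ 18 * r := by
    have : (k : ℝ) ≤ 9 * ⌈r⌉₊ := by exact_mod_cast hk2
    linarith
  have hak : C / 2 * (k : ℝ) ^ (p - 1) ≤ a k := by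
    have := hk₀ k (h1.trans hk1.le)
    rwa [le_div_iff₀ (by positivity)] at this
  have hpow : min 1 (18 ^ (p - 1)) * r ^ (p - 1) ≤ (k : ℝ) ^ (p - 1) := by
    rcases le_total 0 (p - 1) with h | h
    · calc min 1 (18 ^ (p - 1)) * r ^ (p - 1) ≤ 1 * r ^ (p - 1) := by
            gcongr; exact min_le_left _ _
        _ ≤ (k : ℝ) ^ (p - 1) := by rw [one_mul]; exact Real.rpow_le_rpow hr0.le hrk h
    · calc min 1 (18 ^ (p - 1)) * r ^ (p - 1) ≤ 18 ^ (p - 1) * r ^ (p - 1) := by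
            gcongr; exact min_le_right _ _
        _ = (18 * r) ^ (p - 1) := (Real.mul_rpow (by norm_num) hr0.le).symm
        _ ≤ (k : ℝ) ^ (p - 1) := Real.rpow_le_rpow_of_nonpos hk0 hkr h
  have hexp : Real.exp (-36) ≤ Real.exp (-η N * k) := by
    rw [Real.exp_le_exp]
    have e : η N * k = (η N * r) * (k / r) := by field_simp
    have h5 : (k : ℝ) / r ≤ 18 := by rw [div_le_iff₀ hr0]; exact hkr
    have h6 : (η N * r) * (k / r) ≤ 2 * 18 := mul_le_mul h3 h5 (by positivity) (by norm_num)
    linarith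
  calc C / 2 * min 1 (18 ^ (p - 1)) * Real.exp (-36) * r ^ (p - 1)
      = C / 2 * (min 1 (18 ^ (p - 1)) * r ^ (p - 1)) * Real.exp (-36) := by ring
    _ ≤ C / 2 * (k : ℝ) ^ (p - 1) * Real.exp (-η N * k) := by gcongr
    _ ≤ a k * Real.exp (-η N * k) := by gcongr

/-! ### Linear statistics of the scaled counts and masses -/

/-- A linear combination of the scaled counts and the scaled masses. -/
noncomputable def linForm (a : ℕ → ℝ) (C p : ℝ) (u : ℕ → ℝ) (q : ℕ) (δ : ℝ) (c d : ℕ → ℝ) {N : ℕ}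
    (η : N.Partition) : ℝ :=
  ∑ j ∈ Finset.range (q + 1),
    (c j * scaledCount a C p u q δ j η + d j * scaledMass a C p u q δ j η)

/-- The ratio of the normalisation of the counts to `r_N ^ (-p / 2)`; it tends to `1`. -/
noncomputable def countRatio (a : ℕ → ℝ) (C p : ℝ) (u : ℕ → ℝ) (q : ℕ) (δ : ℝ) (N : ℕ) : ℝ :=
  √(fInt C u q 0 (p - 1)) / √(stratSum a C p u q δ N 0 0) * scaling C p N ^ (p / 2)

/-- The ratio of the normalisation of the masses to `r_N ^ (-p / 2 - 1)`; it tends to `1`. -/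
noncomputable def massRatio (a : ℕ → ℝ) (C p : ℝ) (u : ℕ → ℝ) (q : ℕ) (δ : ℝ) (N : ℕ) : ℝ :=
  √(fInt C u q 0 (p + 1)) / √(stratSum a C p u q δ N 0 2)
    * (scaling C p N ^ (p / 2) * scaling C p N)

/-- The coefficient of `n_k` in a linear statistic, multiplied by `r_N ^ (p / 2)`; on each stratum
it is an affine function of `k / r_N`. -/
noncomputable def profile (a : ℕ → ℝ) (C p : ℝ) (u : ℕ → ℝ) (q : ℕ) (δ : ℝ) (c d : ℕ → ℝ)
    (N k : ℕ) : ℝ :=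
  ∑ j ∈ Finset.range (q + 1), if k ∈ stratum C p u q N j then
    countRatio a C p u q δ N * c j + massRatio a C p u q δ N * d j * (k / scaling C p N) else 0

lemma profile_eq {C p : ℝ} (hC : 0 < C) (hp : 0 < p) (a : ℕ → ℝ) {u : ℕ → ℝ} {q : ℕ}
    (hu : ∀ j < q, u j < u (j + 1)) (δ : ℝ) (c d : ℕ → ℝ) {N j k : ℕ} (hj : j ≤ q)
    (hk : k ∈ stratum C p u q N j) :
    profile a C p u q δ c d N k = countRatio a C p u q δ N * c j
      + massRatio a C p u q δ N * d j * (k / scaling C p N) := by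
  unfold profile
  rw [Finset.sum_eq_single j, if_pos hk]
  · intro i hi hij
    rw [if_neg]
    exact fun hki => Finset.disjoint_left.1 (disjoint_stratum hC hp hu N
      (by rw [Finset.mem_range] at hi; omega) hj hij) hki hk
  · intro h
    exact absurd (Finset.mem_range.2 (by omega)) h

lemma linForm_eq {C p : ℝ} (hC : 0 < C) (hp : 0 < p) (a : ℕ → ℝ) {u : ℕ → ℝ} {q : ℕ}
    (hu0 : u 0 = 0) (hu : ∀ j < q, u j < u (j + 1)) (δ : ℝ) (c d : ℕ → ℝ) {N : ℕ}
    (hN : 0 < scaling C p N) (η : N.Partition) :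
    linForm a C p u q δ c d η = ∑ k ∈ Finset.Icc 1 N,
      profile a C p u q δ c d N k / scaling C p N ^ (p / 2)
        * ((mult η k : ℝ) - a k * Real.exp (-δ * k)) := by
  have h1 : scaling C p N ^ (p / 2) ≠ 0 := by positivity
  rw [← sum_stratum hC hp hu0 hu, linForm]
  refine Finset.sum_congr rfl fun j hj => ?_
  rw [Finset.mem_range] at hj
  have e0 : (count C p u q j η : ℝ) - stratSum a C p u q δ N j 0
      = ∑ k ∈ stratum C p u q N j, ((mult η k : ℝ) - a k * Real.exp (-δ * k)) := by
    simp [count, stratSum]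
  have e1 : (mass C p u q j η : ℝ) - stratSum a C p u q δ N j 1
      = ∑ k ∈ stratum C p u q N j, k * ((mult η k : ℝ) - a k * Real.exp (-δ * k)) := by
    simp only [mass, stratSum, pow_one, mul_sub, Finset.sum_sub_distrib]
    push_cast
    congr 1
    exact Finset.sum_congr rfl fun k _ => by ring
  rw [scaledCount, scaledMass, e0, e1, Finset.sum_div, Finset.sum_div, Finset.mul_sum,
    Finset.mul_sum, Finset.mul_sum, Finset.mul_sum, ← Finset.sum_add_distrib]
  refine Finset.sum_congr rfl fun k hk => ?_
  rw [profile_eq hC hp a hu δ c d (by omega) hk, countRatio, massRatio]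
  field_simp

section Asymptotics

variable {C p : ℝ} {a : ℕ → ℝ} {q : ℕ} {u : ℕ → ℝ} {δ : ℕ → ℝ}

lemma tendsto_stratSum_zero (hC : 0 < C) (hp : 0 < p) (ha : ∀ k, 1 ≤ k → 0 < a k)
    (hasymp : a ~[atTop] fun k : ℕ => C * (k : ℝ) ^ (p - 1)) (hu0 : u 0 = 0)
    (hu : ∀ j < q, u j < u (j + 1)) (hδ : Tendsto (fun N => δ N * scaling C p N) atTop (𝓝 1))
    {j : ℕ} (hj : j ≤ q) :
    Tendsto (fun N => stratSum a C p u q (δ N) N j 0 / scaling C p N ^ p) atTop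
      (𝓝 (fInt C u q j (p - 1))) := by
  simpa using tendsto_stratSum hC hp ha hasymp hu0 hu hδ hj 0

lemma tendsto_stratSum_one (hC : 0 < C) (hp : 0 < p) (ha : ∀ k, 1 ≤ k → 0 < a k)
    (hasymp : a ~[atTop] fun k : ℕ => C * (k : ℝ) ^ (p - 1)) (hu0 : u 0 = 0)
    (hu : ∀ j < q, u j < u (j + 1)) (hδ : Tendsto (fun N => δ N * scaling C p N) atTop (𝓝 1))
    {j : ℕ} (hj : j ≤ q) :
    Tendsto (fun N => stratSum a C p u q (δ N) N j 1 / (scaling C p N ^ p * scaling C p N)) atTop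
      (𝓝 (fInt C u q j p)) := by
  have h := tendsto_stratSum hC hp ha hasymp hu0 hu hδ hj 1
  have e : ((1 : ℕ) : ℝ) + p - 1 = p := by push_cast; ring
  rw [e] at h
  refine h.congr' ?_
  filter_upwards [(tendsto_scaling hC hp).eventually_gt_atTop 0] with N hr
  rw [Real.rpow_add hr, Nat.cast_one, Real.rpow_one, mul_comm]

lemma tendsto_stratSum_two (hC : 0 < C) (hp : 0 < p) (ha : ∀ k, 1 ≤ k → 0 < a k)
    (hasymp : a ~[atTop] fun k : ℕ => C * (k : ℝ) ^ (p - 1)) (hu0 : u 0 = 0)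
    (hu : ∀ j < q, u j < u (j + 1)) (hδ : Tendsto (fun N => δ N * scaling C p N) atTop (𝓝 1))
    {j : ℕ} (hj : j ≤ q) :
    Tendsto (fun N => stratSum a C p u q (δ N) N j 2 / (scaling C p N ^ p * scaling C p N ^ 2)) atTop
      (𝓝 (fInt C u q j (p + 1))) := by
  have h := tendsto_stratSum hC hp ha hasymp hu0 hu hδ hj 2
  have e : ((2 : ℕ) : ℝ) + p - 1 = p + 1 := by push_cast; ring
  rw [e] at h
  refine h.congr' ?_
  filter_upwards [(tendsto_scaling hC hp).eventually_gt_atTop 0] with N hr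
  rw [Real.rpow_add hr, Real.rpow_natCast, mul_comm]

lemma rpow_half_sq {x : ℝ} (hx : 0 < x) (s : ℝ) : (x ^ (s / 2)) ^ 2 = x ^ s := by
  rw [← Real.rpow_natCast, ← Real.rpow_mul hx.le]
  congr 1
  push_cast
  ring

lemma tendsto_countRatio (hC : 0 < C) (hp : 0 < p) (ha : ∀ k, 1 ≤ k → 0 < a k)
    (hasymp : a ~[atTop] fun k : ℕ => C * (k : ℝ) ^ (p - 1)) (hu0 : u 0 = 0)
    (hu : ∀ j < q, u j < u (j + 1)) (hδ : Tendsto (fun N => δ N * scaling C p N) atTop (𝓝 1)) :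
    Tendsto (fun N => countRatio a C p u q (δ N) N) atTop (𝓝 1) := by
  have hf : 0 < fInt C u q 0 (p - 1) := fInt_pos hC hu0 hu (Nat.zero_le q) (by linarith)
  have h := (tendsto_stratSum_zero hC hp ha hasymp hu0 hu hδ (Nat.zero_le q)).sqrt
  have h1 := tendsto_const_nhds (x := √(fInt C u q 0 (p - 1))) |>.div h (Real.sqrt_pos.2 hf).ne'
  rw [div_self (Real.sqrt_pos.2 hf).ne'] at h1
  refine h1.congr' ?_
  filter_upwards [(tendsto_scaling hC hp).eventually_gt_atTop 0] with N hr
  rw [countRatio, Pi.div_apply, Real.sqrt_div (stratSum_nonneg ha C p u q (δ N) N 0 0),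
    ← rpow_half_sq hr p, Real.sqrt_sq (by positivity)]
  field_simp

lemma tendsto_massRatio (hC : 0 < C) (hp : 0 < p) (ha : ∀ k, 1 ≤ k → 0 < a k)
    (hasymp : a ~[atTop] fun k : ℕ => C * (k : ℝ) ^ (p - 1)) (hu0 : u 0 = 0)
    (hu : ∀ j < q, u j < u (j + 1)) (hδ : Tendsto (fun N => δ N * scaling C p N) atTop (𝓝 1)) :
    Tendsto (fun N => massRatio a C p u q (δ N) N) atTop (𝓝 1) := by
  have hf : 0 < fInt C u q 0 (p + 1) := fInt_pos hC hu0 hu (Nat.zero_le q) (by linarith)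
  have h := (tendsto_stratSum_two hC hp ha hasymp hu0 hu hδ (Nat.zero_le q)).sqrt
  have h1 := tendsto_const_nhds (x := √(fInt C u q 0 (p + 1))) |>.div h (Real.sqrt_pos.2 hf).ne'
  rw [div_self (Real.sqrt_pos.2 hf).ne'] at h1
  refine h1.congr' ?_
  filter_upwards [(tendsto_scaling hC hp).eventually_gt_atTop 0] with N hr
  rw [massRatio, Pi.div_apply, Real.sqrt_div (stratSum_nonneg ha C p u q (δ N) N 0 2),
    ← rpow_half_sq hr p, ← mul_pow, Real.sqrt_sq (by positivity)]
  field_simp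

/-- The profiles have at most linear growth, uniformly in `N`. -/
lemma exists_abs_profile_le (hC : 0 < C) (hp : 0 < p) (ha : ∀ k, 1 ≤ k → 0 < a k)
    (hasymp : a ~[atTop] fun k : ℕ => C * (k : ℝ) ^ (p - 1)) (hu0 : u 0 = 0)
    (hu : ∀ j < q, u j < u (j + 1)) (hδ : Tendsto (fun N => δ N * scaling C p N) atTop (𝓝 1))
    (c d : ℕ → ℝ) :
    ∃ K : ℝ, 0 ≤ K ∧ ∀ᶠ N in atTop, ∀ k, |profile a C p u q (δ N) c d N k|
      ≤ K * (1 + k / scaling C p N) := by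
  refine ⟨∑ j ∈ Finset.range (q + 1), (2 * |c j| + 2 * |d j|),
    Finset.sum_nonneg fun j _ => by positivity, ?_⟩
  have h1 := (tendsto_countRatio hC hp ha hasymp hu0 hu hδ).abs
  have h2 := (tendsto_massRatio hC hp ha hasymp hu0 hu hδ).abs
  rw [abs_one] at h1 h2
  filter_upwards [h1.eventually_le_const one_lt_two, h2.eventually_le_const one_lt_two,
    (tendsto_scaling hC hp).eventually_gt_atTop 0] with N h3 h4 hr k
  have hx : 0 ≤ (k : ℝ) / scaling C p N := by positivity
  unfold profile
  refine (Finset.abs_sum_le_sum_abs _ _).trans ?_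
  rw [Finset.sum_mul]
  refine Finset.sum_le_sum fun j _ => ?_
  split_ifs
  · refine (abs_add_le _ _).trans ?_
    rw [abs_mul, abs_mul, abs_mul, abs_of_nonneg hx]
    have e1 : |countRatio a C p u q (δ N) N| * |c j| ≤ 2 * |c j| := by gcongr
    have e2 : |massRatio a C p u q (δ N) N| * |d j| * (k / scaling C p N)
        ≤ 2 * |d j| * (k / scaling C p N) := by gcongr
    nlinarith [mul_nonneg (abs_nonneg (c j)) hx, abs_nonneg (d j)]
  · rw [abs_zero]
    positivity

/-- The limiting variance of a linear statistic of independent Poisson multiplicities. -/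
noncomputable def quadForm (C p : ℝ) (u : ℕ → ℝ) (q : ℕ) (c d : ℕ → ℝ) : ℝ :=
  ∑ j ∈ Finset.range (q + 1), (c j ^ 2 * fInt C u q j (p - 1) + 2 * c j * d j * fInt C u q j p
    + d j ^ 2 * fInt C u q j (p + 1))

/-- The limiting covariance of a linear statistic of independent Poisson multiplicities with
their total size. -/
noncomputable def crossForm (C p : ℝ) (u : ℕ → ℝ) (q : ℕ) (c d : ℕ → ℝ) : ℝ :=
  ∑ j ∈ Finset.range (q + 1), (c j * fInt C u q j p + d j * fInt C u q j (p + 1))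

lemma tendsto_quadForm (hC : 0 < C) (hp : 0 < p) (ha : ∀ k, 1 ≤ k → 0 < a k)
    (hasymp : a ~[atTop] fun k : ℕ => C * (k : ℝ) ^ (p - 1)) (hu0 : u 0 = 0)
    (hu : ∀ j < q, u j < u (j + 1)) (hδ : Tendsto (fun N => δ N * scaling C p N) atTop (𝓝 1))
    (c d : ℕ → ℝ) (v : ℝ) :
    Tendsto (fun N => (∑ k ∈ Finset.Icc 1 N, a k * Real.exp (-δ N * k)
        * (profile a C p u q (δ N) c d N k + v * (k / scaling C p N)) ^ 2) / scaling C p N ^ p)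
      atTop (𝓝 (quadForm C p u q c fun j => d j + v)) := by
  have hγ := tendsto_countRatio hC hp ha hasymp hu0 hu hδ
  have hκ := tendsto_massRatio hC hp ha hasymp hu0 hu hδ
  set γ : ℕ → ℝ := fun N => countRatio a C p u q (δ N) N with hγdef
  set κ : ℕ → ℝ := fun N => massRatio a C p u q (δ N) N with hκdef
  have h : Tendsto (fun N => ∑ j ∈ Finset.range (q + 1),
      ((γ N * c j) ^ 2 * (stratSum a C p u q (δ N) N j 0 / scaling C p N ^ p)
        + 2 * (γ N * c j) * (κ N * d j + v)
          * (stratSum a C p u q (δ N) N j 1 / (scaling C p N ^ p * scaling C p N))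
        + (κ N * d j + v) ^ 2
          * (stratSum a C p u q (δ N) N j 2 / (scaling C p N ^ p * scaling C p N ^ 2)))) atTop
      (𝓝 (∑ j ∈ Finset.range (q + 1), ((1 * c j) ^ 2 * fInt C u q j (p - 1)
        + 2 * (1 * c j) * (1 * d j + v) * fInt C u q j p
        + (1 * d j + v) ^ 2 * fInt C u q j (p + 1)))) := by
    refine tendsto_finsetSum _ fun j hj => ?_
    have hj' : j ≤ q := by rw [Finset.mem_range] at hj; omega
    have h0 := tendsto_stratSum_zero hC hp ha hasymp hu0 hu hδ hj'
    have h1 := tendsto_stratSum_one hC hp ha hasymp hu0 hu hδ hj'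
    have h2 := tendsto_stratSum_two hC hp ha hasymp hu0 hu hδ hj'
    have hc := hγ.mul_const (c j)
    have hd := (hκ.mul_const (d j)).add_const v
    exact (((hc.pow 2).mul h0).add (((hc.const_mul 2).mul hd).mul h1)).add ((hd.pow 2).mul h2)
  simp only [one_mul] at h
  refine h.congr' ?_
  filter_upwards [(tendsto_scaling hC hp).eventually_gt_atTop 0] with N hr
  rw [← sum_stratum hC hp hu0 hu, Finset.sum_div]
  refine Finset.sum_congr rfl fun j hj => ?_
  have hj' : j ≤ q := by rw [Finset.mem_range] at hj; omega
  unfold stratSum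
  rw [Finset.sum_div, Finset.sum_div, Finset.sum_div, Finset.sum_div, Finset.mul_sum,
    Finset.mul_sum, Finset.mul_sum, ← Finset.sum_add_distrib, ← Finset.sum_add_distrib]
  refine Finset.sum_congr rfl fun k hk => ?_
  rw [profile_eq hC hp a hu (δ N) c d hj' hk]
  simp only [hγdef, hκdef]
  field_simp
  ring

/-- The variances of the masses of the strata add up to the variance of the total size. -/
lemma sum_fInt (hC : 0 < C) (hp : 0 < p) (hu0 : u 0 = 0) (hu : ∀ j < q, u j < u (j + 1)) :
    ∑ j ∈ Finset.range (q + 1), fInt C u q j (p + 1) = C * Real.Gamma (p + 2) := by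
  -- Both sides are limits of the same sums, for the parameters `a_k = C k ^ (p - 1)`.
  set a : ℕ → ℝ := fun k => C * (k : ℝ) ^ (p - 1) with hadef
  have ha : ∀ k, 1 ≤ k → 0 < a k := fun k hk => by
    have : (0 : ℝ) < k := by exact_mod_cast hk
    positivity
  have hasymp : a ~[atTop] fun k : ℕ => C * (k : ℝ) ^ (p - 1) := IsEquivalent.refl
  have hδ : Tendsto (fun N => (scaling C p N)⁻¹ * scaling C p N) atTop (𝓝 1) := by
    refine tendsto_const_nhds.congr' ?_
    filter_upwards [(tendsto_scaling hC hp).eventually_gt_atTop 0] with N hr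
    rw [inv_mul_cancel₀ hr.ne']
  have h1 : Tendsto (fun N => ∑ j ∈ Finset.range (q + 1),
      stratSum a C p u q (scaling C p N)⁻¹ N j 2 / (scaling C p N ^ p * scaling C p N ^ 2)) atTop
      (𝓝 (∑ j ∈ Finset.range (q + 1), fInt C u q j (p + 1))) := by
    refine tendsto_finsetSum _ fun j hj => ?_
    have hj' : j ≤ q := by rw [Finset.mem_range] at hj; omega
    exact tendsto_stratSum_two hC hp ha hasymp hu0 hu hδ hj'
  have h2 := tendsto_full_sum hC hp ha hasymp one_pos hδ 2
  have e : ((2 : ℕ) : ℝ) + p = p + 2 := by push_cast; ring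
  rw [e, div_one, Real.one_rpow, one_mul] at h2
  refine tendsto_nhds_unique h1 (h2.congr' ?_)
  filter_upwards [(tendsto_scaling hC hp).eventually_gt_atTop 0] with N hr
  rw [← Finset.sum_div, ← sum_stratum hC hp hu0 hu, Real.rpow_add hr, Real.rpow_two]
  rfl

/-- The limiting variance of a linear statistic plus `v` times the total size. -/
lemma quadForm_add (hC : 0 < C) (hp : 0 < p) (hu0 : u 0 = 0) (hu : ∀ j < q, u j < u (j + 1))
    (c d : ℕ → ℝ) (v : ℝ) :
    quadForm C p u q c (fun j => d j + v) = quadForm C p u q c d + 2 * crossForm C p u q c d * v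
      + C * Real.Gamma (p + 2) * v ^ 2 := by
  rw [← sum_fInt hC hp hu0 hu, quadForm, quadForm, crossForm, Finset.mul_sum, Finset.sum_mul,
    Finset.sum_mul, ← Finset.sum_add_distrib, ← Finset.sum_add_distrib]
  exact Finset.sum_congr rfl fun j _ => by ring

lemma integral_exp_neg_quadratic (A B : ℝ) {σ : ℝ} (hσ : 0 < σ) :
    ∫ v : ℝ, Real.exp (-((A + 2 * B * v + σ * v ^ 2) / 2))
      = Real.exp (-((A - B ^ 2 / σ) / 2)) * √(Real.pi / (σ / 2)) := by
  have h : ∀ v : ℝ, Real.exp (-((A + 2 * B * v + σ * v ^ 2) / 2))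
      = Real.exp (-((A - B ^ 2 / σ) / 2)) * Real.exp (-(σ / 2) * (v + B / σ) ^ 2) := by
    intro v
    rw [← Real.exp_add]
    congr 1
    field_simp
    ring
  simp_rw [h]
  rw [integral_const_mul, integral_add_right_eq_self (fun v : ℝ => Real.exp (-(σ / 2) * v ^ 2)),
    integral_gaussian]

/-- The rescaled Fourier integrals of a linear statistic converge. -/
lemma tendsto_integral_profile (hC : 0 < C) (hp : 0 < p) (ha : ∀ k, 1 ≤ k → 0 < a k)
    (hasymp : a ~[atTop] fun k : ℕ => C * (k : ℝ) ^ (p - 1)) (hu0 : u 0 = 0)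
    (hu : ∀ j < q, u j < u (j + 1)) (hδ : Tendsto (fun N => δ N * scaling C p N) atTop (𝓝 1))
    (hmean : Tendsto (fun N : ℕ => (N - ∑ k ∈ Finset.Icc 1 N, (k : ℝ) * a k * Real.exp (-δ N * k))
      / scaling C p N ^ ((p + 2) / 2)) atTop (𝓝 0)) (c d : ℕ → ℝ) :
    Tendsto (fun N => ∫ v in Set.Ioc (-(Real.pi * scaling C p N ^ ((p + 2) / 2)))
      (Real.pi * scaling C p N ^ ((p + 2) / 2)),
        fourierIntegrand (fun k => a k * Real.exp (-δ N * k))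
          (fun k => profile a C p u q (δ N) c d N k / scaling C p N ^ (p / 2)) N
          (v / scaling C p N ^ ((p + 2) / 2))) atTop
      (𝓝 ((Real.exp (-((quadForm C p u q c d
        - crossForm C p u q c d ^ 2 / (C * Real.Gamma (p + 2))) / 2))
        * √(Real.pi / (C * Real.Gamma (p + 2) / 2)) : ℝ) : ℂ)) := by
  have hΓ := Real.Gamma_pos_of_pos (by linarith : 0 < p + 2)
  obtain ⟨K, hK, hprof⟩ := exists_abs_profile_le hC hp ha hasymp hu0 hu hδ c d
  obtain ⟨M, hM⟩ := exists_sum_cube_le hC hp ha hasymp hδ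
  obtain ⟨β, hβ, hblock⟩ := exists_blockBound hC hp hasymp hδ
  have h := tendsto_integral_fourierIntegrand hp hβ hK (tendsto_scaling hC hp)
    (b := fun N k => a k * Real.exp (-δ N * k)) (ψ := fun N k => profile a C p u q (δ N) c d N k) (M := M)
    (fun N k hk => by have := ha k hk; positivity)
    (hprof.mono fun N hN k _ => hN k) hM hblock
    (by simpa only [mul_assoc] using hmean)
    (Q := fun v => quadForm C p u q c fun j => d j + v)
    (fun v => tendsto_quadForm hC hp ha hasymp hu0 hu hδ c d v)
  simp_rw [quadForm_add hC hp hu0 hu c d] at h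
  rw [integral_complex_ofReal, integral_exp_neg_quadratic _ _ (by positivity)] at h
  exact h

/-- The same limit with vanishing coefficients. -/
lemma tendsto_integral_zero (hC : 0 < C) (hp : 0 < p) (ha : ∀ k, 1 ≤ k → 0 < a k)
    (hasymp : a ~[atTop] fun k : ℕ => C * (k : ℝ) ^ (p - 1)) (hu0 : u 0 = 0)
    (hu : ∀ j < q, u j < u (j + 1)) (hδ : Tendsto (fun N => δ N * scaling C p N) atTop (𝓝 1))
    (hmean : Tendsto (fun N : ℕ => (N - ∑ k ∈ Finset.Icc 1 N, (k : ℝ) * a k * Real.exp (-δ N * k))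
      / scaling C p N ^ ((p + 2) / 2)) atTop (𝓝 0)) :
    Tendsto (fun N => ∫ v in Set.Ioc (-(Real.pi * scaling C p N ^ ((p + 2) / 2)))
      (Real.pi * scaling C p N ^ ((p + 2) / 2)),
        fourierIntegrand (fun k => a k * Real.exp (-δ N * k)) (fun _ => 0) N
          (v / scaling C p N ^ ((p + 2) / 2))) atTop
      (𝓝 ((√(Real.pi / (C * Real.Gamma (p + 2) / 2)) : ℝ) : ℂ)) := by
  have h := tendsto_integral_profile hC hp ha hasymp hu0 hu hδ hmean (fun _ => 0) fun _ => 0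
  simpa [profile, quadForm, crossForm] using h

/-- The characteristic functions of linear statistics converge to those of centred Gaussians. -/
theorem tendsto_integral_exp_linForm (hC : 0 < C) (hp : 0 < p) (ha : ∀ k, 1 ≤ k → 0 < a k)
    (hasymp : a ~[atTop] fun k : ℕ => C * (k : ℝ) ^ (p - 1)) (hu0 : u 0 = 0)
    (hu : ∀ j < q, u j < u (j + 1)) (hδ : Tendsto (fun N => δ N * scaling C p N) atTop (𝓝 1))
    (hmean : Tendsto (fun N : ℕ => (N - ∑ k ∈ Finset.Icc 1 N, (k : ℝ) * a k * Real.exp (-δ N * k))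
      / scaling C p N ^ ((p + 2) / 2)) atTop (𝓝 0)) (c d : ℕ → ℝ) :
    Tendsto (fun N => ∫ η : N.Partition, Complex.exp (Complex.I * (linForm a C p u q (δ N) c d η : ℝ))
      ∂gibbsMeasure a ha N) atTop
      (𝓝 ((Real.exp (-((quadForm C p u q c d
        - crossForm C p u q c d ^ 2 / (C * Real.Gamma (p + 2))) / 2)) : ℝ) : ℂ)) := by
  have hΓ := Real.Gamma_pos_of_pos (by linarith : 0 < p + 2)
  have hg : 0 < √(Real.pi / (C * Real.Gamma (p + 2) / 2)) := by
    have := Real.pi_pos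
    positivity
  have hg' := Complex.ofReal_ne_zero.2 hg.ne'
  have h := (tendsto_integral_profile hC hp ha hasymp hu0 hu hδ hmean c d).div
    (tendsto_integral_zero hC hp ha hasymp hu0 hu hδ hmean) hg'
  rw [Complex.ofReal_mul, mul_div_cancel_right₀ _ hg'] at h
  refine h.congr' ?_
  filter_upwards [(tendsto_scaling hC hp).eventually_gt_atTop 0] with N hr
  simp_rw [linForm_eq hC hp a hu0 hu (δ N) c d hr]
  exact (integral_exp_gibbsMeasure ha (δ N) N _ (by positivity)).symm

lemma exp_sub_one_sub_le (x : ℝ) : Real.exp x - 1 - x ≤ x ^ 2 * Real.exp |x| := by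
  have h := Complex.norm_exp_sub_sum_le_norm_mul_exp (x : ℂ) 2
  have e : Complex.exp (x : ℂ) - ∑ m ∈ Finset.range 2, (x : ℂ) ^ m / m.factorial
      = ((Real.exp x - 1 - x : ℝ) : ℂ) := by
    simp [Finset.sum_range_succ]
    ring
  rw [e, Complex.norm_real, Complex.norm_real, Real.norm_eq_abs, Real.norm_eq_abs, sq_abs] at h
  exact (le_abs_self _).trans h

/-- Linear statistics have bounded exponential moments. -/
theorem exists_integral_real_exp_linForm_le (hC : 0 < C) (hp : 0 < p) (ha : ∀ k, 1 ≤ k → 0 < a k)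
    (hasymp : a ~[atTop] fun k : ℕ => C * (k : ℝ) ^ (p - 1)) (hu0 : u 0 = 0)
    (hu : ∀ j < q, u j < u (j + 1)) (hδ : Tendsto (fun N => δ N * scaling C p N) atTop (𝓝 1))
    (hmean : Tendsto (fun N : ℕ => (N - ∑ k ∈ Finset.Icc 1 N, (k : ℝ) * a k * Real.exp (-δ N * k))
      / scaling C p N ^ ((p + 2) / 2)) atTop (𝓝 0)) (c d : ℕ → ℝ) :
    ∃ B : ℝ, ∀ᶠ N in atTop, ∫ η : N.Partition, Real.exp (linForm a C p u q (δ N) c d η)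
      ∂gibbsMeasure a ha N ≤ B := by
  have hΓ := Real.Gamma_pos_of_pos (by linarith : 0 < p + 2)
  have hrlim := tendsto_scaling hC hp
  obtain ⟨K, hK, hprof⟩ := exists_abs_profile_le hC hp ha hasymp hu0 hu hδ c d
  obtain ⟨β, hβ, hblock⟩ := exists_blockBound hC hp hasymp hδ
  -- The growth of the tilt is absorbed by a slight decrease of `δ`.
  set δ' : ℕ → ℝ := fun N => δ N - K / scaling C p N ^ (p / 2) / scaling C p N with hδ'def
  have hδ' : Tendsto (fun N => δ' N * scaling C p N) atTop (𝓝 1) := by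
    have h1 : Tendsto (fun N => K * (scaling C p N ^ (p / 2))⁻¹) atTop (𝓝 0) := by
      have := (((tendsto_rpow_atTop (half_pos hp)).comp hrlim).inv_tendsto_atTop).const_mul K
      rw [mul_zero] at this
      exact this
    have h2 := hδ.sub h1
    rw [sub_zero] at h2
    refine h2.congr' ?_
    filter_upwards [hrlim.eventually_gt_atTop 0] with N hr
    simp only [hδ'def]
    field_simp
  obtain ⟨M, hM⟩ := exists_sum_cube_le hC hp ha hasymp hδ'
  set g := √(Real.pi / (C * Real.Gamma (p + 2) / 2)) with hgdef
  have hg : 0 < g := by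
    have := Real.pi_pos
    positivity
  have hden := (tendsto_integral_zero hC hp ha hasymp hu0 hu hδ hmean).norm
  rw [Complex.norm_real, Real.norm_of_nonneg hg.le] at hden
  -- On the block `k / r ≤ 18`, so that `|θ_k| ≤ K (1 + k / r) ≤ 19 K`.
  set β' := β * Real.exp (-(K * 19)) with hβ'
  have hβ'0 : 0 < β' := by positivity
  set D := ∫ v, stretchedExp (2 * p / (p + 2)) (β' / 20) v with hD
  have hD0 : 0 ≤ D := integral_nonneg fun v => (Real.exp_pos _).le
  refine ⟨Real.exp (K ^ 2 * Real.exp K * M) * (D / (g / 2)), ?_⟩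
  filter_upwards [hprof, hblock, hM, hrlim.eventually_ge_atTop 1,
    hden.eventually_const_le (half_lt_self hg)] with N h1 h2 h3 hr h5
  have hr0 : 0 < scaling C p N := by linarith
  set r := scaling C p N with hrdef
  have hrp : 1 ≤ r ^ (p / 2) := Real.one_le_rpow hr (by positivity)
  set θ : ℕ → ℝ := fun k => profile a C p u q (δ N) c d N k / r ^ (p / 2) with hθ
  set b : ℕ → ℝ := fun k => a k * Real.exp (-δ N * k) with hb
  have hb0 : ∀ k, 1 ≤ k → 0 ≤ b k := fun k hk => by have := ha k hk; positivity
  simp_rw [linForm_eq hC hp a hu0 hu (δ N) c d hr0]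
  rw [integral_real_exp_gibbsMeasure ha (δ N) N θ]
  have hθle : ∀ k : ℕ, |θ k| ≤ K / r ^ (p / 2) * (1 + k / r) := by
    intro k
    simp only [hθ]
    rw [abs_div, abs_of_pos (by positivity : 0 < r ^ (p / 2)), div_mul_eq_mul_div]
    gcongr
    exact h1 k
  have hmain : ∑ k ∈ Finset.Icc 1 N, b k * (Real.exp (θ k) - 1 - θ k) ≤ K ^ 2 * Real.exp K * M := by
    calc ∑ k ∈ Finset.Icc 1 N, b k * (Real.exp (θ k) - 1 - θ k)
        ≤ ∑ k ∈ Finset.Icc 1 N, K ^ 2 * Real.exp K / r ^ p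
            * (a k * Real.exp (-δ' N * k) * (1 + k / r) ^ 3) := by
          refine Finset.sum_le_sum fun k hk => ?_
          have hk1 := (Finset.mem_Icc.1 hk).1
          have hak := ha k hk1
          have hx : 0 ≤ (k : ℝ) / r := by positivity
          have e1 : θ k ^ 2 ≤ K ^ 2 * (1 + k / r) ^ 3 / r ^ p := by
            calc θ k ^ 2 = |θ k| ^ 2 := (sq_abs _).symm
              _ ≤ (K / r ^ (p / 2) * (1 + k / r)) ^ 2 := by gcongr; exact hθle k
              _ = K ^ 2 * (1 + k / r) ^ 2 / r ^ p := by
                  rw [mul_pow, div_pow, rpow_half_sq hr0]; ring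
              _ ≤ K ^ 2 * (1 + k / r) ^ 3 / r ^ p := by
                  gcongr
                  · linarith
                  · norm_num
          have e2 : Real.exp (-δ N * k) * Real.exp |θ k| ≤ Real.exp K * Real.exp (-δ' N * k) := by
            rw [← Real.exp_add, ← Real.exp_add, Real.exp_le_exp]
            have e3 : K / r ^ (p / 2) ≤ K := div_le_self hK hrp
            have e4 : K / r ^ (p / 2) / r * k = K / r ^ (p / 2) * (k / r) := by ring
            have e5 := hθle k
            simp only [hδ'def]
            nlinarith
          calc b k * (Real.exp (θ k) - 1 - θ k) ≤ b k * (θ k ^ 2 * Real.exp |θ k|) :=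
                mul_le_mul_of_nonneg_left (exp_sub_one_sub_le _) (hb0 k hk1)
            _ = a k * θ k ^ 2 * (Real.exp (-δ N * k) * Real.exp |θ k|) := by simp only [hb]; ring
            _ ≤ a k * (K ^ 2 * (1 + k / r) ^ 3 / r ^ p)
                * (Real.exp K * Real.exp (-δ' N * k)) := by gcongr
            _ = _ := by ring
      _ ≤ K ^ 2 * Real.exp K / r ^ p * (M * r ^ p) := by
          rw [← Finset.mul_sum]
          gcongr
      _ = K ^ 2 * Real.exp K * M := by
          have : r ^ p ≠ 0 := by positivity
          field_simp
  have hblock' : BlockBound p β' r N fun k => a k * Real.exp (θ k) * Real.exp (-δ N * k) := by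
    refine ⟨h2.1, fun k hk => ?_⟩
    have hk2 := (Finset.mem_Ioc.1 hk).2
    have hbk := h2.2 k hk
    have hkr : (k : ℝ) / r ≤ 18 := by
      have h6 : (k : ℝ) ≤ 9 * ⌈r⌉₊ := by exact_mod_cast hk2
      have h7 := Nat.ceil_lt_add_one hr0.le
      rw [div_le_iff₀ hr0]
      linarith
    have hθk : -(K * 19) ≤ θ k := by
      have h8 : |θ k| ≤ K * 19 := by
        refine (hθle k).trans ?_
        have : K / r ^ (p / 2) ≤ K := div_le_self hK hrp
        have hx : 0 ≤ (k : ℝ) / r := by positivity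
        exact mul_le_mul this (by linarith) (by linarith) hK
      linarith [neg_abs_le (θ k)]
    have hb1 : 0 ≤ b k := le_trans (by positivity) hbk
    calc β' * r ^ (p - 1) = β * r ^ (p - 1) * Real.exp (-(K * 19)) := by rw [hβ']; ring
      _ ≤ b k * Real.exp (θ k) := by gcongr
      _ = a k * Real.exp (θ k) * Real.exp (-δ N * k) := by simp only [hb]; ring
  have hnum := poissonField_real_total_le hp hβ'0 hr
    (fun k hk => by have := ha k hk; positivity) hblock'
  have hρ : 0 < r ^ ((p + 2) / 2) := by positivity
  have hdenom : (2 * Real.pi * r ^ ((p + 2) / 2))⁻¹ * (g / 2)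
      ≤ (poissonField b N).real {n | total n = N} := by
    have h0 := setIntegral_exp_eq_fourierIntegrand hb0 N (fun _ => 0) hρ
    simp only [zero_mul, Finset.sum_const_zero, Complex.ofReal_zero, mul_zero, Complex.exp_zero,
      integral_const, measureReal_restrict_apply_univ, Complex.real_smul, mul_one] at h0
    have h6 : ‖(((poissonField b N).real {n | total n = N} : ℝ) : ℂ)‖
        = (poissonField b N).real {n | total n = N} := by
      rw [Complex.norm_real, Real.norm_of_nonneg measureReal_nonneg]
    have h7 : ‖(2 * Real.pi * (r ^ ((p + 2) / 2) : ℝ) : ℂ)⁻¹‖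
        = (2 * Real.pi * r ^ ((p + 2) / 2))⁻¹ := by
      rw [norm_inv]
      norm_cast
      rw [Real.norm_of_nonneg (by positivity)]
    rw [← h6, h0, norm_mul, h7]
    gcongr
  have hpos : 0 < (2 * Real.pi * r ^ ((p + 2) / 2))⁻¹ * (g / 2) := by positivity
  have hratio : (poissonField (fun k => a k * Real.exp (θ k) * Real.exp (-δ N * k)) N).real
      {n | total n = N} / (poissonField b N).real {n | total n = N} ≤ D / (g / 2) := by
    calc _ ≤ ((2 * Real.pi * r ^ ((p + 2) / 2))⁻¹ * D)
          / ((2 * Real.pi * r ^ ((p + 2) / 2))⁻¹ * (g / 2)) := by gcongr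
      _ = D / (g / 2) := mul_div_mul_left _ _ (by positivity)
  gcongr

end Asymptotics

/-! ### The limiting covariance form -/

/-- A vector of length `2q + 1`, extended by `0`. -/
noncomputable def extend {q : ℕ} (t : Fin (2 * q + 1) → ℝ) (i : ℕ) : ℝ :=
  if h : i < 2 * q + 1 then t ⟨i, h⟩ else 0

/-- The coefficients of the masses in a linear form on vectors of length `2q + 1`; the mass of
the stratum `0` is not a coordinate of the scaled vector. -/
noncomputable def massCoeff {q : ℕ} (t : Fin (2 * q + 1) → ℝ) (j : ℕ) : ℝ :=
  if j = 0 then 0 else extend t (q + j)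

lemma extend_coe {q : ℕ} (t : Fin (2 * q + 1) → ℝ) (i : Fin (2 * q + 1)) : extend t i = t i := by
  rw [extend, dif_pos i.2]

lemma sum_fin_eq {q : ℕ} {M : Type*} [AddCommMonoid M] (F : ℕ → M) :
    ∑ i : Fin (2 * q + 1), F i
      = ∑ j ∈ Finset.range (q + 1), F j + ∑ j ∈ Finset.range q, F (q + (j + 1)) := by
  rw [← Finset.sum_range F, show 2 * q + 1 = (q + 1) + q by ring, Finset.sum_range_add]
  congr 1
  exact Finset.sum_congr rfl fun j _ => by congr 1; ring

lemma sum_massCoeff {q : ℕ} (t : Fin (2 * q + 1) → ℝ) (F : ℕ → ℝ) :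
    ∑ j ∈ Finset.range q, extend t (q + (j + 1)) * F (j + 1)
      = ∑ j ∈ Finset.range (q + 1), massCoeff t j * F j := by
  rw [Finset.sum_range_succ']
  simp [massCoeff]

lemma sum_mul_scaledVector (a : ℕ → ℝ) (C p : ℝ) (u : ℕ → ℝ) (q : ℕ) (δ : ℝ) {N : ℕ}
    (η : N.Partition) (t : Fin (2 * q + 1) → ℝ) :
    ∑ i, t i * scaledVector a C p u q δ η i
      = linForm a C p u q δ (extend t) (massCoeff t) η := by
  have h : ∀ i : Fin (2 * q + 1), t i * scaledVector a C p u q δ η i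
      = (fun i : ℕ => extend t i * if i ≤ q then scaledCount a C p u q δ i η
        else scaledMass a C p u q δ (i - q) η) i := fun i => by
    simp only [extend_coe]
    rfl
  rw [Finset.sum_congr rfl fun i _ => h i, sum_fin_eq fun i : ℕ => extend t i * if i ≤ q then
    scaledCount a C p u q δ i η else scaledMass a C p u q δ (i - q) η, linForm, Finset.sum_add_distrib,
    ← sum_massCoeff t fun j => scaledMass a C p u q δ j η]
  congr 1
  · refine Finset.sum_congr rfl fun j hj => ?_
    rw [if_pos (by rw [Finset.mem_range] at hj; omega)]
  · refine Finset.sum_congr rfl fun j hj => ?_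
    rw [if_neg (by omega), Nat.add_sub_cancel_left]

/-- The covariances of the coordinates with the total size. -/
noncomputable def crossVec (C p : ℝ) (u : ℕ → ℝ) (q m : ℕ) : ℝ :=
  if m ≤ q then fInt C u q m p else fInt C u q (m - q) (p + 1)

/-- The covariances before conditioning on the total size. -/
noncomputable def poissonCov (C p : ℝ) (u : ℕ → ℝ) (q m k : ℕ) : ℝ :=
  if m ≤ q then
    if k ≤ q then (if m = k then fInt C u q m (p - 1) else 0)
    else (if m = k - q then fInt C u q m p else 0)
  else
    if k ≤ q then (if k = m - q then fInt C u q k p else 0)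
    else (if m = k then fInt C u q (m - q) (p + 1) else 0)

lemma theta_eq (C p : ℝ) (u : ℕ → ℝ) (q m k : ℕ) :
    theta C p u q m k = poissonCov C p u q m k
      - crossVec C p u q m * crossVec C p u q k / (C * Real.Gamma (p + 2)) := by
  by_cases hm : m ≤ q <;> by_cases hk : k ≤ q <;> simp only [theta, poissonCov, crossVec, hm, hk,
    if_true, if_false]
  rw [mul_comm (fInt C u q k p)]

lemma poissonCov_comm (C p : ℝ) (u : ℕ → ℝ) (q m k : ℕ) :
    poissonCov C p u q m k = poissonCov C p u q k m := by
  by_cases hm : m ≤ q <;> by_cases hk : k ≤ q <;> simp only [poissonCov, hm, hk,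
    if_true, if_false]
  · by_cases h : m = k
    · rw [h]
    · rw [if_neg h, if_neg (Ne.symm h)]
  · by_cases h : m = k
    · rw [h]
    · rw [if_neg h, if_neg (Ne.symm h)]

lemma theta_comm (C p : ℝ) (u : ℕ → ℝ) (q m k : ℕ) :
    theta C p u q m k = theta C p u q k m := by
  rw [theta_eq, theta_eq, poissonCov_comm, mul_comm (crossVec C p u q m)]

lemma sum_mul_crossVec (C p : ℝ) (u : ℕ → ℝ) {q : ℕ} (t : Fin (2 * q + 1) → ℝ) :
    ∑ i, t i * crossVec C p u q i = crossForm C p u q (extend t) (massCoeff t) := by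
  have h : ∀ i : Fin (2 * q + 1), t i * crossVec C p u q i
      = (fun i : ℕ => extend t i * crossVec C p u q i) i := fun i => by simp only [extend_coe]
  rw [Finset.sum_congr rfl fun i _ => h i, sum_fin_eq fun i : ℕ => extend t i * crossVec C p u q i,
    crossForm, Finset.sum_add_distrib, ← sum_massCoeff t fun j => fInt C u q j (p + 1)]
  congr 1
  · refine Finset.sum_congr rfl fun j hj => ?_
    rw [crossVec, if_pos (by rw [Finset.mem_range] at hj; omega)]
  · refine Finset.sum_congr rfl fun j hj => ?_
    rw [crossVec, if_neg (by omega), Nat.add_sub_cancel_left]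

lemma sum_poissonCov_of_le (C p : ℝ) (u : ℕ → ℝ) {q m : ℕ} (hm : m ≤ q)
    (t : Fin (2 * q + 1) → ℝ) :
    ∑ k : Fin (2 * q + 1), t k * poissonCov C p u q m k
      = extend t m * fInt C u q m (p - 1) + massCoeff t m * fInt C u q m p := by
  have h : ∀ i : Fin (2 * q + 1), t i * poissonCov C p u q m i
      = (fun i : ℕ => extend t i * poissonCov C p u q m i) i := fun i => by simp only [extend_coe]
  rw [Finset.sum_congr rfl fun i _ => h i,
    sum_fin_eq fun i : ℕ => extend t i * poissonCov C p u q m i]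
  congr 1
  · rw [Finset.sum_eq_single m]
    · simp [poissonCov, hm]
    · intro k hk hkm
      rw [Finset.mem_range] at hk
      simp [poissonCov, hm, show k ≤ q by omega, Ne.symm hkm]
    · intro h
      exact absurd (Finset.mem_range.2 (by omega)) h
  · have e : ∀ j ∈ Finset.range q, extend t (q + (j + 1)) * poissonCov C p u q m (q + (j + 1))
        = extend t (q + (j + 1)) * (if m = j + 1 then fInt C u q m p else 0) := by
      intro j _
      rw [poissonCov, if_pos hm, if_neg (by omega), Nat.add_sub_cancel_left]
    rw [Finset.sum_congr rfl e, sum_massCoeff t fun j => if m = j then fInt C u q m p else 0,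
      Finset.sum_eq_single m]
    · rw [if_pos rfl]
    · intro j _ hj
      rw [if_neg (Ne.symm hj), mul_zero]
    · intro h
      exact absurd (Finset.mem_range.2 (by omega)) h

lemma sum_poissonCov_of_gt (C p : ℝ) (u : ℕ → ℝ) {q j : ℕ} (hj0 : 1 ≤ j) (hj : j ≤ q)
    (t : Fin (2 * q + 1) → ℝ) :
    ∑ k : Fin (2 * q + 1), t k * poissonCov C p u q (q + j) k
      = extend t j * fInt C u q j p + massCoeff t j * fInt C u q j (p + 1) := by
  have h : ∀ i : Fin (2 * q + 1), t i * poissonCov C p u q (q + j) i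
      = (fun i : ℕ => extend t i * poissonCov C p u q (q + j) i) i := fun i => by
    simp only [extend_coe]
  rw [Finset.sum_congr rfl fun i _ => h i,
    sum_fin_eq fun i : ℕ => extend t i * poissonCov C p u q (q + j) i]
  congr 1
  · rw [Finset.sum_eq_single j]
    · simp [poissonCov, hj, show ¬ q + j ≤ q by omega]
    · intro k hk hkj
      rw [Finset.mem_range] at hk
      simp [poissonCov, show ¬ q + j ≤ q by omega, show k ≤ q by omega, hkj]
    · intro h
      exact absurd (Finset.mem_range.2 (by omega)) h
  · have e : ∀ i ∈ Finset.range q, extend t (q + (i + 1)) * poissonCov C p u q (q + j) (q + (i + 1))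
        = extend t (q + (i + 1)) * (if j = i + 1 then fInt C u q j (p + 1) else 0) := by
      intro i _
      rw [poissonCov, if_neg (by omega), if_neg (by omega), Nat.add_sub_cancel_left]
      simp only [add_right_inj]
    rw [Finset.sum_congr rfl e, sum_massCoeff t fun i => if j = i then fInt C u q j (p + 1) else 0,
      Finset.sum_eq_single j]
    · rw [if_pos rfl]
    · intro i _ hi
      rw [if_neg (Ne.symm hi), mul_zero]
    · intro h
      exact absurd (Finset.mem_range.2 (by omega)) h

/-- The quadratic form of the limiting covariance matrix: the variance of the linear statistic,
minus the part explained by the total size. -/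
lemma dotProduct_covMatrix (C p : ℝ) (u : ℕ → ℝ) {q : ℕ} (t : Fin (2 * q + 1) → ℝ) :
    dotProduct t ((covMatrix C p u q).mulVec t) = quadForm C p u q (extend t) (massCoeff t)
      - crossForm C p u q (extend t) (massCoeff t) ^ 2 / (C * Real.Gamma (p + 2)) := by
  have h1 : ∀ m : Fin (2 * q + 1), (covMatrix C p u q).mulVec t m
      = ∑ k : Fin (2 * q + 1), t k * poissonCov C p u q m k
        - crossVec C p u q m * crossForm C p u q (extend t) (massCoeff t)
          / (C * Real.Gamma (p + 2)) := by
    intro m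
    rw [Matrix.mulVec, dotProduct, ← sum_mul_crossVec, Finset.mul_sum, Finset.sum_div,
      ← Finset.sum_sub_distrib]
    refine Finset.sum_congr rfl fun k _ => ?_
    rw [covMatrix, Matrix.of_apply, theta_eq]
    ring
  rw [dotProduct]
  simp_rw [h1, mul_sub]
  rw [Finset.sum_sub_distrib]
  congr 1
  · have h : ∀ i : Fin (2 * q + 1), t i * ∑ k : Fin (2 * q + 1), t k * poissonCov C p u q i k
        = (fun i : ℕ => extend t i * ∑ k : Fin (2 * q + 1), t k * poissonCov C p u q i k) i :=
      fun i => by simp only [extend_coe]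
    rw [Finset.sum_congr rfl fun i _ => h i, sum_fin_eq fun i : ℕ =>
      extend t i * ∑ k : Fin (2 * q + 1), t k * poissonCov C p u q i k]
    have e1 : ∀ m ∈ Finset.range (q + 1),
        extend t m * ∑ k : Fin (2 * q + 1), t k * poissonCov C p u q m k
        = extend t m * (extend t m * fInt C u q m (p - 1) + massCoeff t m * fInt C u q m p) := by
      intro m hm
      rw [sum_poissonCov_of_le C p u (by rw [Finset.mem_range] at hm; omega)]
    have e2 : ∀ j ∈ Finset.range q,
        extend t (q + (j + 1)) * ∑ k : Fin (2 * q + 1), t k * poissonCov C p u q (q + (j + 1)) k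
        = extend t (q + (j + 1)) * (extend t (j + 1) * fInt C u q (j + 1) p
          + massCoeff t (j + 1) * fInt C u q (j + 1) (p + 1)) := by
      intro j hj
      rw [sum_poissonCov_of_gt C p u (by omega) (by rw [Finset.mem_range] at hj; omega)]
    rw [Finset.sum_congr rfl e1, Finset.sum_congr rfl e2,
      sum_massCoeff t fun j => extend t j * fInt C u q j p + massCoeff t j * fInt C u q j (p + 1),
      quadForm, ← Finset.sum_add_distrib]
    exact Finset.sum_congr rfl fun j _ => by ring
  · rw [sq, ← sum_mul_crossVec, Finset.sum_mul, Finset.sum_div]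
    exact Finset.sum_congr rfl fun j _ => by ring

section

variable {C p : ℝ} {a : ℕ → ℝ} {q : ℕ} {u : ℕ → ℝ} {δ : ℕ → ℝ}

lemma quadForm_nonneg (hC : 0 < C) (hp : 0 < p) (ha : ∀ k, 1 ≤ k → 0 < a k)
    (hasymp : a ~[atTop] fun k : ℕ => C * (k : ℝ) ^ (p - 1)) (hu0 : u 0 = 0)
    (hu : ∀ j < q, u j < u (j + 1)) (hδ : Tendsto (fun N => δ N * scaling C p N) atTop (𝓝 1))
    (c d : ℕ → ℝ) : 0 ≤ quadForm C p u q c d := by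
  have h := tendsto_quadForm hC hp ha hasymp hu0 hu hδ c d 0
  simp only [add_zero] at h
  refine ge_of_tendsto' h fun N => ?_
  have hr := scaling_nonneg hC hp N
  refine div_nonneg (Finset.sum_nonneg fun k hk => ?_) (by positivity)
  have := ha k (Finset.mem_Icc.1 hk).1
  positivity

lemma posSemidef_covMatrix (hC : 0 < C) (hp : 0 < p) (ha : ∀ k, 1 ≤ k → 0 < a k)
    (hasymp : a ~[atTop] fun k : ℕ => C * (k : ℝ) ^ (p - 1)) (hu0 : u 0 = 0)
    (hu : ∀ j < q, u j < u (j + 1)) (hδ : Tendsto (fun N => δ N * scaling C p N) atTop (𝓝 1)) :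
    (covMatrix C p u q).PosSemidef := by
  have hΓ := Real.Gamma_pos_of_pos (by linarith : 0 < p + 2)
  refine Matrix.PosSemidef.of_dotProduct_mulVec_nonneg ?_ fun t => ?_
  · ext m k
    rw [Matrix.conjTranspose_apply, star_trivial, covMatrix, Matrix.of_apply, Matrix.of_apply,
      theta_comm]
  · rw [star_trivial, dotProduct_covMatrix]
    -- The form is the minimum over `v` of the variances of the statistics shifted by `v`.
    have h := quadForm_add hC hp hu0 hu (extend t) (massCoeff t)
      (-(crossForm C p u q (extend t) (massCoeff t) / (C * Real.Gamma (p + 2))))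
    have h0 := quadForm_nonneg hC hp ha hasymp hu0 hu hδ (extend t) fun j => massCoeff t j
      + -(crossForm C p u q (extend t) (massCoeff t) / (C * Real.Gamma (p + 2)))
    rw [h] at h0
    refine h0.trans (le_of_eq ?_)
    field_simp
    ring

/-! ### The central limit theorem and the moments -/

theorem tendstoInDistribution_scaledVector (hC : 0 < C) (hp : 0 < p) (ha : ∀ k, 1 ≤ k → 0 < a k)
    (hasymp : a ~[atTop] fun k : ℕ => C * (k : ℝ) ^ (p - 1)) (hu0 : u 0 = 0)
    (hu : ∀ j < q, u j < u (j + 1)) (hδ : Tendsto (fun N => δ N * scaling C p N) atTop (𝓝 1))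
    (hmean : Tendsto (fun N : ℕ => (N - ∑ k ∈ Finset.Icc 1 N, (k : ℝ) * a k * Real.exp (-δ N * k))
      / scaling C p N ^ ((p + 2) / 2)) atTop (𝓝 0)) :
    TendstoInDistribution (fun (N : ℕ) (η : N.Partition) => scaledVector a C p u q (δ N) η) atTop id
      (fun N : ℕ => gibbsMeasure a ha N) (multivariateGaussian 0 (covMatrix C p u q)) where
  forall_aemeasurable N := Measurable.of_discrete.aemeasurable
  tendsto := by
    have hS := posSemidef_covMatrix hC hp ha hasymp hu0 hu hδ
    refine ProbabilityMeasure.tendsto_of_tendsto_charFun fun t => ?_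
    have h := tendsto_integral_exp_linForm hC hp ha hasymp hu0 hu hδ hmean (extend t) (massCoeff t)
    simp only [ProbabilityMeasure.coe_mk, Measure.map_id]
    rw [charFun_multivariateGaussian hS, dotProduct_covMatrix]
    convert h using 2
    · rename_i N
      rw [charFun_apply, integral_map Measurable.of_discrete.aemeasurable
        (by fun_prop)]
      refine integral_congr_ae (Eventually.of_forall fun η => ?_)
      simp only
      rw [← sum_mul_scaledVector, mul_comm]
      congr 3
    · push_cast
      congr 1
      simp

/-- Convergence in distribution together with bounded second moments of `f` gives convergence of
the expectations of the continuous function `f`, by truncation. -/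
lemma tendsto_integral_of_bounded_sq {E : Type*} [TopologicalSpace E] [MeasurableSpace E]
    [OpensMeasurableSpace E] {Ω : ℕ → Type*} [∀ N, MeasurableSpace (Ω N)] {X : ∀ N, Ω N → E}
    {μ : ∀ N, Measure (Ω N)} [∀ N, IsProbabilityMeasure (μ N)] {γ : Measure E}
    [IsProbabilityMeasure γ] (hX : TendstoInDistribution X atTop id μ γ) {f : E → ℝ}
    (hf : Continuous f) {B : ℝ} (hint : ∀ N, Integrable (fun ω => f (X N ω)) (μ N))
    (hint2 : ∀ N, Integrable (fun ω => f (X N ω) ^ 2) (μ N))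
    (hB : ∀ᶠ N in atTop, ∫ ω, f (X N ω) ^ 2 ∂μ N ≤ B) (hγ : Integrable f γ)
    (hγ2 : Integrable (fun x => f x ^ 2) γ) :
    Tendsto (fun N => ∫ ω, f (X N ω) ∂μ N) atTop (𝓝 (∫ x, f x ∂γ)) := by
  have hB0 : 0 ≤ B := by
    obtain ⟨N, hN⟩ := hB.exists
    exact (integral_nonneg fun ω => sq_nonneg _).trans hN
  set B' := max B (∫ x, f x ^ 2 ∂γ) with hB'
  have hB'0 : 0 ≤ B' := hB0.trans (le_max_left _ _)
  rw [Metric.tendsto_atTop']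
  intro ε hε
  obtain ⟨R, hR0, hR⟩ : ∃ R : ℝ, 0 < R ∧ B' / R < ε / 3 := by
    refine ⟨3 * (B' + 1) / ε, by positivity, ?_⟩
    rw [div_lt_div_iff₀ (by positivity) (by norm_num)]
    field_simp
    nlinarith
  -- the truncation of `f` at height `R`
  set g : E → ℝ := fun x => max (-R) (min (f x) R) with hg
  have hgc : Continuous g := continuous_const.max (hf.min continuous_const)
  have hgb : ∀ x, |g x| ≤ R := fun x => by
    rw [abs_le]
    exact ⟨le_max_left _ _, max_le (by linarith) (min_le_right _ _)⟩
  have hdiff : ∀ x, |f x - g x| ≤ f x ^ 2 / R := by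
    intro x
    rw [le_div_iff₀ hR0]
    simp only [hg]
    rcases le_total (f x) R with h1 | h1
    · rw [min_eq_left h1]
      rcases le_total (-R) (f x) with h2 | h2
      · rw [max_eq_right h2, sub_self, abs_zero, zero_mul]
        positivity
      · rw [max_eq_left h2, abs_of_nonpos (by linarith)]
        nlinarith
    · rw [min_eq_right h1, max_eq_right (by linarith), abs_of_nonneg (by linarith)]
      nlinarith
  have hgN : Tendsto (fun N => ∫ ω, g (X N ω) ∂μ N) atTop (𝓝 (∫ x, g x ∂γ)) := by
    have h := (ProbabilityMeasure.tendsto_iff_forall_integral_tendsto.1 hX.tendsto)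
      (BoundedContinuousFunction.ofNormedAddCommGroup g hgc R hgb)
    simp only [ProbabilityMeasure.coe_mk, Measure.map_id,
      BoundedContinuousFunction.coe_ofNormedAddCommGroup] at h
    refine h.congr fun N => ?_
    exact integral_map (hX.forall_aemeasurable N) hgc.aestronglyMeasurable
  have hgint : ∀ N, Integrable (fun ω => g (X N ω)) (μ N) := fun N =>
    Integrable.of_bound (hgc.measurable.comp_aemeasurable
      (hX.forall_aemeasurable N)).aestronglyMeasurable R (Eventually.of_forall fun ω => hgb _)
  have hgγ : Integrable g γ :=
    Integrable.of_bound hgc.aestronglyMeasurable R (Eventually.of_forall fun ω => hgb _)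
  have h1 : ∀ᶠ N in atTop, |∫ ω, f (X N ω) ∂μ N - ∫ ω, g (X N ω) ∂μ N| < ε / 3 := by
    filter_upwards [hB] with N hN
    refine lt_of_le_of_lt ?_ hR
    rw [← integral_sub (hint N) (hgint N)]
    calc _ ≤ ∫ ω, |f (X N ω) - g (X N ω)| ∂μ N := abs_integral_le_integral_abs
      _ ≤ ∫ ω, f (X N ω) ^ 2 / R ∂μ N :=
          integral_mono ((hint N).sub (hgint N)).abs ((hint2 N).div_const R) fun ω => hdiff _
      _ ≤ B' / R := by
          rw [integral_div]
          gcongr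
          exact hN.trans (le_max_left _ _)
  have h2 : |∫ x, f x ∂γ - ∫ x, g x ∂γ| < ε / 3 := by
    refine lt_of_le_of_lt ?_ hR
    rw [← integral_sub hγ hgγ]
    calc _ ≤ ∫ x, |f x - g x| ∂γ := abs_integral_le_integral_abs
      _ ≤ ∫ x, f x ^ 2 / R ∂γ :=
          integral_mono (hγ.sub hgγ).abs (hγ2.div_const R) fun ω => hdiff _
      _ ≤ B' / R := by
          rw [integral_div]
          gcongr
          exact le_max_right _ _
  have h3 := (Metric.tendsto_nhds.1 hgN) (ε / 3) (by positivity)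
  obtain ⟨n, hn⟩ := eventually_atTop.1 (h1.and h3)
  refine ⟨n, fun N hN => ?_⟩
  obtain ⟨h4, h5⟩ := hn N hN.le
  rw [Real.dist_eq] at h5 ⊢
  rw [abs_lt] at h2 h4 h5 ⊢
  constructor <;> linarith [h2.1, h2.2, h4.1, h4.2, h5.1, h5.2]

/-- Bounds `e ^ ‖x‖₁`, and with it all monomials in `x`, by exponentials of finitely many linear
forms. -/
lemma exp_sum_abs_le {ι : Type*} [Fintype ι] [DecidableEq ι] (x : ι → ℝ) :
    Real.exp (∑ i, |x i|)
      ≤ ∑ s : ι → Bool, Real.exp (∑ i, (if s i then 1 else -1 : ℝ) * x i) := by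
  have h : ∑ i, |x i| = ∑ i, (if decide (0 ≤ x i) then 1 else -1 : ℝ) * x i := by
    refine Finset.sum_congr rfl fun i _ => ?_
    by_cases hi : 0 ≤ x i
    · simp [hi, abs_of_nonneg hi]
    · simp [hi, abs_of_neg (not_le.1 hi)]
  rw [h]
  exact Finset.single_le_sum (f := fun s : ι → Bool => Real.exp (∑ i,
    (if s i then 1 else -1 : ℝ) * x i)) (fun s _ => (Real.exp_pos _).le)
    (Finset.mem_univ fun i => decide (0 ≤ x i))

lemma sq_monomial_le {ι : Type*} [Fintype ι] (α : ι → ℕ) (x : ι → ℝ) {y : ℝ}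
    (hy : ∀ i, |x i| ≤ y) : (∏ i, x i ^ α i) ^ 2 ≤ y ^ (2 * ∑ i, α i) := by
  rw [pow_mul', ← sq_abs (∏ i, x i ^ α i), Finset.abs_prod]
  gcongr
  rw [← Finset.prod_pow_eq_pow_sum]
  refine Finset.prod_le_prod (fun i _ => abs_nonneg _) fun i _ => ?_
  rw [abs_pow]
  exact pow_le_pow_left₀ (abs_nonneg _) (hy i) _

lemma integrable_gaussian_monomial_sq {ι : Type*} [Fintype ι] [DecidableEq ι]
    (S : Matrix ι ι ℝ) (α : ι → ℕ) :
    Integrable (fun z : EuclideanSpace ℝ ι => (∏ i, z i ^ α i) ^ 2) (multivariateGaussian 0 S) := by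
  have h : Integrable (fun z : EuclideanSpace ℝ ι => ‖z‖ ^ (2 * ∑ i, α i))
      (multivariateGaussian 0 S) :=
    (IsGaussian.memLp_id (multivariateGaussian 0 S) (2 * ∑ i, α i : ℕ)
      (ENNReal.natCast_ne_top _)).integrable_norm_pow'
  refine h.mono' ?_ (Eventually.of_forall fun z => ?_)
  · exact (Continuous.pow (by fun_prop) 2).aestronglyMeasurable
  · rw [Real.norm_of_nonneg (sq_nonneg _)]
    refine sq_monomial_le α (fun i => z i) fun i => ?_
    rw [← Real.norm_eq_abs]
    exact PiLp.norm_apply_le z i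

lemma integrable_gaussian_monomial {ι : Type*} [Fintype ι] [DecidableEq ι]
    (S : Matrix ι ι ℝ) (α : ι → ℕ) :
    Integrable (fun z : EuclideanSpace ℝ ι => ∏ i, z i ^ α i) (multivariateGaussian 0 S) := by
  have hm : AEStronglyMeasurable (fun z : EuclideanSpace ℝ ι => ∏ i, z i ^ α i)
      (multivariateGaussian 0 S) := by
    exact Continuous.aestronglyMeasurable (by fun_prop)
  exact ((memLp_two_iff_integrable_sq hm).2 (integrable_gaussian_monomial_sq S α)).integrable
    (by norm_num)

theorem tendsto_moment_scaledVector (hC : 0 < C) (hp : 0 < p) (ha : ∀ k, 1 ≤ k → 0 < a k)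
    (hasymp : a ~[atTop] fun k : ℕ => C * (k : ℝ) ^ (p - 1)) (hu0 : u 0 = 0)
    (hu : ∀ j < q, u j < u (j + 1)) (hδ : Tendsto (fun N => δ N * scaling C p N) atTop (𝓝 1))
    (hmean : Tendsto (fun N : ℕ => (N - ∑ k ∈ Finset.Icc 1 N, (k : ℝ) * a k * Real.exp (-δ N * k))
      / scaling C p N ^ ((p + 2) / 2)) atTop (𝓝 0)) (α : Fin (2 * q + 1) → ℕ) :
    Tendsto (fun N : ℕ => ∫ η : N.Partition,
        ∏ i, (scaledVector a C p u q (δ N) η) i ^ α i ∂gibbsMeasure a ha N)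
      atTop (𝓝 (∫ z : EuclideanSpace ℝ (Fin (2 * q + 1)), ∏ i, z i ^ α i
        ∂multivariateGaussian 0 (covMatrix C p u q))) := by
  have hX := tendstoInDistribution_scaledVector hC hp ha hasymp hu0 hu hδ hmean
  have hexp : ∀ s : Fin (2 * q + 1) → Bool, ∃ B : ℝ, ∀ᶠ N in atTop,
      ∫ η : N.Partition, Real.exp (∑ i, (if s i then 1 else -1 : ℝ)
        * scaledVector a C p u q (δ N) η i) ∂gibbsMeasure a ha N ≤ B := by
    intro s
    obtain ⟨B, hB⟩ := exists_integral_real_exp_linForm_le hC hp ha hasymp hu0 hu hδ hmean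
      (extend fun i => if s i then 1 else -1) (massCoeff fun i => if s i then 1 else -1)
    refine ⟨B, hB.mono fun N hN => ?_⟩
    simp_rw [sum_mul_scaledVector a C p u q (δ N) _ fun i => if s i then (1 : ℝ) else -1]
    exact hN
  choose B hB using hexp
  set m := 2 * ∑ i, α i with hm
  refine tendsto_integral_of_bounded_sq (f := fun z : EuclideanSpace ℝ (Fin (2 * q + 1)) =>
    ∏ i, z i ^ α i) hX (by fun_prop) (B := (m.factorial : ℝ) * ∑ s, B s)
    (fun N => Integrable.of_finite) (fun N => Integrable.of_finite) ?_
    (integrable_gaussian_monomial _ α) (integrable_gaussian_monomial_sq _ α)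
  filter_upwards [eventually_all.2 hB] with N hN
  calc ∫ η : N.Partition, (∏ i, scaledVector a C p u q (δ N) η i ^ α i) ^ 2 ∂gibbsMeasure a ha N
      ≤ ∫ η : N.Partition, (m.factorial : ℝ) * ∑ s : Fin (2 * q + 1) → Bool, Real.exp (∑ i,
          (if s i then 1 else -1 : ℝ) * scaledVector a C p u q (δ N) η i) ∂gibbsMeasure a ha N := by
        refine integral_mono Integrable.of_finite Integrable.of_finite fun η => ?_
        set x : Fin (2 * q + 1) → ℝ := fun i => scaledVector a C p u q (δ N) η i with hx
        have h1 := sq_monomial_le α x (y := ∑ i, |x i|) fun i =>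
          Finset.single_le_sum (f := fun i => |x i|) (fun i _ => abs_nonneg _) (Finset.mem_univ i)
        have h2 := Real.pow_div_factorial_le_exp (∑ i, |x i|)
          (Finset.sum_nonneg fun i _ => abs_nonneg _) m
        rw [div_le_iff₀ (by positivity)] at h2
        have h3 := exp_sum_abs_le x
        calc _ ≤ (∑ i, |x i|) ^ m := h1
          _ ≤ Real.exp (∑ i, |x i|) * m.factorial := h2
          _ ≤ _ := by rw [mul_comm]; gcongr
    _ = (m.factorial : ℝ) * ∑ s : Fin (2 * q + 1) → Bool, ∫ η : N.Partition, Real.exp (∑ i,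
          (if s i then 1 else -1 : ℝ) * scaledVector a C p u q (δ N) η i)
          ∂gibbsMeasure a ha N := by
        rw [integral_const_mul, integral_finsetSum _ fun s _ => Integrable.of_finite]
    _ ≤ _ := by
        gcongr with s
        exact hN s

theorem tendsto_covariance_scaledVector (hC : 0 < C) (hp : 0 < p) (ha : ∀ k, 1 ≤ k → 0 < a k)
    (hasymp : a ~[atTop] fun k : ℕ => C * (k : ℝ) ^ (p - 1)) (hu0 : u 0 = 0)
    (hu : ∀ j < q, u j < u (j + 1)) (hδ : Tendsto (fun N => δ N * scaling C p N) atTop (𝓝 1))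
    (hmean : Tendsto (fun N : ℕ => (N - ∑ k ∈ Finset.Icc 1 N, (k : ℝ) * a k * Real.exp (-δ N * k))
      / scaling C p N ^ ((p + 2) / 2)) atTop (𝓝 0)) (m k : Fin (2 * q + 1)) :
    Tendsto (fun N : ℕ => cov[fun η : N.Partition => (scaledVector a C p u q (δ N) η) m,
        fun η : N.Partition => (scaledVector a C p u q (δ N) η) k; gibbsMeasure a ha N])
      atTop (𝓝 (theta C p u q m k)) := by
  have hS := posSemidef_covMatrix hC hp ha hasymp hu0 hu hδ
  have h1 : ∀ (x : Fin (2 * q + 1) → ℝ) (i : Fin (2 * q + 1)),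
      ∏ j, x j ^ (Pi.single i 1 : Fin (2 * q + 1) → ℕ) j = x i := by
    intro x i
    rw [Finset.prod_eq_single i]
    · simp
    · intro j _ hj
      simp [hj]
    · simp
  have h2 : ∀ (x : Fin (2 * q + 1) → ℝ) (i l : Fin (2 * q + 1)),
      ∏ j, x j ^ (Pi.single i 1 + Pi.single l 1 : Fin (2 * q + 1) → ℕ) j = x i * x l := by
    intro x i l
    simp_rw [Pi.add_apply, pow_add]
    rw [Finset.prod_mul_distrib, h1, h1]
  have hmom := tendsto_moment_scaledVector hC hp ha hasymp hu0 hu hδ hmean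
  have hmk := hmom (Pi.single m 1 + Pi.single k 1)
  have hm := hmom (Pi.single m 1)
  have hk := hmom (Pi.single k 1)
  simp_rw [fun z : EuclideanSpace ℝ (Fin (2 * q + 1)) => h2 z m k] at hmk
  simp_rw [fun z : EuclideanSpace ℝ (Fin (2 * q + 1)) => h1 z m] at hm
  simp_rw [fun z : EuclideanSpace ℝ (Fin (2 * q + 1)) => h1 z k] at hk
  have hcov := covariance_eval_multivariateGaussian (μ := 0) hS m k
  have hL : ∀ i : Fin (2 * q + 1), MemLp (fun z : EuclideanSpace ℝ (Fin (2 * q + 1)) => z i) 2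
      (multivariateGaussian 0 (covMatrix C p u q)) := by
    intro i
    have := integrable_gaussian_monomial_sq (covMatrix C p u q) (Pi.single i 1)
    simp_rw [fun z : EuclideanSpace ℝ (Fin (2 * q + 1)) => h1 z i] at this
    exact (memLp_two_iff_integrable_sq (by fun_prop)).2 this
  rw [covariance_eq_sub (hL m) (hL k)] at hcov
  have e : theta C p u q m k = covMatrix C p u q m k := rfl
  rw [e, ← hcov]
  refine (hmk.sub (hm.mul hk)).congr fun N => ?_
  rw [covariance_eq_sub MemLp.of_discrete MemLp.of_discrete]
  rfl

end

/-! ### Decay of the limiting covariances for equidistant points -/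

lemma rpow_mul_exp_neg_lt {s x y : ℝ} (hs : 0 < s) (hsx : s ≤ x) (hxy : x < y) :
    y ^ s * Real.exp (-y) < x ^ s * Real.exp (-x) := by
  have hx : 0 < x := hs.trans_le hsx
  have hy : 0 < y := hx.trans hxy
  rw [Real.rpow_def_of_pos hx, Real.rpow_def_of_pos hy, ← Real.exp_add, ← Real.exp_add,
    Real.exp_lt_exp]
  have h : Real.log (y / x) < y / x - 1 :=
    Real.log_lt_sub_one_of_pos (by positivity) (by rw [Ne, div_eq_one_iff_eq hx.ne']; exact hxy.ne')
  rw [Real.log_div hy.ne' hx.ne'] at h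
  have h2 : (y / x - 1) * s ≤ y - x := by
    rw [div_sub_one hx.ne', div_mul_eq_mul_div, div_le_iff₀ hx]
    nlinarith
  nlinarith

lemma setIntegral_Ioo_rpow_mul_exp_neg_lt {s d v w : ℝ} (hs : 0 < s) (hd : 0 < d) (hsv : s ≤ v)
    (hvw : v < w) : ∫ x in Set.Ioo w (w + d), x ^ s * Real.exp (-x)
      < ∫ x in Set.Ioo v (v + d), x ^ s * Real.exp (-x) := by
  have hc : ContinuousOn (fun x : ℝ => x ^ s * Real.exp (-x)) Set.univ :=
    ((Real.continuous_rpow_const hs.le).mul (by fun_prop)).continuousOn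
  rw [← integral_Ioc_eq_integral_Ioo, ← integral_Ioc_eq_integral_Ioo,
    ← intervalIntegral.integral_of_le (by linarith), ← intervalIntegral.integral_of_le (by linarith)]
  have h := intervalIntegral.integral_comp_add_right (a := v) (b := v + d)
    (fun x : ℝ => x ^ s * Real.exp (-x)) (w - v)
  rw [show v + (w - v) = w by ring, show v + d + (w - v) = w + d by ring] at h
  rw [← h]
  refine intervalIntegral.integral_lt_integral_of_continuousOn_of_le_of_exists_lt (by linarith)
    (hc.comp (by fun_prop) fun x _ => Set.mem_univ _) (hc.mono (Set.subset_univ _))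
    (fun x hx => (rpow_mul_exp_neg_lt hs (hsv.trans hx.1.le) (by linarith)).le)
    ⟨v, ⟨le_rfl, by linarith⟩, rpow_mul_exp_neg_lt hs hsv (by linarith)⟩

/-- The incomplete Gamma integral is of the order of its integrand at the left end point. -/
lemma exists_setIntegral_Ioi_le {s d : ℝ} (hs : 0 < s) (hd : 0 < d) : ∃ K : ℝ, 0 < K ∧
    ∀ v, d ≤ v → ∫ x in Set.Ioi v, x ^ s * Real.exp (-x) ≤ K * (v ^ s * Real.exp (-v)) := by
  set L := max 1 (2 * s / d) with hL
  have hL1 : 1 ≤ L := le_max_left _ _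
  have hL0 : 0 < L := by linarith
  refine ⟨2 * L ^ s, by positivity, fun v hv => ?_⟩
  have hv0 : 0 < v := hd.trans_le hv
  have hbound : ∀ x ∈ Set.Ioi v, x ^ s * Real.exp (-x)
      ≤ L ^ s * v ^ s * Real.exp (-v / 2) * Real.exp (-(1 / 2) * x) := by
    intro x hx
    have hx : v < x := hx
    have hz : 0 ≤ (x - v) / (2 * s) := div_nonneg (by linarith) (by positivity)
    -- `x ≤ L v (1 + (x - v) / (2 s)) ≤ L v exp ((x - v) / (2 s))`
    have h1 : x ≤ L * v * Real.exp ((x - v) / (2 * s)) := by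
      have h2 : 1 + (x - v) / (2 * s) ≤ Real.exp ((x - v) / (2 * s)) := by
        linarith [Real.add_one_le_exp ((x - v) / (2 * s))]
      have h3 : 2 * s ≤ L * v := by
        have : 2 * s / d ≤ L := le_max_right _ _
        rw [div_le_iff₀ hd] at this
        nlinarith
      calc x = v + 2 * s * ((x - v) / (2 * s)) := by rw [mul_div_cancel₀ _ (by positivity)]; ring
        _ ≤ L * v + L * v * ((x - v) / (2 * s)) := by
            gcongr
            nlinarith
        _ = L * v * (1 + (x - v) / (2 * s)) := by ring
        _ ≤ _ := by gcongr
    calc x ^ s * Real.exp (-x)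
        ≤ (L * v * Real.exp ((x - v) / (2 * s))) ^ s * Real.exp (-x) := by
          gcongr
          exact hv0.le.trans hx.le
      _ = L ^ s * v ^ s * (Real.exp ((x - v) / 2) * Real.exp (-x)) := by
          rw [Real.mul_rpow (by positivity) (by positivity), Real.mul_rpow hL0.le hv0.le,
            ← Real.exp_mul, show (x - v) / (2 * s) * s = (x - v) / 2 by field_simp]
          ring
      _ = L ^ s * v ^ s * (Real.exp (-v / 2) * Real.exp (-(1 / 2) * x)) := by
          rw [← Real.exp_add, ← Real.exp_add]
          ring_nf
      _ = _ := by ring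
  calc ∫ x in Set.Ioi v, x ^ s * Real.exp (-x)
      ≤ ∫ x in Set.Ioi v, L ^ s * v ^ s * Real.exp (-v / 2) * Real.exp (-(1 / 2) * x) :=
        setIntegral_mono_on
          ((integrableOn_rpow_mul_exp_neg (by linarith)).mono_set (Set.Ioi_subset_Ioi hv0.le))
          ((integrableOn_exp_mul_Ioi (by norm_num) v).const_mul _) measurableSet_Ioi hbound
    _ = 2 * L ^ s * (v ^ s * Real.exp (-v)) := by
        have h : Real.exp (-v) = Real.exp (-v / 2) * Real.exp (-(1 / 2) * v) := by
          rw [← Real.exp_add]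
          congr 1
          ring
        rw [integral_const_mul, integral_exp_mul_Ioi (by norm_num), h]
        ring

lemma setIntegral_region_le {u : ℕ → ℝ} {q j : ℕ} {v s : ℝ} (hs : -1 < s) (hv : 0 ≤ v)
    (hvu : v ≤ u j) : ∫ x in region u q j, x ^ s * Real.exp (-x)
      ≤ ∫ x in Set.Ioi v, x ^ s * Real.exp (-x) := by
  refine setIntegral_mono_set
    ((integrableOn_rpow_mul_exp_neg hs).mono_set (Set.Ioi_subset_Ioi hv)) ?_
    (LE.le.eventuallyLE ?_)
  · filter_upwards [ae_restrict_mem measurableSet_Ioi] with x hx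
    have : 0 ≤ x := hv.trans (le_of_lt hx)
    simp only [Pi.zero_apply]
    positivity
  · unfold region
    split_ifs
    · exact fun x hx => hvu.trans_lt hx.1
    · exact fun x hx => hvu.trans_lt hx

section

variable {C p d : ℝ} {u : ℕ → ℝ}

lemma fInt_le_Gamma (hC : 0 < C) {q j : ℕ} {s : ℝ} (hs : -1 < s) (hu : 0 ≤ u j) :
    fInt C u q j s ≤ C * Real.Gamma (s + 1) := by
  rw [fInt_eq, ← integral_rpow_mul_exp_neg hs]
  exact mul_le_mul_of_nonneg_left (setIntegral_region_le hs le_rfl hu) hC.le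

lemma fInt_lt_of_equidistant (hC : 0 < C) (hd : 0 < d) (hu : ∀ j, u j = j * d) {q j k : ℕ} {s : ℝ}
    (hs : 0 < s) (hsu : s ≤ u j) (hjk : j < k) (hk : k < q) :
    fInt C u q k s < fInt C u q j s := by
  rw [fInt_eq, fInt_eq, region, region, if_pos hk, if_pos (hjk.trans hk)]
  have h1 : ∀ i, u (i + 1) = u i + d := fun i => by rw [hu, hu]; push_cast; ring
  rw [h1, h1]
  refine mul_lt_mul_of_pos_left (setIntegral_Ioo_rpow_mul_exp_neg_lt hs hd hsu ?_) hC
  rw [hu, hu]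
  gcongr

/-- For `m ≠ k` with `k` a mass coordinate, the covariance before conditioning is at most the
integral of `x ^ p e ^ (-x)` over the stratum of `k`. -/
lemma abs_poissonCov_le {q m k : ℕ} (hmk : m < k) (hk : q < k)
    (hf : 0 ≤ fInt C u q (k - q) p) : |poissonCov C p u q m k| ≤ fInt C u q (k - q) p := by
  rw [poissonCov]
  split_ifs with h1 h2 h3 h4 h5 h6
  all_goals first | omega | simpa using hf | skip
  rw [← h4, abs_of_nonneg (h4 ▸ hf)]

theorem exists_abs_theta_le (hC : 0 < C) (hp : 0 < p) (hd : 0 < d) (hu : ∀ j, u j = j * d) :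
    ∃ A : ℝ, ∀ q m k : ℕ, 1 ≤ q → m < k →
      (k ≤ q → |theta C p u q m k| ≤ A * (u k ^ p * Real.exp (-u k))) ∧
      (q < k → k ≤ 2 * q →
        |theta C p u q m k| ≤ A * (u (k - q) ^ (p + 1) * Real.exp (-u (k - q)))) := by
  obtain ⟨K₁, hK₁, hb₁⟩ := exists_setIntegral_Ioi_le hp hd
  obtain ⟨K₂, hK₂, hb₂⟩ := exists_setIntegral_Ioi_le (by linarith : 0 < p + 1) hd
  have hu0 : u 0 = 0 := by rw [hu]; simp
  have hunn : ∀ j, 0 ≤ u j := fun j => by rw [hu]; positivity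
  have hud : ∀ j, 1 ≤ j → d ≤ u j := fun j hj => by
    rw [hu]
    have : (1 : ℝ) ≤ j := by exact_mod_cast hj
    nlinarith
  have hmono : ∀ j, u j < u (j + 1) := fun j => by rw [hu, hu]; push_cast; nlinarith
  have hf₁ : ∀ q j, 1 ≤ j → fInt C u q j p ≤ C * K₁ * (u j ^ p * Real.exp (-u j)) := by
    intro q j hj
    rw [fInt_eq, mul_assoc]
    gcongr
    exact (setIntegral_region_le (by linarith) (hunn j) le_rfl).trans (hb₁ _ (hud j hj))
  have hf₂ : ∀ q j, 1 ≤ j →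
      fInt C u q j (p + 1) ≤ C * K₂ * (u j ^ (p + 1) * Real.exp (-u j)) := by
    intro q j hj
    rw [fInt_eq, mul_assoc]
    gcongr
    exact (setIntegral_region_le (by linarith) (hunn j) le_rfl).trans (hb₂ _ (hud j hj))
  have hpos : ∀ {q j : ℕ} {s : ℝ}, j ≤ q → -1 < s → 0 < fInt C u q j s := fun hj hs =>
    fInt_pos hC hu0 (fun i _ => hmono i) hj hs
  have hΓ₁ := Real.Gamma_pos_of_pos (by linarith : 0 < p + 1)
  have hΓ₂ := Real.Gamma_pos_of_pos (by linarith : 0 < p + 2)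
  set G₁ := C * Real.Gamma (p + 1) with hG₁
  set G := C * Real.Gamma (p + 2) with hG
  have hG₁0 : 0 < G₁ := by positivity
  have hG0 : 0 < G := by positivity
  have hfG₁ : ∀ q j, fInt C u q j p ≤ G₁ := fun q j =>
    fInt_le_Gamma hC (by linarith) (hunn j)
  have hfG : ∀ q j, fInt C u q j (p + 1) ≤ G := fun q j => by
    have := fInt_le_Gamma (q := q) (s := p + 1) hC (by linarith) (hunn j)
    rwa [show p + 1 + 1 = p + 2 by ring] at this
  have hcross : ∀ {q m : ℕ}, m ≤ 2 * q → 0 ≤ crossVec C p u q m ∧ crossVec C p u q m ≤ G₁ + G := by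
    intro q m hm
    rw [crossVec]
    split_ifs with h
    · exact ⟨(hpos h (by linarith)).le, (hfG₁ _ _).trans (by linarith)⟩
    · exact ⟨(hpos (by omega) (by linarith)).le, (hfG _ _).trans (by linarith)⟩
  refine ⟨(G₁ + G) * (C * (K₁ + K₂)) / G + C * K₁ / d, fun q m k hq hmk => ⟨fun hk => ?_, ?_⟩⟩
  · have hw : 0 ≤ u k ^ p * Real.exp (-u k) := by have := hunn k; positivity
    have h0 : poissonCov C p u q m k = 0 := by
      rw [poissonCov, if_pos (by omega), if_pos hk, if_neg hmk.ne]
    obtain ⟨hm0, hm⟩ := hcross (q := q) (m := m) (by omega)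
    rw [theta_eq, h0, zero_sub, abs_neg, abs_of_nonneg
      (div_nonneg (mul_nonneg hm0 (hcross (by omega)).1) hG0.le)]
    have hk' : crossVec C p u q k ≤ C * (K₁ + K₂) * (u k ^ p * Real.exp (-u k)) := by
      rw [crossVec, if_pos hk]
      refine (hf₁ q k (by omega)).trans ?_
      gcongr
      linarith
    calc _ ≤ (G₁ + G) * (C * (K₁ + K₂) * (u k ^ p * Real.exp (-u k))) / G := by
          have := (hcross (q := q) (m := k) (by omega)).1
          gcongr
      _ = (G₁ + G) * (C * (K₁ + K₂)) / G * (u k ^ p * Real.exp (-u k)) := by ring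
      _ ≤ _ := by
          gcongr
          exact le_add_of_nonneg_right (by positivity)
  · intro hqk hk
    have hj : 1 ≤ k - q := by omega
    have hjd := hud _ hj
    have hj0 : 0 < u (k - q) := hd.trans_le hjd
    obtain ⟨hm0, hm⟩ := hcross (q := q) (m := m) (by omega)
    have h1 : |poissonCov C p u q m k|
        ≤ C * K₁ / d * (u (k - q) ^ (p + 1) * Real.exp (-u (k - q))) := by
      refine (abs_poissonCov_le hmk hqk (hpos (by omega) (by linarith)).le).trans
        ((hf₁ q _ hj).trans ?_)
      rw [Real.rpow_add_one hj0.ne', div_mul_eq_mul_div, le_div_iff₀ hd]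
      calc _ ≤ C * K₁ * (u (k - q) ^ p * Real.exp (-u (k - q))) * u (k - q) := by gcongr
        _ = _ := by ring
    have hk' : crossVec C p u q k
        ≤ C * (K₁ + K₂) * (u (k - q) ^ (p + 1) * Real.exp (-u (k - q))) := by
      rw [crossVec, if_neg (by omega)]
      refine (hf₂ q _ hj).trans ?_
      gcongr
      linarith
    have h2 : |crossVec C p u q m * crossVec C p u q k / G|
        ≤ (G₁ + G) * (C * (K₁ + K₂)) / G * (u (k - q) ^ (p + 1) * Real.exp (-u (k - q))) := by
      have hk0 := (hcross (q := q) (m := k) (by omega)).1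
      rw [abs_of_nonneg (div_nonneg (mul_nonneg hm0 hk0) hG0.le)]
      calc _ ≤ (G₁ + G) * (C * (K₁ + K₂)
            * (u (k - q) ^ (p + 1) * Real.exp (-u (k - q)))) / G := by gcongr
        _ = _ := by ring
    rw [theta_eq]
    refine (abs_sub _ _).trans ?_
    rw [add_mul]
    linarith

theorem abs_theta_lt (hC : 0 < C) (hp : 0 < p) (hd : 0 < d) (hu : ∀ j, u j = j * d)
    {q m k k' : ℕ} (hmk : m < k) (hkk' : k < k') :
    (p ≤ u k → k' < q → |theta C p u q m k'| < |theta C p u q m k|) ∧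
    (q < k → p + 1 ≤ u (k - q) → k' < 2 * q → k' ≠ m + q →
      |theta C p u q m k'| < |theta C p u q m k|) := by
  have hu0 : u 0 = 0 := by rw [hu]; simp
  have hmono : ∀ j, u j < u (j + 1) := fun j => by rw [hu, hu]; push_cast; nlinarith
  have hpos : ∀ {j : ℕ} {s : ℝ}, j ≤ q → -1 < s → 0 < fInt C u q j s := fun hj hs =>
    fInt_pos hC hu0 (fun i _ => hmono i) hj hs
  have hG0 : 0 < C * Real.Gamma (p + 2) :=
    mul_pos hC (Real.Gamma_pos_of_pos (by linarith))
  have hcross : ∀ {i : ℕ}, i ≤ 2 * q → 0 < crossVec C p u q i := by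
    intro i hi
    rw [crossVec]
    split_ifs with h
    · exact hpos h (by linarith)
    · exact hpos (by omega) (by linarith)
  have habs : ∀ {i : ℕ}, i ≤ 2 * q → m ≤ 2 * q → poissonCov C p u q m i = 0 →
      |theta C p u q m i|
        = crossVec C p u q m * crossVec C p u q i / (C * Real.Gamma (p + 2)) := by
    intro i hi hm h0
    rw [theta_eq, h0, zero_sub, abs_neg,
      abs_of_pos (div_pos (mul_pos (hcross hm) (hcross hi)) hG0)]
  refine ⟨fun hpu hk' => ?_, fun hqk hpu hk' hne => ?_⟩
  · have h0 : ∀ i, m < i → i ≤ q → poissonCov C p u q m i = 0 := fun i hi hiq => by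
      rw [poissonCov, if_pos (by omega), if_pos hiq, if_neg hi.ne]
    rw [habs (by omega) (by omega) (h0 k hmk (by omega)),
      habs (by omega) (by omega) (h0 k' (by omega) (by omega))]
    have hm := hcross (i := m) (by omega)
    have h : crossVec C p u q k' < crossVec C p u q k := by
      rw [crossVec, crossVec, if_pos (by omega), if_pos (by omega)]
      exact fInt_lt_of_equidistant hC hd hu hp hpu hkk' hk'
    gcongr
  · have h0 : ∀ i, m < i → q < i → i ≠ m + q → poissonCov C p u q m i = 0 := by
      intro i hi hqi him
      rw [poissonCov]
      split_ifs
      all_goals first | omega | rfl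
    have hm := hcross (i := m) (by omega)
    have hc : ∀ {i}, q < i → crossVec C p u q i = fInt C u q (i - q) (p + 1) := fun hi => by
      rw [crossVec, if_neg (by omega)]
    have hlt : fInt C u q (k' - q) (p + 1) < fInt C u q (k - q) (p + 1) :=
      fInt_lt_of_equidistant hC hd hu (by linarith) hpu (by omega) (by omega)
    rw [habs (by omega) (by omega) (h0 k' (by omega) (by omega) hne), hc (hqk.trans hkk')]
    by_cases hk : k = m + q
    · -- Here `k` is the mass of the stratum of `m`; the stratum `0` makes the inequality strict.
      have hkq : k - q = m := by omega
      rw [hkq] at hlt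
      have hsum := sum_fInt hC hp hu0 (q := q) fun i _ => hmono i
      have h3 : ∑ j ∈ ({0, m, k' - q} : Finset ℕ), fInt C u q j (p + 1)
          ≤ ∑ j ∈ Finset.range (q + 1), fInt C u q j (p + 1) := by
        refine Finset.sum_le_sum_of_subset_of_nonneg ?_ fun j hj _ =>
          (hpos (by rw [Finset.mem_range] at hj; omega) (by linarith)).le
        intro j hj
        simp only [Finset.mem_insert, Finset.mem_singleton] at hj
        rw [Finset.mem_range]
        omega
      rw [Finset.sum_insert (by simp; omega), Finset.sum_insert (by simp; omega),
        Finset.sum_singleton, hsum] at h3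
      have hp0 : 0 < fInt C u q 0 (p + 1) := hpos (by omega) (by linarith)
      have e : theta C p u q m k = crossVec C p u q m
          * (C * Real.Gamma (p + 2) - fInt C u q m (p + 1)) / (C * Real.Gamma (p + 2)) := by
        have hmq : m ≤ q := by omega
        rw [theta_eq, hc hqk, poissonCov, if_pos hmq, if_neg (by omega), if_pos hkq.symm, hkq]
        have : crossVec C p u q m = fInt C u q m p := by rw [crossVec, if_pos hmq]
        rw [this]
        field_simp
      refine lt_of_lt_of_le ?_ (le_abs_self _)
      rw [e]
      gcongr
      linarith
    · rw [habs (by omega) (by omega) (h0 k hmk hqk hk), hc hqk]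
      gcongr

end

end GibbsPartition

theorem theorem4p1 (C p : ℝ) (hC : 0 < C) (hp : 0 < p)
    (a : ℕ → ℝ) (ha : ∀ k, 1 ≤ k → 0 < a k)
    (hasymp : a ~[atTop] fun k : ℕ => C * (k : ℝ) ^ (p - 1)) :
    -- (i), (ii), (iii)
    (∀ (q : ℕ), 1 ≤ q → ∀ (u : ℕ → ℝ), u 0 = 0 → (∀ j < q, u j < u (j + 1)) →
      ∀ (δ : ℕ → ℝ),
      ((fun N : ℕ => (∑ k ∈ Finset.Icc 1 N, (k : ℝ) * a k * Real.exp (-δ N * k)) - (N : ℝ)) =o[atTop]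
        fun N : ℕ => (N : ℝ) ^ ((p + 2) / (2 * (p + 1)))) →
      -- (i) conditional independence of the scaled counts given the scaled masses
      (∀ (N : ℕ) (x y : Fin (q + 1) → ℝ),
        gibbsMeasure a ha N {η | ∀ i : Fin (q + 1), scaledMass a C p u q (δ N) i η = y i} ≠ 0 →
        cond (gibbsMeasure a ha N) {η | ∀ i : Fin (q + 1), scaledMass a C p u q (δ N) i η = y i}
            {η | ∀ j : Fin (q + 1), scaledCount a C p u q (δ N) j η = x j}
          = ∏ j : Fin (q + 1), cond (gibbsMeasure a ha N)
              {η | ∀ i : Fin (q + 1), scaledMass a C p u q (δ N) i η = y i}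
              {η | scaledCount a C p u q (δ N) j η = x j} ∧
        cond (gibbsMeasure a ha N) {η | ∀ i : Fin (q + 1), scaledMass a C p u q (δ N) i η = y i}
            {η | ∀ j : Fin (q + 1), scaledCount a C p u q (δ N) j η = x j}
          = ∏ j : Fin (q + 1), cond (gibbsMeasure a ha N)
              {η | scaledMass a C p u q (δ N) j η = y j}
              {η | scaledCount a C p u q (δ N) j η = x j}) ∧
      -- (ii) the central limit theorem
      (covMatrix C p u q).PosSemidef ∧
      TendstoInDistribution (fun (N : ℕ) (η : N.Partition) => scaledVector a C p u q (δ N) η) atTop id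
        (fun N : ℕ => gibbsMeasure a ha N) (multivariateGaussian 0 (covMatrix C p u q)) ∧
      -- (iii) convergence of all mixed moments, and of the covariances
      (∀ α : Fin (2 * q + 1) → ℕ,
        Tendsto (fun N : ℕ => ∫ η : N.Partition,
            ∏ i, (scaledVector a C p u q (δ N) η) i ^ α i ∂gibbsMeasure a ha N)
          atTop (𝓝 (∫ z : EuclideanSpace ℝ (Fin (2 * q + 1)), ∏ i, z i ^ α i
            ∂multivariateGaussian 0 (covMatrix C p u q)))) ∧
      (∀ m k : Fin (2 * q + 1),
        Tendsto (fun N : ℕ => cov[fun η : N.Partition => (scaledVector a C p u q (δ N) η) m,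
            fun η : N.Partition => (scaledVector a C p u q (δ N) η) k; gibbsMeasure a ha N])
          atTop (𝓝 (theta C p u q m k)))) ∧
    -- (iv) decay of the limiting covariances for equidistant points `u_j = j d`
    (∀ (d : ℝ), 0 < d → ∀ (u : ℕ → ℝ), (∀ j, u j = j * d) →
      -- exponential bounds, with a constant that does not depend on `q`, `m`, `k`
      (∃ A : ℝ, ∀ q m k : ℕ, 1 ≤ q → m < k →
        (k ≤ q → |theta C p u q m k| ≤ A * (u k ^ p * Real.exp (-u k))) ∧
        (q < k → k ≤ 2 * q →
          |theta C p u q m k| ≤ A * (u (k - q) ^ (p + 1) * Real.exp (-u (k - q))))) ∧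
      -- monotone decay in `k` once the mode of the integrand is passed
      (∀ q m k k' : ℕ, 1 ≤ q → m < k → k < k' →
        (p ≤ u k → k' < q → |theta C p u q m k'| < |theta C p u q m k|) ∧
        (q < k → p + 1 ≤ u (k - q) → k' < 2 * q → k' ≠ m + q →
          |theta C p u q m k'| < |theta C p u q m k|))) := by
  refine ⟨fun q _ u hu0 hu δ hδ => ?_, fun d hd u hu => ?_⟩
  · obtain ⟨h1, h2⟩ := tendsto_tilt_mul_scaling hC hp ha hasymp hδ
    exact ⟨fun N x y hne => cond_scaledMass_scaledCount hC hp ha hu0 hu (δ N) N x y hne,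
      posSemidef_covMatrix hC hp ha hasymp hu0 hu h1,
      tendstoInDistribution_scaledVector hC hp ha hasymp hu0 hu h1 h2,
      tendsto_moment_scaledVector hC hp ha hasymp hu0 hu h1 h2,
      tendsto_covariance_scaledVector hC hp ha hasymp hu0 hu h1 h2⟩
  · exact ⟨exists_abs_theta_le hC hp hd hu,
      fun q m k k' _ hmk hkk' => abs_theta_lt hC hp hd hu hmk hkk'⟩
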